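/- **Setting.** Let $M=(\mathcal S,\mathcal A,p,\nu)$ be a finite communicating MDP with $S\ge 2$ states and $A\ge 1$ actions, transition probabilities $p(x|s,a)$ and reward laws $\nu(s,a)$ supported on $[0,1]$. "Policy" means stationary deterministic policy $\pi:\mathcal S\to\mathcal A$. Let $g^\star$ be the optimal long-run average reward. For states $x\ne y$ let $\tau(x,y)=\min_\pi\mathbb E[T^\pi(x,y)]$, where $T^\pi(x,y)$ is the number of steps needed to reach $y$ from $x$ under $\pi$. Put $\mathcal K_{s,a}=\{x:p(x|s,a)>0\}$, $K=\max_{s,a}|\mathcal K_{s,a}|$, $$D=\max_{x\ne y}\tau(x,y),\qquad D_s=\max_{x\neq y\in\bigcup_a\mathcal K_{s,a}}\tau(x,y)\ \ (0\text{ if there is no such pair}),\qquad L_{s,a}=\Big(\sum_x\sqrt{p(x|s,a)(1-p(x|s,a))}\Big)^2 .$$ A learner observes $s_1$ and at each time $t=1,2,\dots$ chooses $a_t$ from its past (and possibly independent randomness); then, given the past, $r_t\sim\nu(s_t,a_t)$ and $s_{t+1}\sim p(\cdot|s_t,a_t)$ are drawn independently. Its regret after $T$ steps is $\mathfrak R(T)=Tg^\star-\sum_{t\le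 T}r_t$. **Confidence sets.** Let $\delta\in(0,1)$, $\delta'=\frac{\delta}{(3+3S)SA}$, $\eta=1.12$, $$\ell_n=\eta\log\frac{\log(n)\log(\eta n)}{\log^2(\eta)\,\delta'}\ (n\ge2),\qquad \beta_n=\sqrt{\tfrac2n\big(1+\tfrac1n\big)\log\big(\sqrt{n+1}/\delta'\big)},$$ $g(q)=\frac{1/2-q}{\log(1/q-1)}$ (extended continuously to $q=0,\frac12,1$), $\underline g(q)=g(q)$ if $q<\frac12$ and $q(1-q)$ otherwise. For a time $t$, let $n=N_t(s,a)$ be the number of plays of $(s,a)$ before $t$, replaced by $1$ if there is none, and let $\hat\mu_t,\hat\sigma_t^2,\hat p_t$ be the empirical mean and variance of the rewards and the empirical transition frequencies of $(s,a)$ before $t$ ($\hat p_t=0$ without observation). Let $$c_t(s,a)=\Big\{m\in[0,1]:|\hat\mu_t(s,a)-m|\le\max\Big(\tfrac12\beta_n,\ \sqrt{\tfrac{2\hat\sigma_t^2(s,a)}{n}\ell_n}+\tfrac{7\ell_n}{3n}\Big)\Big\},$$ and let $C_t(s,a,x)$ be the set of $q\in[0,1]$ with $$|\hat p_t(x|s,a)-q|\le\sqrt{\tfrac{2q(1-q)}n\ell_n}+\tfrac{\ell_n}{3n}\quad\text{and}\quad-\sqrt{g(q)}\,\beta_n\le\hat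 p_t(x|s,a)-q\le\sqrt{\underline g(q)}\,\beta_n .$$ For $n=1$ the expressions with $\ell_n$ are omitted, and both sets are $[0,1]$ if $(s,a)$ has not been played. **Planning (EVI-NOSS) at time $t$.** Write $\mathbb S(f)=\max f-\min f$. Start from $u_0=0$. Given $u_i$, put $f=u_i-\min u_i$, and for each $(s,a)$ and $\mathcal T\subseteq\mathcal S$ let $\overline f(\mathcal T)$ be the maximum of $\sum_{x\in\mathcal T}f(x)q(x)$ over $q$ with $q(x)\in C_t(s,a,x)$ for $x\in\mathcal T$ and $\sum_{x\in\mathcal T}q(x)\le1$. NOSS starts from the set $\widetilde{\mathcal S}$ consisting of the support of $\hat p_t(\cdot|s,a)$ and one maximizer of $f$, and as long as $\widetilde{\mathcal S}\ne\mathcal S$ and $\overline f(\mathcal S\setminus\widetilde{\mathcal S})\ge\min(\kappa,\overline f(\widetilde{\mathcal S}))$ it adds to $\widetilde{\mathcal S}$ a maximizer of $f$ outside $\widetilde{\mathcal S}$; here $\kappa=10\,\mathbb S(u_i)\,|\mathrm{supp}\,\hat p_t(\cdot|s,a)|/\max_{s',a'}N_t(s',a')^{2/3}$. With the resulting sets $\widetilde{\mathcal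 S}_{s,a}$, let $Q_i(s,a)=\max c_t(s,a)+\max_{p'}\sum_xp'(x)u_i(x)$, where $p'$ ranges over the probability distributions that vanish outside $\widetilde{\mathcal S}_{s,a}$ and satisfy $p'(x)\in C_t(s,a,x)$ for all $x$. Put $u_{i+1}(s)=\max_aQ_i(s,a)$. At the first $i\ge0$ with $\mathbb S(u_{i+1}-u_i)\le1/\sqrt t$ the planner returns a policy $\pi$ with $\pi(s)\in\arg\max_aQ_i(s,a)$ for all $s$. Ties are broken arbitrarily, using only information available at time $t$. **UCRL3.** The first episode starts at time $1$. At the start $t_k$ of episode $k$ the policy $\pi_k$ is planned as above with $t=t_k$; it is played until the first time $t>t_k$ at which the pair $(s_t,\pi_k(s_t))$ has already been played at least $N_{t_k}(s_t,\pi_k(s_t))$ times in the episode; this $t$ starts episode $k+1$. UCRL3 *runs up to* $T$ if all planning calls made at times $t_k\le T$ terminate. **Theorem.** There are universal constants $C_1,C_2>0$ such that for every such $M$ and every $\delta\in(0,1)$ there is $T_0$, depending only on $M$ and $\delta$, such that with probability at least $1-4\delta$ the following holds simultaneously for all $T\ge3$ up to which UCRL3 runs: $$\mathfrak R(T)\le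 c\sqrt{T\log\Big(\frac{6S^2A\sqrt{T+1}}\delta\Big)}+60\,D\,K\,S^{2/3}A^{2/3}T^{1/3}+C_1\,D\,S^2A\log^2(T/\delta),\qquad c=5\sqrt{\sum_{s,a}D_s^2L_{s,a}}+10\sqrt{SA}+2D,$$ and, if moreover $T\ge T_0$, $$\mathfrak R(T)\le C_2\Big(\sqrt{\sum_{s,a}\max(D_s^2L_{s,a},1)}+D\Big)\sqrt{T\log(\sqrt T/\delta)} .$$ -/

import Mathlib

open MeasureTheory Filter
open scoped ENNReal

noncomputable section

/-! ## Markov decision processes -/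

/-- A finite MDP: transition probabilities `p s a`, reward laws `ν s a` supported on `[0,1]`. -/
structure MDP (S A : Type*) [Fintype S] where
  p : S → A → S → ℝ
  p_mem : ∀ s a, p s a ∈ stdSimplex ℝ S
  ν : S → A → Measure ℝ
  ν_prob : ∀ s a, IsProbabilityMeasure (ν s a)
  ν_supp : ∀ s a, ν s a (Set.Icc 0 1)ᶜ = 0

namespace MDP

variable {S A : Type*} [Fintype S] [DecidableEq S] [Fintype A]

/-- Mean reward. -/
def mean (M : MDP S A) (s : S) (a : A) : ℝ := ∫ x, x ∂(M.ν s a)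

/-- Transition matrix of a stationary deterministic policy. -/
def policyMatrix (M : MDP S A) (π : S → A) : Matrix S S ℝ := Matrix.of fun s x => M.p s (π s) x

/-- Every state is reachable from every state under some policy. -/
def Communicating (M : MDP S A) : Prop :=
  ∀ x y : S, ∃ (π : S → A) (n : ℕ), 0 < (M.policyMatrix π ^ n) x y

/-- Long-run average expected reward of `π` from the initial state `s`. -/
def gain (M : MDP S A) (π : S → A) (s : S) : ℝ :=
  limsup (fun n : ℕ => (∑ t ∈ Finset.range n,
    (M.policyMatrix π ^ t).mulVec (fun x => M.mean x (π x)) s) / n) atTop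

/-- Optimal gain from `s` (in a communicating MDP it does not depend on `s`). -/
def optGain (M : MDP S A) (s : S) : ℝ := ⨆ π : S → A, M.gain π s

/-- Probability that `y` has not been visited in the first `n` steps from `x` under `π`. -/
def notHit (M : MDP S A) (π : S → A) (y : S) : ℕ → S → ℝ
  | 0, x => if x = y then 0 else 1
  | n + 1, x => if x = y then 0 else ∑ z, M.p x (π x) z * M.notHit π y n z

/-- Expected time to reach `y` from `x` under `π`, as the sum of the tail probabilities. -/
def expHit (M : MDP S A) (π : S → A) (x y : S) : ℝ≥0∞ :=
  ∑' n : ℕ, ENNReal.ofReal (M.notHit π y n x)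

/-- Smallest expected time to reach `y` from `x`. -/
def minHit (M : MDP S A) (x y : S) : ℝ≥0∞ := ⨅ π : S → A, M.expHit π x y

/-- Diameter (finite for communicating MDPs). -/
def diam (M : MDP S A) : ℝ := (⨆ (x : S) (y : S) (_ : x ≠ y), M.minHit x y).toReal

/-- Successor states of a pair. -/
def succs (M : MDP S A) (s : S) (a : A) : Finset S := Finset.univ.filter fun x => 0 < M.p s a x

/-- `K`, the largest number of successor states of a pair. -/
def maxSuccs (M : MDP S A) : ℕ :=
  Finset.univ.sup fun s => Finset.univ.sup fun a => (M.succs s a).card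

/-- Local diameter of `s`, over ordered pairs of distinct one-step successors of `s`
(`0` if there is no such pair). -/
def localDiam (M : MDP S A) (s : S) : ℝ :=
  (⨆ (x : S) (y : S) (_ : (∃ a, x ∈ M.succs s a) ∧ (∃ a, y ∈ M.succs s a) ∧ x ≠ y),
    M.minHit x y).toReal

/-- Local effective support. -/
def effSupp (M : MDP S A) (s : S) (a : A) : ℝ :=
  (∑ x, √(M.p s a x * (1 - M.p s a x))) ^ 2

end MDP

/-! ## Trajectories and empirical quantities -/

/-- A trajectory; times are `1, 2, …`, the entries at time `0` are never used. -/
structure Trajectory (S A : Type*) where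
  st : ℕ → S
  act : ℕ → A
  rew : ℕ → ℝ

namespace Trajectory

variable {S A : Type*} [DecidableEq S] [DecidableEq A]

/-- Times `i` with `lo ≤ i < hi` at which `(x, b)` is played. -/
def visits (h : Trajectory S A) (lo hi : ℕ) (x : S) (b : A) : Finset ℕ :=
  (Finset.Ico lo hi).filter fun i => h.st i = x ∧ h.act i = b

/-- `N_t(x, b)`, at least one by convention. -/
def N (h : Trajectory S A) (t : ℕ) (x : S) (b : A) : ℕ := max 1 (h.visits 1 t x b).card

/-- Empirical mean reward. -/
def rHat (h : Trajectory S A) (t : ℕ) (x : S) (b : A) : ℝ :=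
  (∑ i ∈ h.visits 1 t x b, h.rew i) / h.N t x b

/-- Empirical variance of the reward. -/
def varHat (h : Trajectory S A) (t : ℕ) (x : S) (b : A) : ℝ :=
  (∑ i ∈ h.visits 1 t x b, (h.rew i - h.rHat t x b) ^ 2) / h.N t x b

/-- Empirical transition frequencies (identically zero for a pair without observation). -/
def pHat (h : Trajectory S A) (t : ℕ) (x : S) (b : A) (y : S) : ℝ :=
  (((h.visits 1 t x b).filter fun i => h.st (i + 1) = y).card : ℝ) / h.N t x b

end Trajectory

/-! ## Confidence sets -/

namespace UCRL3

/-- `ℓ_n(δ)` with `η = 1.12`; only used for `n ≥ 2`, since `ℓ_1` is not defined. -/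
def ell (n : ℕ) (δ : ℝ) : ℝ :=
  1.12 * Real.log (Real.log n * Real.log (1.12 * n) / (Real.log 1.12 ^ 2 * δ))

/-- `β_n(δ)`. -/
def beta (n : ℕ) (δ : ℝ) : ℝ :=
  √(2 * (1 + 1 / (n : ℝ)) * Real.log (√((n : ℝ) + 1) / δ) / n)

/-- `g(q) = (1/2 - q) / log (1/q - 1)`, extended by continuity to `0`, `1/2` and `1`. -/
def g (q : ℝ) : ℝ :=
  if q = 0 ∨ q = 1 then 0 else if q = 1 / 2 then 1 / 4 else (1 / 2 - q) / Real.log (1 / q - 1)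

/-- The refined variance proxy of the upper tail. -/
def gLow (q : ℝ) : ℝ := if q < 1 / 2 then g q else q * (1 - q)

variable {S A : Type*} [DecidableEq S] [DecidableEq A]

/-- Half-width of the reward confidence interval at level `δ'`. -/
def rewRadius (h : Trajectory S A) (t : ℕ) (δ' : ℝ) (x : S) (b : A) : ℝ :=
  let n := h.N t x b
  max (beta n δ' / 2)
    (if 2 ≤ n then √(2 * h.varHat t x b / n * ell n δ') + 7 * ell n δ' / (3 * n) else 0)

/-- Confidence set of the mean reward of `(x, b)`; no constraint without an observation. -/
def rewSet (h : Trajectory S A) (t : ℕ) (δ' : ℝ) (x : S) (b : A) : Set ℝ :=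
  {m | m ∈ Set.Icc (0 : ℝ) 1 ∧ ((h.visits 1 t x b).Nonempty →
    |h.rHat t x b - m| ≤ rewRadius h t δ' x b)}

/-- Confidence set of `p(y | x, b)`; no constraint without an observation, and the Bernstein
constraint is void for one observation. -/
def transSet (h : Trajectory S A) (t : ℕ) (δ' : ℝ) (x : S) (b : A) (y : S) : Set ℝ :=
  {q | q ∈ Set.Icc (0 : ℝ) 1 ∧ ((h.visits 1 t x b).Nonempty →
    let n := h.N t x b
    (2 ≤ n → |h.pHat t x b y - q| ≤
      √(2 * q * (1 - q) / n * ell n δ') + ell n δ' / (3 * n)) ∧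
    -√(g q) ≤ (h.pHat t x b y - q) / beta n δ' ∧
    (h.pHat t x b y - q) / beta n δ' ≤ √(gLow q))}

/-! ## Planning: NOSS and EVI-NOSS -/

variable [Fintype S] [Fintype A]

/-- Span seminorm. -/
def span (f : S → ℝ) : ℝ := (⨆ s, f s) - ⨅ s, f s

/-- `f̄(T)`: best value of `∑_{x ∈ T} f(x) q(x)` over sub-probabilities `q` on `T` compatible
with the confidence sets `C`. -/
def fbar (C : S → Set ℝ) (f : S → ℝ) (T : Finset S) : ℝ :=
  sSup {v | ∃ q : S → ℝ, (∀ x ∈ T, q x ∈ C x) ∧ ∑ x ∈ T, q x ≤ 1 ∧ v = ∑ x ∈ T, f x * q x}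

/-- Guard of the NOSS loop (the loop also stops when no state is left to be added). -/
def NossGuard (C : S → Set ℝ) (f : S → ℝ) (κ : ℝ) (T : Finset S) : Prop :=
  T ≠ Finset.univ ∧ min κ (fbar C f T) ≤ fbar C f (Finset.univ \ T)

/-- Supports visited by NOSS started from the support `T₀`, for some resolution of ties. -/
inductive NossVisits (C : S → Set ℝ) (f : S → ℝ) (T₀ : Finset S) (κ : ℝ) : Finset S → Prop
  | start (m : S) (hm : ∀ x, f x ≤ f m) : NossVisits C f T₀ κ (insert m T₀)
  | step (T : Finset S) (hT : NossVisits C f T₀ κ T) (hguard : NossGuard C f κ T)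
      (y : S) (hy : y ∉ T) (hmax : ∀ x, x ∉ T → f x ≤ f y) : NossVisits C f T₀ κ (insert y T)

/-- `T` is a possible output of NOSS. -/
def IsNossOutput (C : S → Set ℝ) (f : S → ℝ) (T₀ : Finset S) (κ : ℝ) (T : Finset S) : Prop :=
  NossVisits C f T₀ κ T ∧ ¬ NossGuard C f κ T

/-- Largest expectation of `u` over the distributions that are compatible with `C` and vanish
outside `T`. -/
def optExp (C : S → Set ℝ) (T : Finset S) (u : S → ℝ) : ℝ :=
  sSup {v | ∃ q ∈ stdSimplex ℝ S, (∀ x, q x ∈ C x) ∧ (∀ x, x ∉ T → q x = 0) ∧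
    v = ∑ x, q x * u x}

/-- Support of `q`. -/
def supp (q : S → ℝ) : Finset S := Finset.univ.filter fun x => 0 < q x

/-- Optimistic value `μ⁺(s, a) + (P⁺ u)(s, a)` for the supports `T`. -/
def qValue (c : S → A → Set ℝ) (C : S → A → S → Set ℝ) (T : S → A → Finset S) (u : S → ℝ)
    (s : S) (a : A) : ℝ :=
  sSup (c s a) + optExp (C s a) (T s a) u

/-- `π` is a policy that EVI-NOSS, run with empirical transitions `ph`, confidence sets `c`, `C`,
largest count `Nmax` and accuracy `ε`, can return (for some resolution of ties): the iterates are
`u 0, …, u (n + 1)`, and `n + 1` is the first index at which the stopping test succeeds. -/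
def IsEviNossOutput (ph : S → A → S → ℝ) (c : S → A → Set ℝ) (C : S → A → S → Set ℝ)
    (Nmax : ℕ) (ε : ℝ) (π : S → A) : Prop :=
  ∃ (n : ℕ) (u : ℕ → S → ℝ) (T : ℕ → S → A → Finset S),
    u 0 = 0 ∧
    (∀ i ≤ n, ∀ s a, IsNossOutput (C s a) (fun x => u i x - ⨅ y, u i y) (supp (ph s a))
      (10 * span (u i) * (supp (ph s a)).card / (Nmax : ℝ) ^ (2 / 3 : ℝ)) (T i s a)) ∧
    (∀ i ≤ n, ∀ s, u (i + 1) s = ⨆ a, qValue c C (T i) (u i) s a) ∧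
    (∀ i < n, ε < span (u (i + 1) - u i)) ∧
    span (u (n + 1) - u n) ≤ ε ∧
    ∀ s a, qValue c C (T n) (u n) s a ≤ qValue c C (T n) (u n) s (π s)

/-! ## The algorithm -/

/-- `π` is a policy that the planner of UCRL3 with input `δ` can return at the start `t` of an
episode, given the observations made before `t`. -/
def IsPlan (δ : ℝ) (h : Trajectory S A) (t : ℕ) (π : S → A) : Prop :=
  let δ₀ := δ / (3 + 3 * (Fintype.card S : ℝ))
  let δ' := δ₀ / ((Fintype.card S : ℝ) * Fintype.card A)
  IsEviNossOutput (h.pHat t) (rewSet h t δ') (transSet h t δ')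
    (Finset.univ.sup fun s => Finset.univ.sup fun a => h.N t s a) (1 / √(t : ℝ)) π

/-- First time of the episode that contains time `t`, when the policy `pol t` is in force at time
`t`. The episode goes on at `t + 1` as long as the number of plays in this episode of the pair
to be played next is smaller than its count at the start of the episode. -/
def episodeStart (h : Trajectory S A) (pol : ℕ → S → A) : ℕ → ℕ
  | 0 => 0
  | t + 1 =>
    let k := episodeStart h pol t
    let x := h.st (t + 1)
    let b := pol t x
    if 0 < t ∧ (h.visits k (t + 1) x b).card < h.N k x b then k else t + 1

/-- The first `T` steps of `h` are an execution of UCRL3 with input `δ`, in which `pol t` is the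
policy in force at time `t`. In particular all planning calls made up to time `T` have returned. -/
def RunsUpTo (δ : ℝ) (h : Trajectory S A) (pol : ℕ → S → A) (T : ℕ) : Prop :=
  ∀ t ∈ Finset.Icc 1 T, h.act t = pol t (h.st t) ∧
    (episodeStart h pol t = t → IsPlan δ h t (pol t)) ∧
    (episodeStart h pol t ≠ t → pol t = pol (t - 1))

end UCRL3

/-! ## Interaction of a learner with an MDP -/

/-- The random trajectory `h` is an interaction with `M`: `ℱ t` contains what is known when the
action of time `t` has been chosen, and given `ℱ t` the reward and the next state are independent
with laws `M.ν s_t a_t` and `M.p s_t a_t`. -/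
structure IsInteraction {S A Ω : Type*} [Fintype S] {mΩ : MeasurableSpace Ω} (M : MDP S A)
    (P : Measure Ω) (ℱ : Filtration ℕ mΩ) (h : Ω → Trajectory S A) : Prop where
  st_meas : ∀ t ≥ 1, ∀ x, MeasurableSet[ℱ t] {ω | (h ω).st t = x}
  act_meas : ∀ t ≥ 1, ∀ b, MeasurableSet[ℱ t] {ω | (h ω).act t = b}
  rew_meas : ∀ t ≥ 1, Measurable[ℱ (t + 1)] fun ω => (h ω).rew t
  law : ∀ t ≥ 1, ∀ F, MeasurableSet[ℱ t] F → ∀ (x : S) (b : A) (y : S) (B : Set ℝ),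
    MeasurableSet B →
    P (F ∩ {ω | (h ω).st t = x ∧ (h ω).act t = b ∧ (h ω).rew t ∈ B ∧ (h ω).st (t + 1) = y}) =
      P (F ∩ {ω | (h ω).st t = x ∧ (h ω).act t = b}) * (M.ν x b B * ENNReal.ofReal (M.p x b y))

/-- Regret after `T` steps. -/
def regret {S A : Type*} [Fintype S] [DecidableEq S] [Fintype A] (M : MDP S A) (h : Trajectory S A)
    (T : ℕ) : ℝ :=
  T * M.optGain (h.st 1) - ∑ t ∈ Finset.Icc 1 T, h.rew t

end

/-!
# Regret of UCRL3

The bound is proved pathwise on a good event, and the good event fails with probability at most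
`4 δ`.

*The good event.* The sums of centred rewards of a pair, of centred indicators of its successor
states, and of the increments of the bias along the run are all controlled in the same way. A bound
for the conditional moment generating function makes `exp (l s - l² v n / 2)`, or its Bernstein
variant, a nonnegative supermartingale (`IsTest`), and Ville's inequality (`IsTest.ville`) bounds
the probability that it is ever large. Mixing over `l` with a Gaussian weight gives the radius
`beta` (`laplace_bound`); Bernstein exponents on geometric slices of the count give `ell`
(`bernstein_bound`). For the proxy `g` the moment bound is the Kearns–Saul inequality
(`bernMgf_le_kearnsSaul`), and for the proxy `gLow` of the other tail it is `bernMgf_le_gLow`.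
Independence of samples is never used: integrals over events of the filtration suffice, so that
the learner may be arbitrary. The result is `measure_not_modelInConfSets`. The two martingales of
the regret itself are `martingale_reward` and `martingale_bias`; the bias has to be a function of
the discrete data of the current episode in order to be predictable (`chosenBias`), because the
iterates of the planner depend on the observed rewards and on the resolution of ties.

*The planner.* On the good event the restriction of supports costs at most
`10 K / Nmax^{2/3}` times the span in each update (`le_optExp_of_noss`). Once this cost is small
against the diameter, the stopping rule alone shows that the last iterate grows at most like `1.38`
times the shortest hitting times (`MDP.sub_le_mul_expHit`) and that the returned policy is
optimistic up to the accuracy, the cost of NOSS and a surplus of the played pair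
(`exists_optimisticBias`). The surplus is governed by the local diameter, since only differences of
the bias between successors of the pair enter, and by the effective support, through the
Bernstein radii.

*Summation.* In an episode every count at most doubles, so a potential argument
(`sum_episodes_le`) sums the weights read at the starts of the episodes: `√n` for the leading part,
with the factor `1 + √2`, a logarithm for the part of lower order, and `n^{1/3}` for the cost of
NOSS. In the early episodes, in which that cost is not yet small, the same potential `n^{1/3}` pays
for the trivial bound `1` on the regret of a step (`cubeRootPotential_add_le`). The biases telescope
within the episodes, of which there are logarithmically many (`card_episodes_le`). The
Cauchy–Schwarz inequality over the pairs gives the leading term, and runs that are too short for the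
asymptotic comparison of the logarithms are covered by the term of lower order.
-/

set_option linter.unusedSectionVars false

noncomputable section

/-! ### Analytic inequalities for Bernoulli variables -/

theorem le_of_hasDerivAt_nonneg {f f' : ℝ → ℝ} {a b : ℝ} (hab : a ≤ b)
    (hf : ∀ x, HasDerivAt f (f' x) x) (h : ∀ x, a < x → x < b → 0 ≤ f' x) : f a ≤ f b := by
  have hm : MonotoneOn f (Set.Icc a b) := by
    refine monotoneOn_of_deriv_nonneg (convex_Icc a b)
      (fun x _ => (hf x).continuousAt.continuousWithinAt)
      (fun x _ => (hf x).differentiableAt.differentiableWithinAt) ?_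
    intro x hx
    rw [interior_Icc] at hx
    rw [(hf x).deriv]
    exact h x hx.1 hx.2
  exact hm (Set.left_mem_Icc.2 hab) (Set.right_mem_Icc.2 hab) hab

theorem Real.mul_sinh_le_mul_sinh {x y : ℝ} (hx : 0 ≤ x) (hxy : x ≤ y) :
    y * Real.sinh x ≤ x * Real.sinh y := by
  have hd : ∀ z, HasDerivAt (fun z => x * Real.sinh z - z * Real.sinh x)
      (x * Real.cosh z - Real.sinh x) z := fun z => by
    exact (((Real.hasDerivAt_sinh z).const_mul x).sub
      ((hasDerivAt_id z).mul_const (Real.sinh x))).congr_deriv (by simp)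
  have h := le_of_hasDerivAt_nonneg hxy hd (fun z hz _ => by
    have h1 : Real.sinh x ≤ x * Real.cosh x := by
      have hd : ∀ z, HasDerivAt (fun z => z * Real.cosh z - Real.sinh z)
          (1 * Real.cosh z + z * Real.sinh z - Real.cosh z) z := fun z =>
        ((hasDerivAt_id z).mul (Real.hasDerivAt_cosh z)).sub (Real.hasDerivAt_sinh z)
      have := le_of_hasDerivAt_nonneg hx hd (fun z hz _ => by
        have := mul_nonneg hz.le (Real.sinh_nonneg_iff.2 hz.le); linarith)
      simp at this
      linarith
    have h2 : Real.cosh x ≤ Real.cosh z := by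
      rw [Real.cosh_le_cosh, abs_of_nonneg hx, abs_of_nonneg (hx.trans hz.le)]; exact hz.le
    have := mul_le_mul_of_nonneg_left h2 hx
    linarith)
  simp only [mul_comm x (Real.sinh x), sub_self] at h
  linarith

/-- `tanh x / x` is nonincreasing on the positive half-line. -/
theorem Real.mul_tanh_le_mul_tanh {x y : ℝ} (hx : 0 ≤ x) (hxy : x ≤ y) :
    x * Real.tanh y ≤ y * Real.tanh x := by
  have h := Real.mul_sinh_le_mul_sinh (sub_nonneg.2 hxy) (by linarith : y - x ≤ x + y)
  rw [Real.tanh_eq_sinh_div_cosh, Real.tanh_eq_sinh_div_cosh, ← mul_div_assoc, ← mul_div_assoc,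
    div_le_div_iff₀ (Real.cosh_pos _) (Real.cosh_pos _)]
  rw [Real.sinh_sub, Real.sinh_add] at h
  nlinarith

theorem Real.tanh_le_self_of_nonneg {x : ℝ} (hx : 0 ≤ x) : Real.tanh x ≤ x := by
  have hd : ∀ z, HasDerivAt (fun z => z * Real.cosh z - Real.sinh z)
      (1 * Real.cosh z + z * Real.sinh z - Real.cosh z) z := fun z =>
    ((hasDerivAt_id z).mul (Real.hasDerivAt_cosh z)).sub (Real.hasDerivAt_sinh z)
  have := le_of_hasDerivAt_nonneg hx hd (fun z hz _ => by
    have := mul_nonneg hz.le (Real.sinh_nonneg_iff.2 hz.le); linarith)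
  simp at this
  rw [Real.tanh_eq_sinh_div_cosh, div_le_iff₀ (Real.cosh_pos _)]
  linarith

theorem Real.hasDerivAt_log_cosh (x : ℝ) :
    HasDerivAt (fun x => Real.log (Real.cosh x)) (Real.tanh x) x := by
  rw [Real.tanh_eq_sinh_div_cosh]
  exact (Real.hasDerivAt_cosh x).log (Real.cosh_pos x).ne'

/-- `log cosh √z` is concave in `z`: here in the form of its tangent at `θ²`. -/
theorem Real.log_cosh_le_tangent {θ : ℝ} (hθ : 0 < θ) {y : ℝ} (hy : 0 ≤ y) :
    Real.log (Real.cosh y) ≤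
      Real.log (Real.cosh θ) + Real.tanh θ / (2 * θ) * (y ^ 2 - θ ^ 2) := by
  set c := Real.tanh θ / (2 * θ) with hc
  have hc' : c * (2 * θ) = Real.tanh θ := by rw [hc]; field_simp
  have hd : ∀ z, HasDerivAt (fun z => c * z ^ 2 - Real.log (Real.cosh z))
      (c * (2 * z) - Real.tanh z) z := fun z => by
    exact (((hasDerivAt_pow 2 z).const_mul c).sub
      (Real.hasDerivAt_log_cosh z)).congr_deriv (by simp)
  have key : c * θ ^ 2 - Real.log (Real.cosh θ) ≤ c * y ^ 2 - Real.log (Real.cosh y) := by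
    rcases le_total θ y with h | h
    · refine le_of_hasDerivAt_nonneg h hd fun z hz _ => ?_
      have := Real.mul_tanh_le_mul_tanh hθ.le hz.le
      rw [← hc'] at this
      have h2 : θ * (Real.tanh z) ≤ θ * (c * (2 * z)) := by linarith
      have := le_of_mul_le_mul_left h2 hθ
      linarith
    · have hd' : ∀ z, HasDerivAt (fun z => -(c * z ^ 2 - Real.log (Real.cosh z)))
          (-(c * (2 * z) - Real.tanh z)) z := fun z => (hd z).neg
      have := le_of_hasDerivAt_nonneg h hd' (fun z hz hz2 => by
        have hz0 : 0 < z := lt_of_le_of_lt hy hz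
        have := Real.mul_tanh_le_mul_tanh hz0.le hz2.le
        rw [← hc'] at this
        have h2 : θ * (c * (2 * z)) ≤ θ * Real.tanh z := by linarith
        have := le_of_mul_le_mul_left h2 hθ
        linarith)
      linarith
  linarith

theorem Real.cosh_le_cosh_mul_exp {θ : ℝ} (hθ : θ ≠ 0) (y : ℝ) :
    Real.cosh y ≤
      Real.cosh θ * Real.exp (Real.tanh θ / (2 * θ) * (y ^ 2 - θ ^ 2)) := by
  have h := Real.log_cosh_le_tangent (abs_pos.2 hθ) (abs_nonneg y)
  rw [Real.cosh_abs, Real.cosh_abs, sq_abs, sq_abs] at h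
  have h2 : Real.tanh |θ| / (2 * |θ|) = Real.tanh θ / (2 * θ) := by
    rcases abs_choice θ with h | h <;> rw [h]
    rw [Real.tanh_neg, mul_neg, neg_div_neg_eq]
  rw [h2] at h
  have := Real.exp_le_exp.2 h
  rwa [Real.exp_add, Real.exp_log (Real.cosh_pos _), Real.exp_log (Real.cosh_pos _)] at this

/-- Moment generating function of a centred Bernoulli variable of parameter `q`. -/
def bernMgf (q l : ℝ) : ℝ := q * Real.exp (l * (1 - q)) + (1 - q) * Real.exp (-(l * q))

theorem bernMgf_eq (q l : ℝ) : bernMgf q l =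
    Real.exp (l / 2 * (1 - 2 * q)) * (Real.cosh (l / 2) + (2 * q - 1) * Real.sinh (l / 2)) := by
  have h1 : Real.exp (l * (1 - q)) = Real.exp (l / 2 * (1 - 2 * q)) * Real.exp (l / 2) := by
    rw [← Real.exp_add]; ring_nf
  have h2 : Real.exp (-(l * q)) = Real.exp (l / 2 * (1 - 2 * q)) * Real.exp (-(l / 2)) := by
    rw [← Real.exp_add]; ring_nf
  rw [bernMgf, h1, h2, Real.cosh_eq, Real.sinh_eq]
  ring

theorem bernMgf_swap (q l : ℝ) : bernMgf (1 - q) l = bernMgf q (-l) := by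
  unfold bernMgf; ring_nf

/-- The parameter `θ` with `tanh θ = 1 - 2 q`; in it `g q` becomes `tanh θ / (4 θ)`. -/
theorem exists_tanh_eq {q : ℝ} (h0 : 0 < q) (h1 : q < 1) :
    ∃ θ, Real.tanh θ = 1 - 2 * q ∧ Real.log (1 / q - 1) = 2 * θ := by
  refine ⟨Real.log (1 / q - 1) / 2, ?_, by ring⟩
  have hq : 0 < 1 / q - 1 := by rw [sub_pos, lt_div_iff₀ h0]; linarith
  set θ := Real.log (1 / q - 1) / 2 with hθ
  have he : Real.exp θ * Real.exp θ = 1 / q - 1 := by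
    rw [← Real.exp_add, hθ, add_halves, Real.exp_log hq]
  have hp := Real.exp_pos θ
  rw [Real.tanh_eq_sinh_div_cosh, Real.sinh_eq, Real.cosh_eq, Real.exp_neg]
  rw [div_eq_iff (by positivity)]
  have : (Real.exp θ) ^ 2 * q = 1 - q := by rw [pow_two, he]; field_simp
  field_simp
  nlinarith

theorem UCRL3.g_eq {q θ : ℝ} (h0 : 0 < q) (h1 : q < 1) (ht : Real.tanh θ = 1 - 2 * q)
    (hl : Real.log (1 / q - 1) = 2 * θ) (hne : q ≠ 1 / 2) :
    UCRL3.g q = Real.tanh θ / (4 * θ) := by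
  rw [UCRL3.g, if_neg (by rintro (h | h) <;> linarith), if_neg hne, hl, ht]
  rw [show (1:ℝ) / 2 - q = (1 - 2 * q) / 2 by ring, div_div]; ring_nf

theorem tanh_param_ne_zero {q θ : ℝ} (ht : Real.tanh θ = 1 - 2 * q) (hne : q ≠ 1 / 2) :
    θ ≠ 0 := by
  rintro rfl
  rw [Real.tanh_zero] at ht
  exact hne (by linarith)

/-- The Kearns–Saul inequality. -/
theorem bernMgf_le_kearnsSaul {q : ℝ} (h0 : 0 < q) (h1 : q < 1) (l : ℝ) :
    bernMgf q l ≤ Real.exp (l ^ 2 * UCRL3.g q / 2) := by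
  by_cases hne : q = 1 / 2
  · subst hne
    have hg : UCRL3.g (1 / 2) = 1 / 4 := by norm_num [UCRL3.g]
    rw [bernMgf_eq, hg]
    norm_num
    refine (Real.cosh_le_exp_half_sq _).trans (Real.exp_le_exp.2 ?_)
    nlinarith
  · obtain ⟨θ, ht, hl⟩ := exists_tanh_eq h0 h1
    have hθ := tanh_param_ne_zero ht hne
    rw [UCRL3.g_eq h0 h1 ht hl hne, bernMgf_eq]
    have hs : Real.sinh θ = (1 - 2 * q) * Real.cosh θ := by
      rw [← ht, Real.tanh_eq_sinh_div_cosh, div_mul_cancel₀ _ (Real.cosh_pos θ).ne']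
    have hc : Real.cosh (l / 2) + (2 * q - 1) * Real.sinh (l / 2)
        = Real.cosh (l / 2 - θ) / Real.cosh θ := by
      rw [eq_div_iff (Real.cosh_pos θ).ne', Real.cosh_sub, hs]; ring
    rw [hc]
    have h := Real.cosh_le_cosh_mul_exp hθ (l / 2 - θ)
    have h' : Real.cosh (l / 2 - θ) / Real.cosh θ ≤
        Real.exp (Real.tanh θ / (2 * θ) * ((l / 2 - θ) ^ 2 - θ ^ 2)) := by
      rw [div_le_iff₀ (Real.cosh_pos θ)]; linarith
    refine (mul_le_mul_of_nonneg_left h' (Real.exp_pos _).le).trans (le_of_eq ?_)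
    rw [← Real.exp_add, ← ht]
    congr 1
    field_simp
    ring

/-- A variable with values `±1` and mean `t ≥ 0` satisfies the sub-Gaussian bound with its true
variance `1 - t²` for exponents `h ≥ 0`. -/
theorem cosh_add_mul_sinh_le {t h : ℝ} (ht0 : 0 ≤ t) (ht1 : t ≤ 1) (hh : 0 ≤ h) :
    Real.cosh h + t * Real.sinh h ≤ Real.exp (h * t + h ^ 2 * (1 - t ^ 2) / 2) := by
  -- the quotient of the two sides is nonincreasing in `h`
  have hd : ∀ z, HasDerivAt (fun z => -((Real.cosh z + t * Real.sinh z)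
        * Real.exp (-(z * t + z ^ 2 * (1 - t ^ 2) / 2))))
      (-((Real.sinh z + t * Real.cosh z) * Real.exp (-(z * t + z ^ 2 * (1 - t ^ 2) / 2))
        + (Real.cosh z + t * Real.sinh z) * (Real.exp (-(z * t + z ^ 2 * (1 - t ^ 2) / 2))
          * (-(t + z * (1 - t ^ 2)))))) z := fun z => by
    refine HasDerivAt.neg (HasDerivAt.mul
      ((Real.hasDerivAt_cosh z).add ((Real.hasDerivAt_sinh z).const_mul t)) (HasDerivAt.exp ?_))
    exact ((((hasDerivAt_id z).mul_const t).add
      (((hasDerivAt_pow 2 z).mul_const (1 - t ^ 2)).div_const 2)).neg).congr_deriv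
        (by simp; ring)
  have h := le_of_hasDerivAt_nonneg hh hd (fun z hz _ => by
    set e := Real.exp (-(z * t + z ^ 2 * (1 - t ^ 2) / 2))
    have he : 0 < e := Real.exp_pos _
    have hT : Real.sinh z ≤ z * Real.cosh z := by
      have := Real.tanh_le_self_of_nonneg hz.le
      rwa [Real.tanh_eq_sinh_div_cosh, div_le_iff₀ (Real.cosh_pos _)] at this
    have hsz := Real.sinh_nonneg_iff.2 hz.le
    have ht2 : 0 ≤ 1 - t ^ 2 := by nlinarith
    have h1 : 0 ≤ (1 - t ^ 2) * (z * Real.cosh z - Real.sinh z) :=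
      mul_nonneg ht2 (by linarith)
    have h2 : 0 ≤ z * (1 - t ^ 2) * (t * Real.sinh z) := by positivity
    have : 0 ≤ e * ((Real.cosh z + t * Real.sinh z) * (t + z * (1 - t ^ 2))
        - (Real.sinh z + t * Real.cosh z)) := by
      refine mul_nonneg he.le ?_
      nlinarith
    nlinarith)
  simp only [Real.cosh_zero, Real.sinh_zero, mul_zero, add_zero, one_mul, zero_mul, ne_eq,
    OfNat.ofNat_ne_zero, not_false_eq_true, zero_pow, zero_div, neg_zero, Real.exp_zero,
    neg_le_neg_iff, Real.exp_neg] at h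
  rwa [← div_eq_mul_inv, div_le_one (Real.exp_pos _)] at h

/-- For `q ≥ 1/2` the upper tail of a Bernoulli variable is sub-Gaussian with its variance as
proxy. -/
theorem bernMgf_le_of_half_le {q l : ℝ} (h0 : 1 / 2 ≤ q) (h1 : q ≤ 1) (hl : 0 ≤ l) :
    bernMgf q l ≤ Real.exp (l ^ 2 * (q * (1 - q)) / 2) := by
  rw [bernMgf_eq]
  have h := cosh_add_mul_sinh_le (t := 2 * q - 1) (h := l / 2) (by linarith) (by linarith)
    (by linarith)
  refine (mul_le_mul_of_nonneg_left h (Real.exp_pos _).le).trans (le_of_eq ?_)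
  rw [← Real.exp_add]
  ring_nf

/-- On the upper side the variance proxy `g q` can be replaced by the variance when `1/2 ≤ q`. -/
theorem bernMgf_le_gLow {q l : ℝ} (h0 : 0 < q) (h1 : q < 1) (hl : 0 ≤ l) :
    bernMgf q l ≤ Real.exp (l ^ 2 * UCRL3.gLow q / 2) := by
  unfold UCRL3.gLow
  split_ifs with h
  · exact bernMgf_le_kearnsSaul h0 h1 l
  · exact bernMgf_le_of_half_le (not_lt.1 h) h1.le hl

theorem Real.exp_sub_one_sub_le_of_nonneg {y : ℝ} (hy : 0 ≤ y) :
    2 * (1 - y / 3) * (Real.exp y - 1 - y) ≤ y ^ 2 := by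
  have hm : ∀ z, 0 ≤ z → 0 ≤ z + 2 + (z - 2) * Real.exp z := fun z hz => by
    have hd : ∀ x, HasDerivAt (fun x => x + 2 + (x - 2) * Real.exp x)
        (1 + (x - 1) * Real.exp x) x := fun x => by
      exact (((hasDerivAt_id x).add_const 2).add
        (((hasDerivAt_id x).sub_const 2).mul (Real.hasDerivAt_exp x))).congr_deriv
          (by simp; ring)
    have := le_of_hasDerivAt_nonneg hz hd (fun x hx _ => by
      have h1 := Real.add_one_le_exp (-x)
      have h2 : Real.exp (-x) * Real.exp x = 1 := by rw [← Real.exp_add]; simp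
      have h3 := Real.exp_pos x
      nlinarith)
    simpa using this
  have hd : ∀ x, HasDerivAt (fun x => x ^ 2 - 2 * (1 - x / 3) * (Real.exp x - 1 - x))
      (2 / 3 * (x + 2 + (x - 2) * Real.exp x)) x := fun x => by
    have h1 : HasDerivAt (fun x : ℝ => 2 * (1 - x / 3)) (-(2 / 3)) x :=
      ((((hasDerivAt_id x).div_const 3).const_sub 1).const_mul 2).congr_deriv (by ring)
    have h2 : HasDerivAt (fun x : ℝ => Real.exp x - 1 - x) (Real.exp x - 1) x :=
      (((Real.hasDerivAt_exp x).sub_const 1).sub (hasDerivAt_id x)).congr_deriv (by ring)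
    exact ((hasDerivAt_pow 2 x).sub (h1.mul h2)).congr_deriv (by simp; ring)
  have := le_of_hasDerivAt_nonneg hy hd (fun x hx _ => by
    have := hm x hx.le; positivity)
  simp at this
  linarith

theorem Real.exp_le_quadratic_of_nonpos {y : ℝ} (hy : y ≤ 0) :
    Real.exp y ≤ 1 + y + y ^ 2 / 2 := by
  have hd : ∀ x, HasDerivAt (fun x => Real.exp x - (1 + x + x ^ 2 / 2))
      (Real.exp x - (1 + x)) x := fun x => by
    exact ((Real.hasDerivAt_exp x).sub (((hasDerivAt_id x).const_add 1).add
      ((hasDerivAt_pow 2 x).div_const 2))).congr_deriv (by simp)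
  have := le_of_hasDerivAt_nonneg hy hd (fun x _ _ => by
    have := Real.add_one_le_exp x; linarith)
  simp at this
  linarith

theorem Real.exp_le_bernstein {y l : ℝ} (hy : y ≤ l) (hl0 : 0 ≤ l) (hl : l < 3) :
    Real.exp y ≤ 1 + y + y ^ 2 / (2 * (1 - l / 3)) := by
  have hpos : 0 < 2 * (1 - l / 3) := by linarith
  rcases le_total y 0 with h | h
  · refine (Real.exp_le_quadratic_of_nonpos h).trans ?_
    gcongr
    linarith
  · have h1 := Real.exp_sub_one_sub_le_of_nonneg h
    have h2 : 0 ≤ Real.exp y - 1 - y := by have := Real.add_one_le_exp y; linarith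
    have h3 : Real.exp y - 1 - y ≤ y ^ 2 / (2 * (1 - l / 3)) := by
      rw [le_div_iff₀ hpos]
      nlinarith
    linarith

/-- Bernstein's bound on the moment generating function of a centred Bernoulli variable. -/
theorem bernMgf_le_bernstein {q l : ℝ} (h0 : 0 ≤ q) (h1 : q ≤ 1) (hl0 : 0 ≤ l) (hl : l < 3) :
    bernMgf q l ≤ Real.exp (q * (1 - q) * (l ^ 2 / (2 * (1 - l / 3)))) := by
  have a := Real.exp_le_bernstein (y := l * (1 - q)) (by nlinarith) hl0 hl
  have b := Real.exp_le_bernstein (y := -(l * q)) (by nlinarith) hl0 hl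
  refine le_trans ?_ (Real.add_one_le_exp _)
  refine (add_le_add (mul_le_mul_of_nonneg_left a h0)
    (mul_le_mul_of_nonneg_left b (sub_nonneg.2 h1))).trans (le_of_eq ?_)
  ring

/-! ### The variance proxies and the shape of the confidence sets -/

namespace UCRL3

theorem g_nonneg {q : ℝ} (h0 : 0 ≤ q) (h1 : q ≤ 1) : 0 ≤ g q := by
  by_cases hq : q = 0 ∨ q = 1
  · simp [g, hq]
  push Not at hq
  have h0' := lt_of_le_of_ne h0 hq.1.symm
  have h1' := lt_of_le_of_ne h1 hq.2
  by_cases hne : q = 1 / 2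
  · subst hne; norm_num [g]
  obtain ⟨θ, ht, hl⟩ := exists_tanh_eq h0' h1'
  rw [g_eq h0' h1' ht hl hne]
  rcases le_total 0 θ with h | h
  · exact div_nonneg (by
      rw [Real.tanh_eq_sinh_div_cosh]
      exact div_nonneg (Real.sinh_nonneg_iff.2 h) (Real.cosh_pos _).le) (by linarith)
  · exact div_nonneg_of_nonpos (by
      rw [Real.tanh_eq_sinh_div_cosh]
      exact div_nonpos_of_nonpos_of_nonneg (Real.sinh_nonpos_iff.2 h) (Real.cosh_pos _).le)
      (by linarith)

theorem g_le_quarter_of_lt_half {q : ℝ} (h0 : 0 ≤ q) (h1 : q < 1 / 2) : g q ≤ 1 / 4 := by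
  rcases h0.eq_or_lt with rfl | h0
  · norm_num [g]
  obtain ⟨θ, ht, hl⟩ := exists_tanh_eq h0 (by linarith)
  rw [g_eq h0 (by linarith) ht hl h1.ne]
  have hθ : 0 < θ := by
    by_contra h
    have : Real.tanh θ ≤ 0 := by
      rw [Real.tanh_eq_sinh_div_cosh]
      exact div_nonpos_of_nonpos_of_nonneg (Real.sinh_nonpos_iff.2 (not_lt.1 h))
        (Real.cosh_pos _).le
    linarith
  have := Real.tanh_le_self_of_nonneg hθ.le
  rw [div_le_div_iff₀ (by linarith) (by norm_num)]
  linarith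

theorem g_mono_of_lt_half {p q : ℝ} (h0 : 0 ≤ p) (hpq : p ≤ q) (h1 : q < 1 / 2) : g p ≤ g q := by
  rcases h0.eq_or_lt with rfl | h0
  · have : g 0 = 0 := by simp [g]
    rw [this]; exact g_nonneg hpq (by linarith)
  have pos : ∀ {x t : ℝ}, x < 1 / 2 → Real.tanh t = 1 - 2 * x → 0 < t := fun {x t} hx ht => by
    by_contra h
    have : Real.tanh t ≤ 0 := by
      rw [Real.tanh_eq_sinh_div_cosh]
      exact div_nonpos_of_nonpos_of_nonneg (Real.sinh_nonpos_iff.2 (not_lt.1 h))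
        (Real.cosh_pos _).le
    linarith
  obtain ⟨s, hs, hls⟩ := exists_tanh_eq h0 (by linarith)
  obtain ⟨t, ht, hlt⟩ := exists_tanh_eq (h0.trans_le hpq) (by linarith)
  rw [g_eq h0 (by linarith) hs hls (by linarith), g_eq (h0.trans_le hpq) (by linarith) ht hlt
    h1.ne]
  have hs0 := pos (by linarith) hs
  have ht0 := pos h1 ht
  have hts : t ≤ s := by
    have : 2 * t ≤ 2 * s := by
      rw [← hls, ← hlt]
      have hq0 := h0.trans_le hpq
      apply Real.log_le_log
      · rw [sub_pos, lt_div_iff₀ hq0]; linarith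
      · gcongr
    linarith
  have := Real.mul_tanh_le_mul_tanh ht0.le hts
  rw [div_le_div_iff₀ (by linarith) (by linarith)]
  linarith

/-- The standard deviation of a Bernoulli variable decreases at most linearly towards `r`. -/
theorem mul_sqrt_var_le {p q r a : ℝ} (h0 : 0 ≤ p) (hpq : p ≤ q) (hr : r ≤ 1)
    (ha0 : 0 ≤ a) (ha : a ≤ 1) (hq : q = (1 - a) * p + a * r) (hqr : q ≤ r) :
    (1 - a) * √(p * (1 - p)) ≤ √(q * (1 - q)) := by
  refine Real.le_sqrt_of_sq_le ?_
  have hp1 : p ≤ 1 := by linarith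
  rw [mul_pow, Real.sq_sqrt (mul_nonneg h0 (by linarith))]
  have h1 : (1 - a) * p ≤ q := by nlinarith
  have h2 : (1 - a) * (1 - p) ≤ 1 - q := by nlinarith
  calc (1 - a) ^ 2 * (p * (1 - p)) = ((1 - a) * p) * ((1 - a) * (1 - p)) := by ring
    _ ≤ q * (1 - q) := mul_le_mul h1 h2 (mul_nonneg (by linarith) (by linarith)) (h0.trans hpq)

theorem exists_between_param {p q r : ℝ} (hpq : p ≤ q) (hqr : q ≤ r) :
    ∃ a, 0 ≤ a ∧ a ≤ 1 ∧ q = (1 - a) * p + a * r := by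
  rcases eq_or_lt_of_le (hpq.trans hqr) with h | h
  · exact ⟨0, le_rfl, zero_le_one, by linarith⟩
  · refine ⟨(q - p) / (r - p), div_nonneg (by linarith) (by linarith), ?_, ?_⟩
    · rw [div_le_one (by linarith)]; linarith
    · field_simp [(sub_pos.2 h).ne']; ring

/-- The Bernstein constraint is stable when `p` is moved towards a larger centre `r`. -/
theorem bernstein_between {p q r v w : ℝ} (h0 : 0 ≤ p) (hpq : p ≤ q) (hqr : q ≤ r) (hr : r ≤ 1)
    (hw : 0 ≤ w) (h : r - p ≤ √(p * (1 - p)) * v + w) : r - q ≤ √(q * (1 - q)) * v + w ∨ v < 0 := by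
  by_cases hv : v < 0
  · exact Or.inr hv
  left
  push Not at hv
  obtain ⟨a, ha0, ha, hq⟩ := exists_between_param hpq hqr
  have h1 := mul_sqrt_var_le h0 hpq hr ha0 ha hq hqr
  have h2 := mul_le_mul_of_nonneg_right h1 hv
  have h3 : r - q = (1 - a) * (r - p) := by rw [hq]; ring
  have h4 := mul_le_mul_of_nonneg_left h (sub_nonneg.2 ha)
  have h5 : (1 - a) * w ≤ w := by nlinarith
  rw [h3]; nlinarith

/-- The constraint with the proxy `gLow` is stable when `p` is moved towards a larger centre `r`.
The proxy is not monotone, and on `[1/2, 1]` the argument for the Bernstein constraint is used. -/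
theorem gLow_between {p q r b : ℝ} (h0 : 0 ≤ p) (hpq : p ≤ q) (hqr : q ≤ r) (hr : r ≤ 1)
    (hb : 0 < b) (h : (r - p) / b ≤ √(gLow p)) : (r - q) / b ≤ √(gLow q) := by
  have var_case : ∀ {x : ℝ}, 1 / 2 ≤ x → x ≤ q → (r - x) / b ≤ √(x * (1 - x)) →
      (r - q) / b ≤ √(q * (1 - q)) := fun {x} hx hxq hh => by
    rw [div_le_iff₀ hb] at hh ⊢
    rcases bernstein_between (by linarith) hxq hqr hr le_rfl (by linarith : r - x ≤
      √(x * (1 - x)) * b + 0) with h | h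
    · linarith
    · linarith
  unfold gLow at h ⊢
  by_cases hq : q < 1 / 2
  · rw [if_pos hq]
    rw [if_pos (by linarith)] at h
    refine le_trans ?_ (h.trans (Real.sqrt_le_sqrt (g_mono_of_lt_half h0 hpq hq)))
    gcongr
  · rw [if_neg hq]
    push Not at hq
    by_cases hp : p < 1 / 2
    · rw [if_pos hp] at h
      refine var_case le_rfl hq ?_
      refine le_trans ?_ (h.trans (Real.sqrt_le_sqrt ((g_le_quarter_of_lt_half h0 hp).trans ?_)))
      · gcongr
      · norm_num
    · rw [if_neg hp] at h
      exact var_case (not_lt.1 hp) hpq h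

end UCRL3

/-! ### Test supermartingales and Ville's inequality -/

/-- A bound for the integrals of `Z` over all events of a sub-σ-algebra extends to integrals
against weights that are measurable for it. -/
theorem setLIntegral_mul_le_of_forall {Ω : Type*} {m mΩ : MeasurableSpace Ω} {P : Measure Ω}
    (hm : m ≤ mΩ) {Z w : Ω → ℝ≥0∞}
    (hZ : Measurable Z) (hw : Measurable[m] w) {G : Set Ω} (hG : MeasurableSet[m] G)
    (h : ∀ F, MeasurableSet[m] F → F ⊆ G → ∫⁻ ω in F, Z ω ∂P ≤ P F) :
    ∫⁻ ω in G, w ω * Z ω ∂P ≤ ∫⁻ ω in G, w ω ∂P := by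
  have hle : ((P.restrict G).withDensity Z).trim hm ≤ (P.restrict G).trim hm := by
    refine @Measure.le_intro _ m _ _ fun s hs _ => ?_
    rw [trim_measurableSet_eq hm hs, trim_measurableSet_eq hm hs, withDensity_apply _ (hm _ hs),
      Measure.restrict_restrict (hm _ hs), Measure.restrict_apply (hm _ hs)]
    exact h _ (hs.inter hG) Set.inter_subset_right
  calc ∫⁻ ω in G, w ω * Z ω ∂P = ∫⁻ ω, w ω ∂((P.restrict G).withDensity Z) := by
        rw [lintegral_withDensity_eq_lintegral_mul _ hZ (hw.mono hm le_rfl)]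
        simp [mul_comm]
    _ = ∫⁻ ω, w ω ∂(((P.restrict G).withDensity Z).trim hm) := (lintegral_trim hm hw).symm
    _ ≤ ∫⁻ ω, w ω ∂((P.restrict G).trim hm) := lintegral_mono' hle le_rfl
    _ = _ := lintegral_trim hm hw

theorem measurable_lintegral_exp {Ω : Type*} {m : MeasurableSpace Ω} {s n : Ω → ℝ}
    (hs : Measurable s) (hn : Measurable n) (v : ℝ) : Measurable (Function.uncurry
      fun (ω : Ω) (l : ℝ) => ENNReal.ofReal (Real.exp (l * s ω - l ^ 2 * v / 2 * n ω))) := by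
  unfold Function.uncurry
  fun_prop

theorem measurable_lintegral_exp_mixture {Ω : Type*} {m : MeasurableSpace Ω} {s n : Ω → ℝ}
    (hs : Measurable s) (hn : Measurable n) (v : ℝ) (ρ : Measure ℝ) [SFinite ρ] : Measurable
      fun ω => ∫⁻ l, ENNReal.ofReal (Real.exp (l * s ω - l ^ 2 * v / 2 * n ω)) ∂ρ :=
  (measurable_lintegral_exp hs hn v).lintegral_prod_right

section Ville

variable {Ω : Type*} {mΩ : MeasurableSpace Ω} {P : Measure Ω} {ℱ : Filtration ℕ mΩ}

/-- A nonnegative supermartingale started at time `1` with initial mean at most one, expressed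
through Lebesgue integrals, so that no integrability has to be checked. -/
structure IsTest (P : Measure Ω) (ℱ : Filtration ℕ mΩ) (W : ℕ → Ω → ℝ≥0∞) : Prop where
  meas : ∀ t ≥ 1, Measurable[ℱ t] (W t)
  step : ∀ t ≥ 1, ∀ F, MeasurableSet[ℱ t] F → ∫⁻ ω in F, W (t + 1) ω ∂P ≤ ∫⁻ ω in F, W t ω ∂P
  init : ∫⁻ ω, W 1 ω ∂P ≤ 1

/-- Ville's inequality. -/
theorem IsTest.ville {W : ℕ → Ω → ℝ≥0∞} (h : IsTest P ℱ W) (a : ℝ≥0∞) :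
    P {ω | ∃ t ≥ 1, a ≤ W t ω} ≤ a⁻¹ := by
  -- `A n` is the event that the level `a` is reached at one of the times `1, …, n`.
  set A : ℕ → Set Ω := fun n => {ω | ∃ t ≥ 1, t ≤ n ∧ a ≤ W t ω} with hA
  have hB : ∀ n, 1 ≤ n → MeasurableSet[ℱ n] {ω | a ≤ W n ω} := fun n hn =>
    (h.meas n hn) measurableSet_Ici
  have hAm : ∀ n, MeasurableSet[ℱ n] (A n) := fun n => by
    have : A n = ⋃ t ∈ Finset.Icc 1 n, {ω | a ≤ W t ω} := by
      ext ω; simp [hA, and_assoc]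
    rw [this]
    refine MeasurableSet.biUnion (m := ℱ n) (Set.to_countable _) fun t ht => ?_
    have ht' := Finset.mem_Icc.1 ht
    exact ℱ.mono ht'.2 _ (hB t ht'.1)
  have hsucc : ∀ n, A (n + 1) = A n ∪ ((A n)ᶜ ∩ {ω | a ≤ W (n + 1) ω}) := fun n => by
    ext ω
    simp only [hA, Set.mem_ofPred_eq, Set.mem_union, Set.mem_inter_iff, Set.mem_compl_iff]
    constructor
    · rintro ⟨t, h1, h2, h3⟩
      by_cases hx : ∃ t ≥ 1, t ≤ n ∧ a ≤ W t ω
      · exact Or.inl hx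
      · refine Or.inr ⟨hx, ?_⟩
        rcases Nat.lt_or_ge n t with hlt | hge
        · obtain rfl : t = n + 1 := by omega
          exact h3
        · exact absurd ⟨t, h1, hge, h3⟩ hx
    · rintro (⟨t, h1, h2, h3⟩ | ⟨_, h3⟩)
      · exact ⟨t, h1, by omega, h3⟩
      · exact ⟨n + 1, by omega, le_rfl, h3⟩
  have key : ∀ n, a * P (A n) + ∫⁻ ω in (A n)ᶜ, W (n + 1) ω ∂P ≤ 1 := by
    intro n
    induction n with
    | zero =>
      have : A 0 = ∅ := by ext ω; simp [hA]
      simpa [this] using h.init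
    | succ n ih =>
      have hC : MeasurableSet {ω | a ≤ W (n + 1) ω} := ℱ.le _ _ (hB (n + 1) (by omega))
      have hAn : MeasurableSet (A n) := ℱ.le _ _ (hAm n)
      have h1 : ∫⁻ ω in (A (n + 1))ᶜ, W (n + 1 + 1) ω ∂P ≤ ∫⁻ ω in (A (n + 1))ᶜ, W (n + 1) ω ∂P :=
        h.step (n + 1) (by omega) _ (hAm (n + 1)).compl
      have h2 : (A (n + 1))ᶜ = (A n)ᶜ \ {ω | a ≤ W (n + 1) ω} := by
        rw [hsucc]; ext ω; simp only [Set.mem_compl_iff, Set.mem_union, Set.mem_inter_iff,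
          Set.mem_sdiff]; tauto
      have h3 : P (A (n + 1)) ≤ P (A n) + P ((A n)ᶜ ∩ {ω | a ≤ W (n + 1) ω}) := by
        rw [hsucc]; exact measure_union_le _ _
      have h4 : a * P ((A n)ᶜ ∩ {ω | a ≤ W (n + 1) ω})
          ≤ ∫⁻ ω in (A n)ᶜ ∩ {ω | a ≤ W (n + 1) ω}, W (n + 1) ω ∂P :=
        calc _ = ∫⁻ _ in (A n)ᶜ ∩ {ω | a ≤ W (n + 1) ω}, a ∂P := by simp
          _ ≤ _ := setLIntegral_mono' (hAn.compl.inter hC) fun ω hω => hω.2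
      have h5 := lintegral_inter_add_sdiff (μ := P) (fun ω => W (n + 1) ω) ((A n)ᶜ) hC
      calc _ ≤ a * (P (A n) + P ((A n)ᶜ ∩ {ω | a ≤ W (n + 1) ω}))
              + ∫⁻ ω in (A (n + 1))ᶜ, W (n + 1) ω ∂P := by gcongr
        _ ≤ a * P (A n) + (∫⁻ ω in (A n)ᶜ ∩ {ω | a ≤ W (n + 1) ω}, W (n + 1) ω ∂P
              + ∫⁻ ω in (A n)ᶜ \ {ω | a ≤ W (n + 1) ω}, W (n + 1) ω ∂P) := by
            rw [mul_add, add_assoc, h2]; gcongr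
        _ ≤ 1 := by rw [h5]; exact ih
  have hmono : Monotone A := fun m n hmn ω ⟨t, h1, h2, h3⟩ => ⟨t, h1, h2.trans hmn, h3⟩
  have hU : {ω | ∃ t ≥ 1, a ≤ W t ω} = ⋃ n, A n := by
    ext ω; simp only [Set.mem_ofPred_eq, Set.mem_iUnion, hA]
    exact ⟨fun ⟨t, h1, h2⟩ => ⟨t, t, h1, le_rfl, h2⟩, fun ⟨_, t, h1, _, h2⟩ => ⟨t, h1, h2⟩⟩
  rw [hU, hmono.measure_iUnion]
  refine iSup_le fun n => ?_
  rw [ENNReal.le_inv_iff_mul_le, mul_comm]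
  exact le_self_add.trans (key n)

open Classical in
/-- Number of times `i` with `1 ≤ i < t` at which `I i` occurs. -/
def cnt (I : ℕ → Set Ω) (t : ℕ) (ω : Ω) : ℕ := ((Finset.Ico 1 t).filter fun i => ω ∈ I i).card

open Classical in
/-- Sum of the `X i` over the times `i` with `1 ≤ i < t` at which `I i` occurs. -/
def psum (I : ℕ → Set Ω) (X : ℕ → Ω → ℝ) (t : ℕ) (ω : Ω) : ℝ :=
  ∑ i ∈ (Finset.Ico 1 t).filter fun i => ω ∈ I i, X i ω

variable {I : ℕ → Set Ω} {X : ℕ → Ω → ℝ}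

theorem cnt_succ_of_mem {t : ℕ} (ht : 1 ≤ t) {ω : Ω} (h : ω ∈ I t) :
    cnt I (t + 1) ω = cnt I t ω + 1 := by
  classical
  unfold cnt
  rw [← Nat.succ_eq_add_one, Nat.Ico_succ_right_eq_insert_Ico ht, Finset.filter_insert, if_pos h,
    Finset.card_insert_of_notMem (by simp)]

theorem cnt_succ_of_notMem {t : ℕ} (ht : 1 ≤ t) {ω : Ω} (h : ω ∉ I t) :
    cnt I (t + 1) ω = cnt I t ω := by
  classical
  unfold cnt
  rw [← Nat.succ_eq_add_one, Nat.Ico_succ_right_eq_insert_Ico ht, Finset.filter_insert, if_neg h]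

theorem psum_succ_of_mem {t : ℕ} (ht : 1 ≤ t) {ω : Ω} (h : ω ∈ I t) :
    psum I X (t + 1) ω = psum I X t ω + X t ω := by
  classical
  unfold psum
  rw [← Nat.succ_eq_add_one, Nat.Ico_succ_right_eq_insert_Ico ht, Finset.filter_insert, if_pos h,
    Finset.sum_insert (by simp), add_comm]

theorem psum_succ_of_notMem {t : ℕ} (ht : 1 ≤ t) {ω : Ω} (h : ω ∉ I t) :
    psum I X (t + 1) ω = psum I X t ω := by
  classical
  unfold psum
  rw [← Nat.succ_eq_add_one, Nat.Ico_succ_right_eq_insert_Ico ht, Finset.filter_insert, if_neg h]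

theorem measurable_psum (hI : ∀ t ≥ 1, MeasurableSet[ℱ t] (I t))
    (hX : ∀ t ≥ 1, Measurable[ℱ (t + 1)] (X t)) (t : ℕ) : Measurable[ℱ t] (psum I X t) := by
  classical
  have : psum I X t = fun ω => ∑ i ∈ Finset.Ico 1 t, (I i).indicator (X i) ω := by
    ext ω
    rw [psum, Finset.sum_filter]
    rfl
  rw [this]
  refine Finset.measurable_sum (m := ℱ t) _ fun i hi => ?_
  have hi' := Finset.mem_Ico.1 hi
  exact Measurable.indicator ((hX i hi'.1).mono (ℱ.mono hi'.2) le_rfl)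
    (ℱ.mono (by omega : i ≤ t) _ (hI i hi'.1))

theorem cnt_eq_psum (t : ℕ) (ω : Ω) : (cnt I t ω : ℝ) = psum I (fun _ _ => 1) t ω := by
  simp [cnt, psum]

theorem measurable_cnt (hI : ∀ t ≥ 1, MeasurableSet[ℱ t] (I t)) (t : ℕ) :
    Measurable[ℱ t] (fun ω => (cnt I t ω : ℝ)) := by
  simp_rw [cnt_eq_psum]
  exact measurable_psum hI (fun _ _ => measurable_const) t

/-- Given the past, and on the events `I t`, the moment generating function of the increment
`X t` at `l` is at most `exp c`. -/
def MgfBound (P : Measure Ω) (ℱ : Filtration ℕ mΩ) (I : ℕ → Set Ω) (X : ℕ → Ω → ℝ) (l c : ℝ) :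
    Prop :=
  ∀ t ≥ 1, ∀ F, MeasurableSet[ℱ t] F → F ⊆ I t →
    ∫⁻ ω in F, ENNReal.ofReal (Real.exp (l * X t ω)) ∂P ≤ ENNReal.ofReal (Real.exp c) * P F

/-- The exponential supermartingale. -/
theorem isTest_exp [IsProbabilityMeasure P] (hI : ∀ t ≥ 1, MeasurableSet[ℱ t] (I t))
    (hX : ∀ t ≥ 1, Measurable[ℱ (t + 1)] (X t)) {l c : ℝ} (hmgf : MgfBound P ℱ I X l c) :
    IsTest P ℱ fun t ω => ENNReal.ofReal (Real.exp (l * psum I X t ω - c * cnt I t ω)) := by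
  have hmeas : ∀ t, Measurable[ℱ t]
      fun ω => ENNReal.ofReal (Real.exp (l * psum I X t ω - c * cnt I t ω)) := fun t =>
    ENNReal.measurable_ofReal.comp (Real.measurable_exp.comp
      (((measurable_psum hI hX t).const_mul l).sub ((measurable_cnt hI t).const_mul c)))
  refine ⟨fun t _ => hmeas t, fun t ht F hF => ?_, ?_⟩
  · have hIt : MeasurableSet (I t) := ℱ.le _ _ (hI t ht)
    rw [← lintegral_inter_add_sdiff _ F hIt, ← lintegral_inter_add_sdiff (B := I t) _ F hIt]
    have hFm : MeasurableSet F := ℱ.le _ _ hF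
    refine add_le_add ?_ (le_of_eq ?_)
    · have hZ : Measurable fun ω => ENNReal.ofReal (Real.exp (l * X t ω - c)) :=
        ENNReal.measurable_ofReal.comp (Real.measurable_exp.comp
          ((((hX t ht).mono (ℱ.le _) le_rfl).const_mul l).sub_const c))
      calc _ = ∫⁻ ω in F ∩ I t, ENNReal.ofReal (Real.exp (l * psum I X t ω - c * cnt I t ω))
            * ENNReal.ofReal (Real.exp (l * X t ω - c)) ∂P := by
            refine setLIntegral_congr_fun (hFm.inter hIt) fun ω hω => ?_
            rw [← ENNReal.ofReal_mul (Real.exp_pos _).le, ← Real.exp_add]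
            simp only [cnt_succ_of_mem ht hω.2, psum_succ_of_mem ht hω.2]
            push_cast
            ring_nf
        _ ≤ _ := by
            refine setLIntegral_mul_le_of_forall (ℱ.le t) hZ (hmeas t) (hF.inter (hI t ht)) ?_
            intro G hG hGs
            have h1 := hmgf t ht G hG (hGs.trans Set.inter_subset_right)
            have h2 : ∀ ω, ENNReal.ofReal (Real.exp (l * X t ω - c))
                = ENNReal.ofReal (Real.exp (-c)) * ENNReal.ofReal (Real.exp (l * X t ω)) := by
              intro ω
              rw [← ENNReal.ofReal_mul (Real.exp_pos _).le, ← Real.exp_add]; ring_nf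
            simp_rw [h2]
            rw [lintegral_const_mul' _ _ ENNReal.ofReal_ne_top]
            calc _ ≤ ENNReal.ofReal (Real.exp (-c)) * (ENNReal.ofReal (Real.exp c) * P G) := by
                  gcongr
              _ = P G := by
                  rw [← mul_assoc, ← ENNReal.ofReal_mul (Real.exp_pos _).le, ← Real.exp_add]
                  simp
    · refine setLIntegral_congr_fun (hFm.diff hIt) fun ω hω => ?_
      simp only [cnt_succ_of_notMem ht hω.2, psum_succ_of_notMem ht hω.2]
  · simp [psum, cnt]

/-- Mixtures of exponential supermartingales over the parameter. -/
theorem isTest_mixture [IsProbabilityMeasure P] (ρ : Measure ℝ) [SFinite ρ] (hρ : ρ Set.univ ≤ 1)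
    (hI : ∀ t ≥ 1, MeasurableSet[ℱ t] (I t)) (hX : ∀ t ≥ 1, Measurable[ℱ (t + 1)] (X t))
    {v : ℝ} (hmgf : ∀ᵐ l ∂ρ, MgfBound P ℱ I X l (l ^ 2 * v / 2)) :
    IsTest P ℱ fun t ω =>
      ∫⁻ l, ENNReal.ofReal (Real.exp (l * psum I X t ω - l ^ 2 * v / 2 * cnt I t ω)) ∂ρ := by
  have hs := measurable_psum (ℱ := ℱ) hI hX
  have hn := measurable_cnt (ℱ := ℱ) hI
  refine ⟨fun t _ => measurable_lintegral_exp_mixture (hs t) (hn t) v ρ, fun t ht F hF => ?_, ?_⟩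
  · have J : ∀ t, AEMeasurable (Function.uncurry fun (ω : Ω) (l : ℝ) => ENNReal.ofReal
        (Real.exp (l * psum I X t ω - l ^ 2 * v / 2 * cnt I t ω))) ((P.restrict F).prod ρ) :=
      fun t => (measurable_lintegral_exp ((hs t).mono (ℱ.le _) le_rfl)
        ((hn t).mono (ℱ.le _) le_rfl) v).aemeasurable
    rw [lintegral_lintegral_swap (J _), lintegral_lintegral_swap (J _)]
    refine lintegral_mono_ae (hmgf.mono fun l hl => ?_)
    exact (isTest_exp hI hX hl).step t ht F hF
  · simpa [psum, cnt] using hρ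

end Ville

/-! ### Time-uniform deviation bounds -/

section Deviation

variable {Ω : Type*} {mΩ : MeasurableSpace Ω} {P : Measure Ω} {ℱ : Filtration ℕ mΩ}
  {I : ℕ → Set Ω} {X : ℕ → Ω → ℝ}

theorem lintegral_half_gaussian {b : ℝ} (hb : 0 < b) :
    ∫⁻ x in Set.Ioi (0 : ℝ), ENNReal.ofReal (Real.exp (-b * x ^ 2))
      = ENNReal.ofReal (√(Real.pi / b) / 2) := by
  rw [← integral_gaussian_Ioi, ofReal_integral_eq_lintegral_ofReal]
  · exact (integrable_exp_neg_mul_sq hb).integrableOn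
  · exact ae_of_all _ fun x => (Real.exp_pos _).le

/-- Half-normal law of variance proxy `1 / v`, the mixing law of Laplace's method for one-sided
bounds. -/
def halfNormal (v : ℝ) : Measure ℝ :=
  (volume.restrict (Set.Ioi (0 : ℝ))).withDensity
    fun l => ENNReal.ofReal (2 * √(v / (2 * Real.pi)) * Real.exp (-(v / 2) * l ^ 2))

theorem measurable_halfNormal_density (v : ℝ) : Measurable
    fun l : ℝ => ENNReal.ofReal (2 * √(v / (2 * Real.pi)) * Real.exp (-(v / 2) * l ^ 2)) := by
  fun_prop

instance (v : ℝ) : SFinite (halfNormal v) := by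
  unfold halfNormal
  infer_instance

theorem halfNormal_univ_le {v : ℝ} (hv : 0 < v) : halfNormal v Set.univ ≤ 1 := by
  rw [halfNormal, withDensity_apply _ MeasurableSet.univ, Measure.restrict_univ]
  have h : ∀ l : ℝ, ENNReal.ofReal (2 * √(v / (2 * Real.pi)) * Real.exp (-(v / 2) * l ^ 2))
      = ENNReal.ofReal (2 * √(v / (2 * Real.pi))) * ENNReal.ofReal (Real.exp (-(v / 2) * l ^ 2)) :=
    fun l => ENNReal.ofReal_mul (by positivity)
  simp_rw [h]
  rw [lintegral_const_mul' _ _ ENNReal.ofReal_ne_top, lintegral_half_gaussian (by positivity),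
    ← ENNReal.ofReal_mul (by positivity)]
  refine ENNReal.ofReal_le_one.2 (le_of_eq ?_)
  have : √(v / (2 * Real.pi)) * √(Real.pi / (v / 2)) = 1 := by
    rw [← Real.sqrt_mul (by positivity)]
    rw [show v / (2 * Real.pi) * (Real.pi / (v / 2)) = 1 by
      field_simp]
    exact Real.sqrt_one
  linarith

/-- The half-normal mixture dominates half of the full Gaussian mixture when `s ≥ 0`. -/
theorem le_lintegral_halfNormal {v s n : ℝ} (hv : 0 < v) (hs : 0 ≤ s) (hn : 0 ≤ n) :
    ENNReal.ofReal (Real.exp (s ^ 2 / (2 * v * (n + 1))) / √(n + 1)) ≤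
      ∫⁻ l, ENNReal.ofReal (Real.exp (l * s - l ^ 2 * v / 2 * n)) ∂(halfNormal v) := by
  set a := v * (n + 1) with ha
  have ha0 : 0 < a := by positivity
  set c := 2 * √(v / (2 * Real.pi)) with hc
  have hc0 : 0 ≤ c := by positivity
  rw [halfNormal, lintegral_withDensity_eq_lintegral_mul _ (measurable_halfNormal_density v)
    (by fun_prop)]
  have hm : 0 ≤ s / a := by positivity
  have e1 : ∀ l : ℝ, c * Real.exp (-(v / 2) * l ^ 2) * Real.exp (l * s - l ^ 2 * v / 2 * n)
      = c * Real.exp (s ^ 2 / (2 * a)) * Real.exp (-(a / 2) * (l - s / a) ^ 2) := fun l => by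
    rw [mul_assoc c, mul_assoc c, ← Real.exp_add, ← Real.exp_add]
    congr 2
    rw [ha]; field_simp; ring
  calc ENNReal.ofReal (Real.exp (s ^ 2 / (2 * v * (n + 1))) / √(n + 1))
      = ENNReal.ofReal (c * Real.exp (s ^ 2 / (2 * a)))
          * ENNReal.ofReal (√(Real.pi / (a / 2)) / 2) := by
        rw [← ENNReal.ofReal_mul (by positivity)]
        congr 1
        have : √(v / (2 * Real.pi)) * √(Real.pi / (a / 2)) = 1 / √(n + 1) := by
          rw [← Real.sqrt_mul (by positivity), ← Real.sqrt_one, ← Real.sqrt_div zero_le_one,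
            Real.sqrt_one]
          congr 1
          rw [ha]; field_simp
        rw [hc, ← mul_assoc (2:ℝ) v]
        calc _ = Real.exp (s ^ 2 / (2 * v * (n + 1))) * (1 / √(n + 1)) := by ring
          _ = _ := by rw [← this]; rw [ha]; ring_nf
    _ = ENNReal.ofReal (c * Real.exp (s ^ 2 / (2 * a)))
          * ∫⁻ l, (Set.Ioi (0:ℝ)).indicator
            (fun l => ENNReal.ofReal (Real.exp (-(a / 2) * l ^ 2))) (l - s / a) := by
        rw [lintegral_sub_right_eq_self (fun l => (Set.Ioi (0:ℝ)).indicator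
            (fun l => ENNReal.ofReal (Real.exp (-(a / 2) * l ^ 2))) l),
          lintegral_indicator measurableSet_Ioi, lintegral_half_gaussian (by positivity)]
    _ ≤ ∫⁻ l in Set.Ioi (0:ℝ), _ := by
        rw [← lintegral_const_mul' _ _ ENNReal.ofReal_ne_top, ← lintegral_indicator
          measurableSet_Ioi]
        refine lintegral_mono fun l => ?_
        by_cases h : s / a < l
        · have h1 : l - s / a ∈ Set.Ioi (0:ℝ) := by simpa using h
          have h2 : l ∈ Set.Ioi (0:ℝ) := lt_of_le_of_lt hm h
          rw [Set.indicator_of_mem h1, Set.indicator_of_mem h2, Pi.mul_apply,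
            ← ENNReal.ofReal_mul (by positivity), ← ENNReal.ofReal_mul (by positivity), e1]
        · have h1 : l - s / a ∉ Set.Ioi (0:ℝ) := by simpa using h
          rw [Set.indicator_of_notMem h1, mul_zero]
          exact zero_le

/-- Laplace's method: a one-sided sub-Gaussian deviation bound, uniform in time. -/
theorem laplace_bound [IsProbabilityMeasure P] (hI : ∀ t ≥ 1, MeasurableSet[ℱ t] (I t))
    (hX : ∀ t ≥ 1, Measurable[ℱ (t + 1)] (X t)) {v : ℝ} (hv : 0 < v)
    (hmgf : ∀ l, 0 < l → MgfBound P ℱ I X l (l ^ 2 * v / 2)) {d : ℝ} (hd : 0 < d) :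
    P {ω | ∃ t ≥ 1, √(2 * v * (cnt I t ω + 1) * Real.log (√((cnt I t ω : ℝ) + 1) / d))
      < psum I X t ω} ≤ ENNReal.ofReal d := by
  have hae : ∀ᵐ l ∂(halfNormal v), MgfBound P ℱ I X l (l ^ 2 * v / 2) := by
    have : ∀ᵐ l ∂(volume.restrict (Set.Ioi (0:ℝ))), MgfBound P ℱ I X l (l ^ 2 * v / 2) :=
      (ae_restrict_mem measurableSet_Ioi).mono fun l hl => hmgf l hl
    exact (withDensity_absolutelyContinuous _ _).ae_le this
  have ht := isTest_mixture (halfNormal v) (halfNormal_univ_le hv) hI hX hae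
  have hV := ht.ville (ENNReal.ofReal (1 / d))
  rw [ENNReal.ofReal_div_of_pos hd, ENNReal.ofReal_one, one_div, inv_inv] at hV
  refine (measure_mono ?_).trans hV
  rintro ω ⟨t, ht1, h⟩
  refine ⟨t, ht1, ?_⟩
  set n : ℝ := (cnt I t ω : ℝ) with hn
  set s := psum I X t ω
  have hn0 : 0 ≤ n := Nat.cast_nonneg _
  have hs : 0 ≤ s := (Real.sqrt_nonneg _).trans h.le
  refine le_trans ?_ (le_lintegral_halfNormal hv hs hn0)
  have hsn : 0 < √(n + 1) := Real.sqrt_pos.2 (by linarith)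
  have hlog : Real.log (√(n + 1) / d) ≤ s ^ 2 / (2 * v * (n + 1)) := by
    rw [le_div_iff₀ (by positivity), mul_comm]
    exact (Real.sqrt_le_left hs).1 h.le
  rw [← ENNReal.ofReal_inv_of_pos hd]
  refine ENNReal.ofReal_le_ofReal ?_
  have := Real.exp_le_exp.2 hlog
  rw [Real.exp_log (by positivity)] at this
  rw [le_div_iff₀ hsn]
  calc d⁻¹ * √(n + 1) = √(n + 1) / d := by ring
    _ ≤ _ := this

/-- The optimal parameter in Bernstein's inequality for the deviation `√(2 V x) + x / 3`. -/
theorem bernstein_param {V x : ℝ} (hV : 0 < V) (hx : 0 < x) :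
    ∃ l, 0 < l ∧ l < 3 ∧
      l * (√(2 * V * x) + x / 3) - V * (l ^ 2 / (2 * (1 - l / 3))) = x := by
  set r := √(V / (2 * x)) with hr
  have hr0 : 0 < r := Real.sqrt_pos.2 (by positivity)
  have hr2 : r ^ 2 = V / (2 * x) := Real.sq_sqrt (by positivity)
  have hVr : V = 2 * x * r ^ 2 := by rw [hr2]; field_simp
  refine ⟨3 / (1 + 3 * r), by positivity, ?_, ?_⟩
  · rw [div_lt_iff₀ (by positivity)]; linarith
  · have h1 : √(2 * V * x) = 2 * x * r := by
      rw [show 2 * V * x = (2 * x * r) ^ 2 by rw [hVr]; ring]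
      exact Real.sqrt_sq (by positivity)
    have h2 : 1 - 3 / (1 + 3 * r) / 3 = 3 * r / (1 + 3 * r) := by field_simp; ring
    rw [h1, h2, hVr]
    field_simp
    ring

theorem sum_inv_mul_succ (m : ℕ) :
    ∑ k ∈ Finset.range m, 1 / (((k : ℝ) + 1) * (k + 2)) = 1 - 1 / ((m : ℝ) + 1) := by
  induction m with
  | zero => simp
  | succ m ih => rw [Finset.sum_range_succ, ih]; push_cast; field_simp; ring

/-- The index of the slice `[1.12 ^ (k + 1), 1.12 ^ (k + 2))` that contains `n`, and the
comparison of `ell n` with the level attached to the slice. -/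
theorem exists_slice {n : ℕ} (hn : 2 ≤ n) {d : ℝ} (hd : 0 < d) :
    ∃ k : ℕ, (1.12 : ℝ) ^ (k + 1) ≤ n ∧ (n : ℝ) ≤ 1.12 ^ (k + 2) ∧
      1.12 * Real.log (((k : ℝ) + 1) * (k + 2) / d) ≤ UCRL3.ell n d := by
  have hη : 0 < Real.log 1.12 := Real.log_pos (by norm_num)
  have hn2 : (2 : ℝ) ≤ n := by exact_mod_cast hn
  have hn0 : (0 : ℝ) < n := by linarith
  have hq : 1 ≤ Real.log n / Real.log 1.12 := by
    rw [one_le_div hη]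
    exact Real.log_le_log (by norm_num) (by norm_num; linarith)
  obtain ⟨k, hk⟩ : ∃ k, ⌊Real.log n / Real.log 1.12⌋₊ = k + 1 :=
    Nat.exists_eq_succ_of_ne_zero (Nat.floor_pos.2 hq).ne'
  have h1 : ((k : ℝ) + 1) * Real.log 1.12 ≤ Real.log n := by
    have := Nat.floor_le (zero_le_one.trans hq)
    rw [hk, le_div_iff₀ hη] at this
    push_cast at this; exact this
  have h2 : Real.log n ≤ ((k : ℝ) + 2) * Real.log 1.12 := by
    have := Nat.lt_floor_add_one (Real.log n / Real.log 1.12)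
    rw [hk, div_lt_iff₀ hη] at this
    push_cast at this; linarith
  refine ⟨k, ?_, ?_, ?_⟩
  · rw [← Real.log_le_log_iff (by positivity) hn0, Real.log_pow]; push_cast; exact h1
  · rw [← Real.log_le_log_iff hn0 (by positivity), Real.log_pow]; push_cast; exact h2
  · unfold UCRL3.ell
    refine mul_le_mul_of_nonneg_left (Real.log_le_log (by positivity) ?_) (by norm_num)
    rw [Real.log_mul (by norm_num) hn0.ne', div_le_div_iff₀ hd (by positivity)]
    have h3 : ((k : ℝ) + 2) * Real.log 1.12 ≤ Real.log 1.12 + Real.log n := by linarith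
    have h4 := mul_le_mul h1 h3 (by positivity)
      (by linarith [Real.log_pos (by linarith : (1:ℝ) < n)])
    calc _ = (((k : ℝ) + 1) * Real.log 1.12 * (((k : ℝ) + 2) * Real.log 1.12)) * d := by ring
      _ ≤ _ := mul_le_mul_of_nonneg_right h4 hd.le

/-- Bernstein's inequality, uniform in time, by peeling over geometric slices of the number of
observations. -/
theorem bernstein_bound [IsProbabilityMeasure P] (hI : ∀ t ≥ 1, MeasurableSet[ℱ t] (I t))
    (hX : ∀ t ≥ 1, Measurable[ℱ (t + 1)] (X t)) {v : ℝ} (hv : 0 < v)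
    (hmgf : ∀ l, 0 ≤ l → l < 3 → MgfBound P ℱ I X l (v * (l ^ 2 / (2 * (1 - l / 3)))))
    {d : ℝ} (hd : 0 < d) (hd1 : d ≤ 1) :
    P {ω | ∃ t ≥ 1, 2 ≤ cnt I t ω ∧ √(2 * v * cnt I t ω * UCRL3.ell (cnt I t ω) d)
      + UCRL3.ell (cnt I t ω) d / 3 < psum I X t ω} ≤ ENNReal.ofReal d := by
  have hx : ∀ k : ℕ, 0 < Real.log (((k : ℝ) + 1) * (k + 2) / d) := fun k =>
    Real.log_pos (by
      rw [lt_div_iff₀ hd]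
      have : (0:ℝ) ≤ k := Nat.cast_nonneg k
      nlinarith)
  choose l hl0 hl3 hl using fun k : ℕ => bernstein_param (V := v * 1.12 ^ (k + 2)) (by positivity)
    (hx k)
  have hW := fun k => (isTest_exp hI hX (hmgf (l k) (hl0 k).le (hl3 k))).ville
    (ENNReal.ofReal (((k : ℝ) + 1) * (k + 2) / d))
  have hlevel : ∀ k : ℕ, (ENNReal.ofReal (((k : ℝ) + 1) * (k + 2) / d))⁻¹
      = ENNReal.ofReal (d * (1 / (((k : ℝ) + 1) * (k + 2)))) := fun k => by
    rw [← ENNReal.ofReal_inv_of_pos (by positivity), inv_div, mul_one_div]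
  refine (measure_mono (t := ⋃ k : ℕ, {ω | ∃ t ≥ 1, ENNReal.ofReal (((k : ℝ) + 1) * (k + 2) / d) ≤
    ENNReal.ofReal (Real.exp (l k * psum I X t ω
      - v * (l k ^ 2 / (2 * (1 - l k / 3))) * cnt I t ω))}) ?_).trans
    ((measure_iUnion_le _).trans ?_)
  · rintro ω ⟨t, ht1, hn, h⟩
    obtain ⟨k, h1, h2, h3⟩ := exists_slice hn hd
    refine Set.mem_iUnion.2 ⟨k, t, ht1, ENNReal.ofReal_le_ofReal ?_⟩
    set n : ℝ := (cnt I t ω : ℝ) with hn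
    set e := UCRL3.ell (cnt I t ω) d
    set x := Real.log (((k : ℝ) + 1) * (k + 2) / d) with hxd
    rw [show ((k : ℝ) + 1) * (k + 2) / d = Real.exp x from (Real.exp_log (by positivity)).symm]
    refine Real.exp_le_exp.2 ?_
    have hx0 : 0 < x := hx k
    have hxe : x ≤ e := by linarith
    have ha : √(2 * (v * 1.12 ^ (k + 2)) * x) ≤ √(2 * v * n * e) := by
      refine Real.sqrt_le_sqrt ?_
      calc 2 * (v * 1.12 ^ (k + 2)) * x = 2 * v * (1.12 ^ (k + 1) * (1.12 * x)) := by ring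
        _ ≤ 2 * v * (n * e) := by gcongr
        _ = _ := by ring
    have hb : l k * (√(2 * (v * 1.12 ^ (k + 2)) * x) + x / 3) ≤ l k * psum I X t ω :=
      mul_le_mul_of_nonneg_left (by linarith) (hl0 k).le
    have hc : v * (l k ^ 2 / (2 * (1 - l k / 3))) * n
        ≤ v * 1.12 ^ (k + 2) * (l k ^ 2 / (2 * (1 - l k / 3))) := by
      have : 0 ≤ l k ^ 2 / (2 * (1 - l k / 3)) :=
        div_nonneg (by positivity) (by linarith [hl3 k])
      calc _ = v * n * (l k ^ 2 / (2 * (1 - l k / 3))) := by ring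
        _ ≤ _ := by gcongr
    linarith [hl k]
  · refine (ENNReal.tsum_le_tsum fun k => (hW k).trans (hlevel k).le).trans ?_
    refine ENNReal.tsum_le_of_sum_range_le fun m => ?_
    rw [← ENNReal.ofReal_sum_of_nonneg fun k _ => by positivity, ← Finset.mul_sum,
      sum_inv_mul_succ]
    refine ENNReal.ofReal_le_ofReal ?_
    have : (0:ℝ) ≤ 1 / ((m : ℝ) + 1) := by positivity
    nlinarith

end Deviation

/-! ### Conditional laws along an interaction -/

/-- Hoeffding's lemma, as a Lebesgue integral. -/
theorem hoeffding_lintegral {α : Type*} {mα : MeasurableSpace α} {μ : Measure α}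
    [IsProbabilityMeasure μ] {f : α → ℝ} (hf : Measurable f) {a b : ℝ}
    (hab : ∀ᵐ x ∂μ, f x ∈ Set.Icc a b) (l : ℝ) :
    ∫⁻ x, ENNReal.ofReal (Real.exp (l * (f x - ∫ y, f y ∂μ))) ∂μ ≤
      ENNReal.ofReal (Real.exp (l ^ 2 * ((b - a) ^ 2 / 4) / 2)) := by
  have h := ProbabilityTheory.hasSubgaussianMGF_of_mem_Icc hf.aemeasurable hab
  rw [← ofReal_integral_eq_lintegral_ofReal (h.integrable_exp_mul l)
    (ae_of_all _ fun x => (Real.exp_pos _).le)]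
  refine ENNReal.ofReal_le_ofReal ((h.mgf_le l).trans (Real.exp_le_exp.2 (le_of_eq ?_)))
  push_cast
  rw [Real.norm_eq_abs, div_pow, sq_abs]
  ring

/-- Hoeffding's lemma for a law on a finite set given by its weights. -/
theorem hoeffding_stdSimplex {S : Type*} [Fintype S] {p : S → ℝ} (hp : p ∈ stdSimplex ℝ S)
    {f : S → ℝ} {B : ℝ} (hB : ∀ x y, f x - f y ≤ B) (l : ℝ) :
    ∑ y, ENNReal.ofReal (p y) * ENNReal.ofReal (Real.exp (l * (f y - ∑ z, p z * f z))) ≤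
      ENNReal.ofReal (Real.exp (l ^ 2 * (B ^ 2 / 4) / 2)) := by
  let _ : MeasurableSpace S := ⊤
  set μ : Measure S := ∑ y, ENNReal.ofReal (p y) • Measure.dirac y with hμ
  have hS : Nonempty S := by
    by_contra h
    rw [not_nonempty_iff] at h
    have := hp.2
    simp at this
  have hprob : IsProbabilityMeasure μ := ⟨by
    rw [hμ, Measure.finsetSum_apply]
    simp only [Measure.smul_apply, Measure.dirac_apply' _ MeasurableSet.univ, Set.mem_univ,
      Set.indicator_of_mem, Pi.one_apply, smul_eq_mul, mul_one]
    rw [← ENNReal.ofReal_sum_of_nonneg fun y _ => hp.1 y, hp.2, ENNReal.ofReal_one]⟩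
  have hf : Measurable f := fun s _ => trivial
  have hint : ∫ y, f y ∂μ = ∑ z, p z * f z := by
    rw [hμ, integral_finsetSum_measure]
    · refine Finset.sum_congr rfl fun y _ => ?_
      rw [integral_smul_measure, integral_dirac, ENNReal.toReal_ofReal (hp.1 y), smul_eq_mul]
    · intro y _
      exact (integrable_dirac (by simp)).smul_measure ENNReal.ofReal_ne_top
  obtain ⟨m, hm⟩ := Finite.exists_min f
  have hrange : ∀ᵐ x ∂μ, f x ∈ Set.Icc (f m) (f m + B) :=
    ae_of_all _ fun x => ⟨hm x, by linarith [hB x m]⟩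
  have h := hoeffding_lintegral (μ := μ) hf hrange l
  rw [hint, add_sub_cancel_left] at h
  refine le_trans (le_of_eq ?_) h
  rw [hμ, lintegral_finsetSum_measure]
  refine Finset.sum_congr rfl fun y _ => ?_
  rw [lintegral_smul_measure, lintegral_dirac, smul_eq_mul]

/-- A bound on the conditional moment generating function may be checked on the cells of a
countable partition known at the time. -/
theorem mgfBound_of_partition {Ω Δ : Type*} [Countable Δ] {mΩ : MeasurableSpace Ω} {P : Measure Ω}
    {ℱ : Filtration ℕ mΩ} {I : ℕ → Set Ω} {X : ℕ → Ω → ℝ} {l c : ℝ} (D : ℕ → Ω → Δ)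
    (hD : ∀ t ≥ 1, ∀ d, MeasurableSet[ℱ t] {ω | D t ω = d})
    (h : ∀ t ≥ 1, ∀ F, MeasurableSet[ℱ t] F → F ⊆ I t → ∀ d, F ⊆ {ω | D t ω = d} →
      ∫⁻ ω in F, ENNReal.ofReal (Real.exp (l * X t ω)) ∂P ≤ ENNReal.ofReal (Real.exp c) * P F) :
    MgfBound P ℱ I X l c := by
  intro t ht F hF hFI
  have hU : F = ⋃ d, F ∩ {ω | D t ω = d} := by
    rw [← Set.inter_iUnion]
    ext ω; simp
  have hm : ∀ d, MeasurableSet (F ∩ {ω | D t ω = d}) := fun d =>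
    ℱ.le t _ (hF.inter (hD t ht d))
  have hdisj : Pairwise (Function.onFun Disjoint fun d => F ∩ {ω | D t ω = d}) := by
    intro d e hde
    refine Set.disjoint_left.2 fun ω h1 h2 => hde ?_
    have e1 : D t ω = d := h1.2
    have e2 : D t ω = e := h2.2
    exact e1.symm.trans e2
  rw [hU, lintegral_iUnion hm hdisj, measure_iUnion hdisj hm, ← ENNReal.tsum_mul_left]
  exact ENNReal.tsum_le_tsum fun d => h t ht _ (hF.inter (hD t ht d))
    (Set.inter_subset_left.trans hFI) d Set.inter_subset_right

section Interaction

variable {S A Ω : Type*} [Fintype S] {mΩ : MeasurableSpace Ω} {M : MDP S A}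
  {P : Measure Ω} {ℱ : Filtration ℕ mΩ} {h : Ω → Trajectory S A}

/-- The pair `(x, b)` is played at time `t`. -/
def playEvent (h : Ω → Trajectory S A) (x : S) (b : A) (t : ℕ) : Set Ω :=
  {ω | (h ω).st t = x ∧ (h ω).act t = b}

theorem measurableSet_playEvent (hi : IsInteraction M P ℱ h) (x : S) (b : A) :
    ∀ t ≥ 1, MeasurableSet[ℱ t] (playEvent h x b t) := fun t ht =>
  (hi.st_meas t ht x).inter (hi.act_meas t ht b)

theorem measurable_rew (hi : IsInteraction M P ℱ h) {t : ℕ} (ht : 1 ≤ t) :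
    Measurable fun ω => (h ω).rew t := (hi.rew_meas t ht).mono (ℱ.le _) le_rfl

theorem measurableSet_st (hi : IsInteraction M P ℱ h) {t : ℕ} (ht : 1 ≤ t) (y : S) :
    MeasurableSet {ω | (h ω).st t = y} := ℱ.le _ _ (hi.st_meas t ht y)

/-- Given the past and the pair played, the reward and the next state are independent with laws
`ν` and `p`. -/
theorem lintegral_interaction [IsProbabilityMeasure P] (hi : IsInteraction M P ℱ h) {t : ℕ}
    (ht : 1 ≤ t) {x : S} {b : A} {F : Set Ω} (hF : MeasurableSet[ℱ t] F)
    (hFx : F ⊆ playEvent h x b t) {φ : S → ℝ → ℝ≥0∞} (hφ : ∀ y, Measurable (φ y)) :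
    ∫⁻ ω in F, φ ((h ω).st (t + 1)) ((h ω).rew t) ∂P =
      P F * ∑ y, ENNReal.ofReal (M.p x b y) * ∫⁻ r, φ y r ∂(M.ν x b) := by
  have hFm : MeasurableSet F := ℱ.le _ _ hF
  have hr := measurable_rew hi ht
  have hst := fun y => measurableSet_st hi (by omega : 1 ≤ t + 1) y
  have hU : F = ⋃ y, F ∩ {ω | (h ω).st (t + 1) = y} := by
    rw [← Set.inter_iUnion]; ext ω; simp
  have hdisj : Pairwise (Function.onFun Disjoint fun y => F ∩ {ω | (h ω).st (t + 1) = y}) := by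
    intro d e hde
    refine Set.disjoint_left.2 fun ω h1 h2 => hde ?_
    have e1 : (h ω).st (t + 1) = d := h1.2
    have e2 : (h ω).st (t + 1) = e := h2.2
    exact e1.symm.trans e2
  have hm : ∀ y, MeasurableSet (F ∩ {ω | (h ω).st (t + 1) = y}) := fun y => hFm.inter (hst y)
  conv_lhs => rw [hU]
  rw [lintegral_iUnion hm hdisj, tsum_fintype, Finset.mul_sum]
  refine Finset.sum_congr rfl fun y _ => ?_
  have hmap : (P.restrict (F ∩ {ω | (h ω).st (t + 1) = y})).map (fun ω => (h ω).rew t)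
      = (P F * ENNReal.ofReal (M.p x b y)) • M.ν x b := by
    refine Measure.ext fun B hB => ?_
    rw [Measure.map_apply hr hB, Measure.restrict_apply (hr hB), Measure.smul_apply, smul_eq_mul]
    have h1 := hi.law t ht F hF x b y B hB
    have h2 : F ∩ {ω | (h ω).st t = x ∧ (h ω).act t = b} = F := Set.inter_eq_left.2 hFx
    have h3 : (fun ω => (h ω).rew t) ⁻¹' B ∩ (F ∩ {ω | (h ω).st (t + 1) = y}) =
        F ∩ {ω | (h ω).st t = x ∧ (h ω).act t = b ∧ (h ω).rew t ∈ B ∧ (h ω).st (t + 1) = y} := by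
      ext ω
      simp only [Set.mem_inter_iff, Set.mem_preimage, Set.mem_ofPred_eq]
      constructor
      · rintro ⟨h1, h2, h3⟩
        exact ⟨h2, (hFx h2).1, (hFx h2).2, h1, h3⟩
      · rintro ⟨h1, _, _, h2, h3⟩
        exact ⟨h2, h1, h3⟩
    rw [h3, h1, h2]
    ring
  calc _ = ∫⁻ ω in F ∩ {ω | (h ω).st (t + 1) = y}, φ y ((h ω).rew t) ∂P :=
        setLIntegral_congr_fun (hm y) fun ω hω => by
          have : (h ω).st (t + 1) = y := hω.2
          simp only [this]
    _ = ∫⁻ r, φ y r ∂((P.restrict (F ∩ {ω | (h ω).st (t + 1) = y})).map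
          (fun ω => (h ω).rew t)) := (lintegral_map (hφ y) hr).symm
    _ = _ := by rw [hmap, lintegral_smul_measure, smul_eq_mul, mul_assoc]

/-- A transition of probability zero is never observed. -/
theorem null_transition (hi : IsInteraction M P ℱ h) (x : S) (b : A) (y : S)
    (hp : M.p x b y = 0) :
    P {ω | ∃ t ≥ 1, ω ∈ playEvent h x b t ∧ (h ω).st (t + 1) = y} = 0 := by
  have hU : {ω | ∃ t ≥ 1, ω ∈ playEvent h x b t ∧ (h ω).st (t + 1) = y} =
      ⋃ (t : ℕ), ⋃ (_ : t ≥ 1), playEvent h x b t ∩ {ω | (h ω).st (t + 1) = y} := by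
    ext ω
    simp only [Set.mem_iUnion, Set.mem_inter_iff, Set.mem_ofPred_eq, exists_prop]
  rw [hU]
  refine measure_iUnion_null fun t => measure_iUnion_null fun ht => ?_
  have h1 := hi.law t ht Set.univ MeasurableSet.univ x b y Set.univ MeasurableSet.univ
  rw [hp, ENNReal.ofReal_zero, mul_zero, mul_zero] at h1
  rw [← h1]
  congr 1
  ext ω; simp [playEvent, and_assoc]

/-- Rewards: sub-Gaussian deviations of both signs. -/
theorem mgf_reward [IsProbabilityMeasure P] (hi : IsInteraction M P ℱ h) {t : ℕ}
    (ht : 1 ≤ t) {x : S} {b : A} {F : Set Ω} (hF : MeasurableSet[ℱ t] F)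
    (hFx : F ⊆ playEvent h x b t) (l : ℝ) :
    ∫⁻ ω in F, ENNReal.ofReal (Real.exp (l * ((h ω).rew t - M.mean x b))) ∂P ≤
      ENNReal.ofReal (Real.exp (l ^ 2 * (1 / 4) / 2)) * P F := by
  have := M.ν_prob x b
  rw [lintegral_interaction hi ht hF hFx
    (φ := fun _ r => ENNReal.ofReal (Real.exp (l * (r - M.mean x b)))) (fun _ => by fun_prop),
    ← Finset.sum_mul, mul_comm]
  rw [← ENNReal.ofReal_sum_of_nonneg fun y _ => (M.p_mem x b).1 y, (M.p_mem x b).2,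
    ENNReal.ofReal_one, one_mul]
  gcongr
  have h := hoeffding_lintegral (μ := M.ν x b) measurable_id (a := 0) (b := 1)
    ((ae_iff.2 (M.ν_supp x b))) l
  simpa [MDP.mean] using h

theorem mgf_transition [IsProbabilityMeasure P] (hi : IsInteraction M P ℱ h) {t : ℕ}
    (ht : 1 ≤ t) {x : S} {b : A} {F : Set Ω} (hF : MeasurableSet[ℱ t] F)
    (hFx : F ⊆ playEvent h x b t) (ψ : S → ℝ) :
    ∫⁻ ω in F, ENNReal.ofReal (Real.exp (ψ ((h ω).st (t + 1)))) ∂P =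
      P F * ∑ y, ENNReal.ofReal (M.p x b y) * ENNReal.ofReal (Real.exp (ψ y)) := by
  have := M.ν_prob x b
  rw [lintegral_interaction hi ht hF hFx
    (φ := fun y _ => ENNReal.ofReal (Real.exp (ψ y))) (fun _ => by fun_prop)]
  simp

theorem mgf_indicator [IsProbabilityMeasure P] [DecidableEq S] (hi : IsInteraction M P ℱ h)
    {t : ℕ} (ht : 1 ≤ t) {x : S} {b : A} {F : Set Ω} (hF : MeasurableSet[ℱ t] F)
    (hFx : F ⊆ playEvent h x b t) (y : S) (l : ℝ) :
    ∫⁻ ω in F, ENNReal.ofReal (Real.exp (l * ((if (h ω).st (t + 1) = y then 1 else 0)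
      - M.p x b y))) ∂P = ENNReal.ofReal (bernMgf (M.p x b y) l) * P F := by
  rw [mgf_transition hi ht hF hFx (fun z => l * ((if z = y then 1 else 0) - M.p x b y)), mul_comm]
  congr 1
  have hp := M.p_mem x b
  simp_rw [← ENNReal.ofReal_mul (hp.1 _)]
  rw [← ENNReal.ofReal_sum_of_nonneg fun z _ => mul_nonneg (hp.1 z) (Real.exp_pos _).le]
  congr 1
  rw [← Finset.add_sum_erase _ _ (Finset.mem_univ y)]
  have h1 : ∑ z ∈ Finset.univ.erase y, M.p x b z
      * Real.exp (l * ((if z = y then 1 else 0) - M.p x b y))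
      = (1 - M.p x b y) * Real.exp (-(l * M.p x b y)) := by
    rw [← hp.2, ← Finset.add_sum_erase _ _ (Finset.mem_univ y), add_sub_cancel_left,
      Finset.sum_mul]
    refine Finset.sum_congr rfl fun z hz => ?_
    rw [if_neg (Finset.ne_of_mem_erase hz)]
    ring_nf
  rw [h1, if_pos rfl, bernMgf]

end Interaction

/-! ### The true model lies in the confidence sets -/

namespace UCRL3

theorem g_pos {q : ℝ} (h0 : 0 < q) (h1 : q < 1) : 0 < g q := by
  refine lt_of_le_of_ne (g_nonneg h0.le h1.le) fun h => ?_
  by_cases hne : q = 1 / 2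
  · subst hne; norm_num [g] at h
  obtain ⟨θ, ht, hl⟩ := exists_tanh_eq h0 h1
  have hθ := tanh_param_ne_zero ht hne
  rw [g_eq h0 h1 ht hl hne, ht, eq_comm, div_eq_zero_iff] at h
  rcases h with h | h
  · exact hne (by linarith)
  · exact hθ (by linarith)

theorem gLow_pos {q : ℝ} (h0 : 0 < q) (h1 : q < 1) : 0 < gLow q := by
  unfold gLow
  split_ifs
  · exact g_pos h0 h1
  · exact mul_pos h0 (by linarith)

theorem log_level_pos {n : ℕ} (hn : 1 ≤ n) {d : ℝ} (hd : 0 < d) (hd1 : d ≤ 1) :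
    0 < Real.log (√((n : ℝ) + 1) / d) := by
  have h1 : (1 : ℝ) ≤ n := by exact_mod_cast hn
  have h2 : 1 < √((n : ℝ) + 1) := by
    rw [Real.lt_sqrt zero_le_one]; linarith
  refine Real.log_pos ?_
  rw [lt_div_iff₀ hd]
  linarith

theorem beta_pos {n : ℕ} (hn : 1 ≤ n) {d : ℝ} (hd : 0 < d) (hd1 : d ≤ 1) : 0 < beta n d := by
  have h1 : (0 : ℝ) < n := by exact_mod_cast hn
  have := log_level_pos hn hd hd1
  exact Real.sqrt_pos.2 (by positivity)

theorem ell_pos {n : ℕ} (hn : 2 ≤ n) {d : ℝ} (hd : 0 < d) (hd1 : d ≤ 1) : 0 < ell n d := by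
  obtain ⟨k, -, -, hk⟩ := exists_slice hn hd
  refine lt_of_lt_of_le (mul_pos (by norm_num) (Real.log_pos ?_)) hk
  rw [lt_div_iff₀ hd]
  have : (0:ℝ) ≤ k := Nat.cast_nonneg k
  nlinarith

theorem mul_sqrt_eq {a : ℝ} (ha : 0 ≤ a) (z : ℝ) : a * √z = √(a ^ 2 * z) := by
  rw [Real.sqrt_mul (sq_nonneg _), Real.sqrt_sq ha]

/-- The Laplace deviation of a sum of `n` terms, in terms of the width `beta n` for their mean. -/
theorem laplace_eq_beta {n : ℕ} (hn : 1 ≤ n) (d : ℝ) {v : ℝ} (hv : 0 ≤ v) :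
    √(2 * v * ((n : ℝ) + 1) * Real.log (√((n : ℝ) + 1) / d)) = n * (√v * beta n d) := by
  have h1 : (0 : ℝ) < n := by exact_mod_cast hn
  rw [beta, ← Real.sqrt_mul hv]
  rw [mul_sqrt_eq h1.le]
  congr 1
  field_simp

/-- The Bernstein deviation of a sum of `n` terms, in terms of the radius for their mean. -/
theorem bernstein_eq {n : ℕ} (hn : 1 ≤ n) (q e : ℝ) :
    √(2 * (q * (1 - q)) * n * e) + e / 3 = n * (√(2 * q * (1 - q) / n * e) + e / (3 * n)) := by
  have h1 : (0 : ℝ) < n := by exact_mod_cast hn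
  rw [mul_add]
  congr 1
  · rw [mul_sqrt_eq h1.le]
    congr 1
    field_simp
  · field_simp

end UCRL3

theorem filter_playEvent {S A Ω : Type*} [DecidableEq S] [DecidableEq A]
    {h : Ω → Trajectory S A} (x : S) (b : A) (t : ℕ) (ω : Ω)
    [DecidablePred fun i => ω ∈ playEvent h x b i] :
    ((Finset.Ico 1 t).filter fun i => ω ∈ playEvent h x b i) = (h ω).visits 1 t x b := by
  ext i
  simp only [Trajectory.visits, Finset.mem_filter]
  rfl

theorem Trajectory.N_eq_card {S A : Type*} [DecidableEq S] [DecidableEq A]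
    {H : Trajectory S A} {t : ℕ} {x : S} {b : A}
    (hn : (H.visits 1 t x b).Nonempty) : H.N t x b = (H.visits 1 t x b).card :=
  max_eq_right hn.card_pos

theorem psum_neg {Ω : Type*} {I : ℕ → Set Ω} {X : ℕ → Ω → ℝ} (t : ℕ) (ω : Ω) :
    psum I (fun i ω => -X i ω) t ω = -psum I X t ω := by
  simp [psum]

section Confidence

variable {S A Ω : Type*} [Fintype S] [DecidableEq S] [DecidableEq A]
  {mΩ : MeasurableSpace Ω} {M : MDP S A}
  {P : Measure Ω} {ℱ : Filtration ℕ mΩ} {h : Ω → Trajectory S A}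

theorem cnt_playEvent (x : S) (b : A) (t : ℕ) (ω : Ω) :
    cnt (playEvent h x b) t ω = ((h ω).visits 1 t x b).card := by
  rw [cnt, filter_playEvent]

theorem psum_reward (x : S) (b : A) (t : ℕ) (ω : Ω) (m : ℝ)
    (hn : ((h ω).visits 1 t x b).Nonempty) :
    psum (playEvent h x b) (fun i ω => (h ω).rew i - m) t ω
      = (h ω).N t x b * ((h ω).rHat t x b - m) := by
  rw [psum, filter_playEvent, Trajectory.rHat, Finset.sum_sub_distrib, Finset.sum_const,
    Trajectory.N_eq_card hn, nsmul_eq_mul]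
  have : ((((h ω).visits 1 t x b).card : ℕ) : ℝ) ≠ 0 := by exact_mod_cast hn.card_pos.ne'
  field_simp

theorem psum_transition (x : S) (b : A) (t : ℕ) (ω : Ω) (y : S) (q : ℝ)
    (hn : ((h ω).visits 1 t x b).Nonempty) :
    psum (playEvent h x b) (fun i ω => (if (h ω).st (i + 1) = y then 1 else 0) - q) t ω
      = (h ω).N t x b * ((h ω).pHat t x b y - q) := by
  rw [psum, filter_playEvent, Trajectory.pHat, Finset.sum_sub_distrib, Finset.sum_const,
    Trajectory.N_eq_card hn, nsmul_eq_mul, Finset.sum_boole]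
  have : ((((h ω).visits 1 t x b).card : ℕ) : ℝ) ≠ 0 := by exact_mod_cast hn.card_pos.ne'
  field_simp

variable [IsProbabilityMeasure P]

theorem measure_reward_deviation_le (hi : IsInteraction M P ℱ h) (x : S) (b : A) {d : ℝ}
    (hd : 0 < d) :
    P {ω | ∃ t ≥ 1, ((h ω).visits 1 t x b).Nonempty ∧
      UCRL3.beta ((h ω).N t x b) d / 2 < |(h ω).rHat t x b - M.mean x b|} ≤
      ENNReal.ofReal d + ENNReal.ofReal d := by
  have hI := measurableSet_playEvent hi x b
  have hX : ∀ t ≥ 1, Measurable[ℱ (t + 1)] fun ω => (h ω).rew t - M.mean x b := fun t ht =>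
    (hi.rew_meas t ht).sub_const _
  have hX' : ∀ t ≥ 1, Measurable[ℱ (t + 1)] fun ω => -((h ω).rew t - M.mean x b) := fun t ht =>
    (hX t ht).neg
  have h1 := laplace_bound (P := P) hI hX (v := 1 / 4) (by norm_num)
    (fun l _ t ht F hF hFx => mgf_reward hi ht hF hFx l) hd
  have h2 := laplace_bound (P := P) hI hX' (v := 1 / 4) (by norm_num)
    (fun l _ t ht F hF hFx => by
      simpa only [neg_mul, mul_neg, neg_sq] using mgf_reward hi ht hF hFx (-l)) hd
  refine (measure_mono ?_).trans ((measure_union_le _ _).trans (add_le_add h1 h2))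
  rintro ω ⟨t, ht, hn, hlt⟩
  have hN : cnt (playEvent h x b) t ω = (h ω).N t x b := by
    rw [cnt_playEvent, Trajectory.N_eq_card hn]
  have hN1 : 1 ≤ (h ω).N t x b := le_max_left _ _
  have hN0 : (0 : ℝ) < (h ω).N t x b := by exact_mod_cast hN1
  have hs : √(1 / 4 : ℝ) = 1 / 2 := by
    rw [show (1 / 4 : ℝ) = (1 / 2) ^ 2 by norm_num]; exact Real.sqrt_sq (by norm_num)
  rcases lt_abs.1 hlt with hlt | hlt
  · left
    refine ⟨t, ht, ?_⟩
    rw [hN, UCRL3.laplace_eq_beta hN1 d (by norm_num), psum_reward _ _ _ _ _ hn, hs]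
    exact mul_lt_mul_of_pos_left (by linarith) hN0
  · right
    refine ⟨t, ht, ?_⟩
    rw [psum_neg, hN, UCRL3.laplace_eq_beta hN1 d (by norm_num), psum_reward _ _ _ _ _ hn, hs,
      ← mul_neg]
    exact mul_lt_mul_of_pos_left (by linarith) hN0

/-- A deterministic transition almost surely never fails. -/
theorem measure_exists_transition_ne (hi : IsInteraction M P ℱ h) (x : S) (b : A) (y : S)
    (hp : M.p x b y = 1) :
    P {ω | ∃ t ≥ 1, ω ∈ playEvent h x b t ∧ (h ω).st (t + 1) ≠ y} = 0 := by
  have hz : ∀ z, z ≠ y → M.p x b z = 0 := fun z hz => by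
    have h1 := (M.p_mem x b).2
    rw [← Finset.add_sum_erase _ _ (Finset.mem_univ y), hp] at h1
    have h2 : ∑ z ∈ Finset.univ.erase y, M.p x b z = 0 := by linarith
    exact (Finset.sum_eq_zero_iff_of_nonneg fun z _ => (M.p_mem x b).1 z).1 h2 z (by simp [hz])
  refine measure_mono_null (t := ⋃ (z : S), ⋃ (_ : z ≠ y),
    {ω | ∃ t ≥ 1, ω ∈ playEvent h x b t ∧ (h ω).st (t + 1) = z}) ?_ ?_
  · rintro ω ⟨t, ht, h1, h2⟩
    exact Set.mem_iUnion.2 ⟨_, Set.mem_iUnion.2 ⟨h2, t, ht, h1, rfl⟩⟩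
  · exact measure_iUnion_null fun z => measure_iUnion_null fun hzy =>
      null_transition hi x b z (hz z hzy)

/-- Mass of the event that `p(y | x, b)` leaves its confidence set: two Laplace and two Bernstein
bounds, one for each tail. -/
theorem transition_deviation (hi : IsInteraction M P ℱ h) (x : S) (b : A) (y : S) {d : ℝ}
    (hd : 0 < d) (hd1 : d ≤ 1) :
    P {ω | ∃ t ≥ 1, M.p x b y ∉ UCRL3.transSet (h ω) t d x b y} ≤ 4 * ENNReal.ofReal d := by
  set q := M.p x b y with hq
  have hq0 : 0 ≤ q := (M.p_mem x b).1 y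
  have hq1 : q ≤ 1 := by
    have h1 := Finset.single_le_sum (f := M.p x b) (fun z _ => (M.p_mem x b).1 z)
      (Finset.mem_univ y)
    rwa [(M.p_mem x b).2] at h1
  -- For a deterministic transition the empirical frequency is exact.
  have hdet : ∀ (ω : Ω) (t : ℕ), t ≥ 1 → (((h ω).visits 1 t x b).Nonempty →
      (h ω).pHat t x b y = q) → q ∈ UCRL3.transSet (h ω) t d x b y := fun ω t ht he => by
    refine ⟨⟨hq0, hq1⟩, fun hn => ?_⟩
    have hN1 : 1 ≤ (h ω).N t x b := le_max_left _ _
    simp only [he hn, sub_self, abs_zero, zero_div, Left.neg_nonpos_iff]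
    refine ⟨fun h2 => ?_, Real.sqrt_nonneg _, Real.sqrt_nonneg _⟩
    have := UCRL3.ell_pos h2 hd hd1
    have := Real.sqrt_nonneg (2 * q * (1 - q) / ((h ω).N t x b) * UCRL3.ell ((h ω).N t x b) d)
    positivity
  have hpsum := fun (ω : Ω) (t : ℕ) (hn : ((h ω).visits 1 t x b).Nonempty) =>
    psum_transition (h := h) x b t ω y q hn
  rcases hq0.eq_or_lt with h0 | h0
  · refine (measure_mono_null ?_ (null_transition hi x b y h0.symm)).le.trans zero_le
    rintro ω ⟨t, ht, hnot⟩
    by_contra hcon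
    refine hnot (hdet ω t ht fun hn => ?_)
    rw [Trajectory.pHat, ← h0, div_eq_zero_iff]
    left
    rw [Nat.cast_eq_zero, Finset.card_eq_zero, Finset.filter_eq_empty_iff]
    intro i hi' hy
    simp only [Trajectory.visits, Finset.mem_filter, Finset.mem_Ico] at hi'
    exact hcon ⟨i, hi'.1.1, hi'.2, hy⟩
  rcases hq1.eq_or_lt with h1 | h1
  · refine (measure_mono_null ?_ (measure_exists_transition_ne hi x b y h1)).le.trans zero_le
    rintro ω ⟨t, ht, hnot⟩
    by_contra hcon
    refine hnot (hdet ω t ht fun hn => ?_)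
    have hN0 : (0 : ℝ) < ((h ω).visits 1 t x b).card := by exact_mod_cast hn.card_pos
    rw [Trajectory.pHat, h1, Trajectory.N_eq_card hn, div_eq_one_iff_eq hN0.ne']
    rw [Finset.filter_true_of_mem]
    intro i hi'
    simp only [Trajectory.visits, Finset.mem_filter, Finset.mem_Ico] at hi'
    by_contra hy
    exact hcon ⟨i, hi'.1.1, hi'.2, hy⟩
  have hI := measurableSet_playEvent hi x b
  have hX : ∀ t ≥ 1, Measurable[ℱ (t + 1)]
      fun ω => ((if (h ω).st (t + 1) = y then 1 else 0) - q : ℝ) := fun t ht =>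
    (Measurable.ite (hi.st_meas (t + 1) (by omega) y) measurable_const measurable_const).sub_const _
  have hX' : ∀ t ≥ 1, Measurable[ℱ (t + 1)]
      fun ω => -((if (h ω).st (t + 1) = y then 1 else 0) - q : ℝ) := fun t ht => (hX t ht).neg
  have mgf : ∀ l c, bernMgf q l ≤ Real.exp c → MgfBound P ℱ (playEvent h x b)
      (fun i ω => (if (h ω).st (i + 1) = y then 1 else 0) - q) l c :=
    fun l c hle t ht F hF hFx => by
    rw [mgf_indicator hi ht hF hFx y l]
    gcongr
  have mgf' : ∀ l c, bernMgf q (-l) ≤ Real.exp c → MgfBound P ℱ (playEvent h x b)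
      (fun i ω => -((if (h ω).st (i + 1) = y then 1 else 0) - q)) l c :=
    fun l c hle t ht F hF hFx => by
      have := mgf (-l) c hle t ht F hF hFx
      simpa only [neg_mul, mul_neg] using this
  have e1 := laplace_bound (P := P) hI hX (UCRL3.gLow_pos h0 h1)
    (fun l hl => mgf l _ (bernMgf_le_gLow h0 h1 hl.le)) hd
  have e2 := laplace_bound (P := P) hI hX' (UCRL3.g_pos h0 h1)
    (fun l hl => mgf' l _ (by simpa using bernMgf_le_kearnsSaul h0 h1 (-l))) hd
  have hv : 0 < q * (1 - q) := mul_pos h0 (by linarith)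
  have e3 := bernstein_bound (P := P) hI hX hv
    (fun l hl hl3 => mgf l _ (bernMgf_le_bernstein hq0 hq1 hl hl3)) hd hd1
  have e4 := bernstein_bound (P := P) hI hX' hv
    (fun l hl hl3 => mgf' l _ (by
      have := bernMgf_le_bernstein (q := 1 - q) (by linarith) (by linarith) hl hl3
      rw [bernMgf_swap] at this
      refine this.trans (le_of_eq ?_)
      ring_nf)) hd hd1
  have e : P _ ≤ 4 * ENNReal.ofReal d := (measure_union_le _ _).trans ((add_le_add
    ((measure_union_le _ _).trans (add_le_add e1 e2))
    ((measure_union_le _ _).trans (add_le_add e3 e4))).trans (le_of_eq (by ring)))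
  refine (measure_mono ?_).trans e
  rintro ω ⟨t, ht, hnot⟩
  by_contra hcon
  simp only [Set.mem_union, Set.mem_ofPred_eq, not_or, not_exists, not_and, not_lt,
    psum_neg] at hcon
  obtain ⟨⟨c1, c2⟩, c3, c4⟩ := hcon
  refine hnot ⟨⟨hq0, hq1⟩, fun hn => ?_⟩
  have hN : cnt (playEvent h x b) t ω = (h ω).N t x b := by
    rw [cnt_playEvent, Trajectory.N_eq_card hn]
  have hN1 : 1 ≤ (h ω).N t x b := le_max_left _ _
  have hN0 : (0 : ℝ) < (h ω).N t x b := by exact_mod_cast hN1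
  have c1 := c1 t ht
  have c2 := c2 t ht
  have c3 := c3 t ht
  have c4 := c4 t ht
  rw [hN, hpsum ω t hn] at c1 c2 c3 c4
  rw [UCRL3.laplace_eq_beta hN1 d (UCRL3.gLow_pos h0 h1).le] at c1
  rw [UCRL3.laplace_eq_beta hN1 d (UCRL3.g_pos h0 h1).le, ← mul_neg] at c2
  rw [UCRL3.bernstein_eq hN1] at c3 c4
  rw [← mul_neg] at c4
  have hβ := UCRL3.beta_pos hN1 hd hd1
  have c1 := le_of_mul_le_mul_left c1 hN0
  have c2 := le_of_mul_le_mul_left c2 hN0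
  refine ⟨fun h2 => ?_, ?_, ?_⟩
  · have c3 := le_of_mul_le_mul_left (c3 h2) hN0
    have c4 := le_of_mul_le_mul_left (c4 h2) hN0
    exact abs_le.2 ⟨by linarith, c3⟩
  · rw [le_div_iff₀ hβ]; linarith
  · rw [div_le_iff₀ hβ]; linarith

/-- At every time the true model belongs to the confidence sets of level `d`. -/
def ModelInConfSets (M : MDP S A) (d : ℝ) (H : Trajectory S A) : Prop :=
  ∀ t ≥ 1, ∀ x b, (((H.visits 1 t x b).Nonempty →
    |H.rHat t x b - M.mean x b| ≤ UCRL3.beta (H.N t x b) d / 2) ∧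
    ∀ y, M.p x b y ∈ UCRL3.transSet H t d x b y)

/-- Union bound over the pairs: two deviations of the mean reward, and four deviations of each
transition probability. -/
theorem measure_not_modelInConfSets [Fintype A] (hi : IsInteraction M P ℱ h) {d : ℝ}
    (hd : 0 < d) (hd1 : d ≤ 1) :
    P {ω | ¬ ModelInConfSets M d (h ω)} ≤ ENNReal.ofReal
      ((2 + 4 * (Fintype.card S : ℝ)) * ((Fintype.card S : ℝ) * Fintype.card A) * d) := by
  have hsub : {ω | ¬ ModelInConfSets M d (h ω)} ⊆ ⋃ x, ⋃ b,
      ({ω | ∃ t ≥ 1, ((h ω).visits 1 t x b).Nonempty ∧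
        UCRL3.beta ((h ω).N t x b) d / 2 < |(h ω).rHat t x b - M.mean x b|} ∪
      ⋃ y, {ω | ∃ t ≥ 1, M.p x b y ∉ UCRL3.transSet (h ω) t d x b y}) := by
    intro ω hω
    by_contra hcon
    refine hω fun t ht x b => ?_
    simp only [Set.mem_iUnion, Set.mem_union, Set.mem_ofPred_eq, not_exists, not_or, not_and,
      not_lt, not_not] at hcon
    exact ⟨(hcon x b).1 t ht, fun y => (hcon x b).2 y t ht⟩
  refine (measure_mono hsub).trans ?_
  have hle : ∀ x b, P ({ω | ∃ t ≥ 1, ((h ω).visits 1 t x b).Nonempty ∧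
        UCRL3.beta ((h ω).N t x b) d / 2 < |(h ω).rHat t x b - M.mean x b|} ∪
      ⋃ y, {ω | ∃ t ≥ 1, M.p x b y ∉ UCRL3.transSet (h ω) t d x b y}) ≤
      (2 + 4 * (Fintype.card S : ℝ≥0∞)) * ENNReal.ofReal d := fun x b => by
    have hy : P (⋃ y, {ω | ∃ t ≥ 1, M.p x b y ∉ UCRL3.transSet (h ω) t d x b y}) ≤
        Fintype.card S * (4 * ENNReal.ofReal d) := by
      refine (measure_iUnion_le _).trans ?_
      rw [tsum_fintype]
      refine (Finset.sum_le_sum fun y _ => transition_deviation hi x b y hd hd1).trans ?_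
      simp
    exact (measure_union_le _ _).trans
      ((add_le_add (measure_reward_deviation_le hi x b hd) hy).trans
      (le_of_eq (by ring)))
  refine (measure_iUnion_le _).trans ?_
  rw [tsum_fintype]
  refine (Finset.sum_le_sum fun x _ => (measure_iUnion_le _).trans ((tsum_fintype _).le.trans
    (Finset.sum_le_sum fun b _ => hle x b))).trans ?_
  simp only [Finset.sum_const, Finset.card_univ, nsmul_eq_mul]
  rw [ENNReal.ofReal_mul (by positivity), ENNReal.ofReal_mul (by positivity),
    ENNReal.ofReal_mul (by positivity), ENNReal.ofReal_add (by positivity) (by positivity),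
    ENNReal.ofReal_mul (by positivity)]
  simp only [ENNReal.ofReal_ofNat, ENNReal.ofReal_natCast]
  refine le_of_eq ?_
  ring

end Confidence

/-! ### The discrete history and the two martingales -/

section History

variable {S A : Type*} [DecidableEq S] [DecidableEq A]

theorem Trajectory.visits_congr {H H' : Trajectory S A} {lo hi n : ℕ} (hlo : 1 ≤ lo)
    (hhi : hi ≤ n + 1) (hst : ∀ i, 1 ≤ i → i ≤ n → H.st i = H'.st i)
    (hact : ∀ i, 1 ≤ i → i ≤ n → H.act i = H'.act i) (x : S) (b : A) :
    H.visits lo hi x b = H'.visits lo hi x b := by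
  unfold Trajectory.visits
  refine Finset.filter_congr fun i hi' => ?_
  have := Finset.mem_Ico.1 hi'
  rw [hst i (by omega) (by omega), hact i (by omega) (by omega)]

theorem Trajectory.N_congr {H H' : Trajectory S A} {t n : ℕ}
    (ht : t ≤ n + 1) (hst : ∀ i, 1 ≤ i → i ≤ n → H.st i = H'.st i)
    (hact : ∀ i, 1 ≤ i → i ≤ n → H.act i = H'.act i) : H.N t = H'.N t := by
  funext x b
  rw [Trajectory.N, Trajectory.N, Trajectory.visits_congr le_rfl ht hst hact]

namespace UCRL3

theorem episodeStart_mem (H : Trajectory S A) (pl : ℕ → S → A) {t : ℕ} (ht : 1 ≤ t) :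
    1 ≤ episodeStart H pl t ∧ episodeStart H pl t ≤ t := by
  induction t with
  | zero => omega
  | succ t ih =>
    rw [episodeStart]
    split_ifs with h
    · have := ih h.1; omega
    · omega

theorem episodeStart_congr {H H' : Trajectory S A} {pl pl' : ℕ → S → A} {t : ℕ} (ht : 1 ≤ t)
    (hst : ∀ i, 1 ≤ i → i ≤ t → H.st i = H'.st i)
    (hact : ∀ i, 1 ≤ i → i ≤ t → H.act i = H'.act i)
    (hpl : ∀ i, 1 ≤ i → i ≤ t → pl i = pl' i) :
    episodeStart H pl t = episodeStart H' pl' t := by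
  induction t with
  | zero => omega
  | succ t ih =>
    rcases Nat.eq_zero_or_pos t with rfl | h0
    · simp [episodeStart]
    · have ih' := ih h0 (fun i h1 h2 => hst i h1 (by omega)) (fun i h1 h2 => hact i h1 (by omega))
        (fun i h1 h2 => hpl i h1 (by omega))
      have hm := episodeStart_mem H pl h0
      rw [episodeStart, episodeStart]
      rw [← ih', ← hst (t + 1) (by omega) le_rfl, ← hpl t h0 (by omega),
        Trajectory.N_congr (H := H) (H' := H') (n := t + 1) (by omega) hst hact,
        Trajectory.visits_congr (H := H) (H' := H') (n := t + 1) hm.1 (by omega) hst hact]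

/-- What is known about the episode in progress at time `t`: its start, its policy and the counts
at its start. -/
def episodeData (H : Trajectory S A) (pl : ℕ → S → A) (t : ℕ) : ℕ × (S → A) × (S → A → ℕ) :=
  (episodeStart H pl t, pl t, H.N (episodeStart H pl t))

end UCRL3

end History

theorem measurable_comp_of_countable {Ω Γ β : Type*} [Countable Γ] {m : MeasurableSpace Ω}
    [MeasurableSpace β] {C : Ω → Γ} (hC : ∀ c, MeasurableSet {ω | C ω = c}) (f : Γ → β) :
    Measurable fun ω => f (C ω) := by
  let _ : MeasurableSpace Γ := ⊤
  have h1 : Measurable C := measurable_to_countable' hC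
  exact (measurable_from_top (f := f)).comp h1

theorem measurableSet_prod_fiber {Ω Γ Γ' : Type*} {m : MeasurableSpace Ω} {C : Ω → Γ} {C' : Ω → Γ'}
    (hC : ∀ c, MeasurableSet {ω | C ω = c}) (hC' : ∀ c, MeasurableSet {ω | C' ω = c}) (c : Γ × Γ') :
    MeasurableSet {ω | (C ω, C' ω) = c} := by
  have : {ω | (C ω, C' ω) = c} = {ω | C ω = c.1} ∩ {ω | C' ω = c.2} := by
    ext ω; simp [Prod.ext_iff]
  rw [this]
  exact (hC _).inter (hC' _)

section Martingales

open UCRL3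

variable {S A Ω : Type*} [Fintype S] [DecidableEq S] [Fintype A] [DecidableEq A]
  {mΩ : MeasurableSpace Ω} {M : MDP S A}
  {P : Measure Ω} {ℱ : Filtration ℕ mΩ} {h : Ω → Trajectory S A} {pol : Ω → ℕ → S → A}

/-- The data of the current episode is a function of the discrete history, hence known. -/
theorem measurableSet_episodeData (hi : IsInteraction M P ℱ h)
    (hpol : ∀ t ≥ 1, ∀ π : S → A, MeasurableSet[ℱ t] {ω | pol ω t = π}) (t : ℕ) (ht : t ≥ 1)
    (d : ℕ × (S → A) × (S → A → ℕ)) :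
    MeasurableSet[ℱ t] {ω | episodeData (h ω) (pol ω) t = d} := by
  -- the history consists of finitely many variables with finitely many values
  let hist : Ω → (Finset.Icc 1 t → S × A × (S → A)) := fun ω i =>
    ((h ω).st i, (h ω).act i, pol ω i)
  have hm : ∀ c, MeasurableSet[ℱ t] {ω | hist ω = c} := fun c => by
    have : {ω | hist ω = c} = ⋂ i : Finset.Icc 1 t, {ω | (h ω).st i = (c i).1} ∩
        ({ω | (h ω).act i = (c i).2.1} ∩ {ω | pol ω i = (c i).2.2}) := by
      ext ω
      simp [hist, funext_iff, Prod.ext_iff]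
    rw [this]
    refine MeasurableSet.iInter (m := ℱ t) fun i => ?_
    have hi' := Finset.mem_Icc.1 i.2
    exact ℱ.mono hi'.2 _ ((hi.st_meas i hi'.1 _).inter
      ((hi.act_meas i hi'.1 _).inter (hpol i hi'.1 _)))
  have hfac : ∀ ω ω', hist ω = hist ω' →
      episodeData (h ω) (pol ω) t = episodeData (h ω') (pol ω') t := fun ω ω' he => by
    have hall : ∀ i, 1 ≤ i → i ≤ t → (h ω).st i = (h ω').st i ∧ (h ω).act i = (h ω').act i ∧
        pol ω i = pol ω' i := fun i h1 h2 => by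
      have := congrFun he ⟨i, Finset.mem_Icc.2 ⟨h1, h2⟩⟩
      simpa [hist, Prod.ext_iff] using this
    have e1 := episodeStart_congr ht (fun i h1 h2 => (hall i h1 h2).1)
      (fun i h1 h2 => (hall i h1 h2).2.1) (fun i h1 h2 => (hall i h1 h2).2.2)
    have hmem := episodeStart_mem (h ω) (pol ω) ht
    rw [episodeData, episodeData, ← e1, (hall t ht le_rfl).2.2,
      Trajectory.N_congr (H := h ω) (H' := h ω') (n := t) (by omega)
        (fun i h1 h2 => (hall i h1 h2).1) (fun i h1 h2 => (hall i h1 h2).2.1)]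
  have hU : {ω | episodeData (h ω) (pol ω) t = d} =
      ⋃ c ∈ {c | ∃ ω, hist ω = c ∧ episodeData (h ω) (pol ω) t = d}, {ω | hist ω = c} := by
    ext ω
    simp only [Set.mem_ofPred_eq, Set.mem_iUnion, exists_prop]
    constructor
    · intro hω; exact ⟨hist ω, ⟨ω, rfl, hω⟩, rfl⟩
    · rintro ⟨c, ⟨ω', h1, h2⟩, h3⟩
      rw [hfac ω ω' (h3.trans h1.symm), h2]
  rw [hU]
  exact MeasurableSet.biUnion (m := ℱ t) (Set.to_countable _) fun c _ => hm c

theorem measurableSet_late (hi : IsInteraction M P ℱ h)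
    (hpol : ∀ t ≥ 1, ∀ π : S → A, MeasurableSet[ℱ t] {ω | pol ω t = π}) (late : ℕ → Prop) :
    ∀ t ≥ 1, MeasurableSet[ℱ t] {ω | late (episodeStart (h ω) (pol ω) t)} := fun t ht => by
  have := measurable_comp_of_countable (m := ℱ t) (measurableSet_episodeData hi hpol t ht)
    (fun d => late d.1)
  simpa only [Set.preimage_singleton_true, episodeData] using this (measurableSet_singleton True)

/-- Almost surely all rewards lie in the unit interval. -/
theorem rewards_mem_Icc (hi : IsInteraction M P ℱ h) :
    P {ω | ¬ ∀ t ≥ 1, (h ω).rew t ∈ Set.Icc (0 : ℝ) 1} = 0 := by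
  have hU : {ω | ¬ ∀ t ≥ 1, (h ω).rew t ∈ Set.Icc (0 : ℝ) 1} ⊆
      ⋃ (t : ℕ), ⋃ (_ : t ≥ 1), ⋃ (x : S), ⋃ (b : A), ⋃ (y : S),
      {ω | (h ω).st t = x ∧ (h ω).act t = b ∧ (h ω).rew t ∈ (Set.Icc (0:ℝ) 1)ᶜ ∧
        (h ω).st (t + 1) = y} := by
    intro ω hω
    simp only [Set.mem_ofPred_eq, not_forall] at hω
    obtain ⟨t, ht, hlt⟩ := hω
    simp only [Set.mem_iUnion]
    exact ⟨t, ht, _, _, _, rfl, rfl, hlt, rfl⟩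
  refine measure_mono_null hU ?_
  refine measure_iUnion_null fun t => measure_iUnion_null fun ht => measure_iUnion_null fun x =>
    measure_iUnion_null fun b => measure_iUnion_null fun y => ?_
  have h1 := hi.law t ht Set.univ MeasurableSet.univ x b y (Set.Icc (0:ℝ) 1)ᶜ
    measurableSet_Icc.compl
  rw [M.ν_supp, zero_mul, mul_zero, Set.univ_inter] at h1
  exact h1

variable [IsProbabilityMeasure P]

/-- Deviation of the collected rewards from their conditional means, over the late episodes. -/
theorem martingale_reward (hi : IsInteraction M P ℱ h)
    (hpol : ∀ t ≥ 1, ∀ π : S → A, MeasurableSet[ℱ t] {ω | pol ω t = π}) (late : ℕ → Prop)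
    {d : ℝ} (hd : 0 < d) :
    P {ω | ∃ t ≥ 1, √(2 * (1 / 4) * (cnt (fun t => {ω | late (episodeStart (h ω) (pol ω) t)}) t ω
        + 1) * Real.log (√((cnt (fun t => {ω | late (episodeStart (h ω) (pol ω) t)}) t ω : ℝ) + 1)
          / d)) < psum (fun t => {ω | late (episodeStart (h ω) (pol ω) t)})
        (fun t ω => M.mean ((h ω).st t) ((h ω).act t) - (h ω).rew t) t ω} ≤ ENNReal.ofReal d := by
  have hpair : ∀ t ≥ 1, ∀ c : S × A, MeasurableSet[ℱ t] {ω | ((h ω).st t, (h ω).act t) = c} :=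
    fun t ht c => measurableSet_prod_fiber (hi.st_meas t ht) (hi.act_meas t ht) c
  refine laplace_bound (measurableSet_late hi hpol late) (fun t ht => ?_) (by norm_num)
    (fun l _ => ?_) hd
  · refine Measurable.sub ?_ (hi.rew_meas t ht)
    exact (measurable_comp_of_countable (m := ℱ t) (hpair t ht)
      (fun c => M.mean c.1 c.2)).mono (ℱ.mono (by omega)) le_rfl
  · refine mgfBound_of_partition (fun t ω => ((h ω).st t, (h ω).act t)) hpair ?_
    rintro t ht F hF - ⟨x, b⟩ hFx
    have hFx' : F ⊆ playEvent h x b t := fun ω hω => by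
      have : ((h ω).st t, (h ω).act t) = (x, b) := hFx hω
      exact Prod.ext_iff.1 this
    have h1 := mgf_reward hi ht hF hFx' (-l)
    rw [neg_sq] at h1
    refine le_trans (le_of_eq ?_) h1
    refine setLIntegral_congr_fun (ℱ.le _ _ hF) fun ω hω => ?_
    rw [(hFx' hω).1, (hFx' hω).2]
    ring_nf

/-- Deviation of a predictable bias from its conditional mean, over the late episodes. The bias is
a function of the data of the current episode. -/
theorem martingale_bias (hi : IsInteraction M P ℱ h)
    (hpol : ∀ t ≥ 1, ∀ π : S → A, MeasurableSet[ℱ t] {ω | pol ω t = π}) (late : ℕ → Prop)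
    (U : ℕ × (S → A) × (S → A → ℕ) → S → ℝ) {B : ℝ} (hB0 : 0 < B)
    (hB : ∀ d x y, U d x - U d y ≤ B) {d : ℝ} (hd : 0 < d) :
    P {ω | ∃ t ≥ 1, √(2 * (B ^ 2 / 4) *
        (cnt (fun t => {ω | late (episodeStart (h ω) (pol ω) t)}) t ω
        + 1) * Real.log (√((cnt (fun t => {ω | late (episodeStart (h ω) (pol ω) t)}) t ω : ℝ) + 1)
          / d)) < psum (fun t => {ω | late (episodeStart (h ω) (pol ω) t)})
        (fun t ω => ∑ z, M.p ((h ω).st t) ((h ω).act t) z * U (episodeData (h ω) (pol ω) t) z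
          - U (episodeData (h ω) (pol ω) t) ((h ω).st (t + 1))) t ω} ≤ ENNReal.ofReal d := by
  have hcell : ∀ t ≥ 1, ∀ c : (S × A) × (ℕ × (S → A) × (S → A → ℕ)), MeasurableSet[ℱ t]
      {ω | (((h ω).st t, (h ω).act t), episodeData (h ω) (pol ω) t) = c} := fun t ht c =>
    measurableSet_prod_fiber (fun c => measurableSet_prod_fiber (hi.st_meas t ht)
      (hi.act_meas t ht) c) (measurableSet_episodeData hi hpol t ht) c
  refine laplace_bound (measurableSet_late hi hpol late) (fun t ht => ?_) (by positivity)
    (fun l _ => ?_) hd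
  · have hc : ∀ c : ((S × A) × (ℕ × (S → A) × (S → A → ℕ))) × S, MeasurableSet[ℱ (t + 1)]
        {ω | ((((h ω).st t, (h ω).act t), episodeData (h ω) (pol ω) t), (h ω).st (t + 1)) = c} :=
      fun c => measurableSet_prod_fiber (fun c => ℱ.mono (by omega : t ≤ t + 1) _ (hcell t ht c))
        (hi.st_meas (t + 1) (by omega)) c
    exact measurable_comp_of_countable (m := ℱ (t + 1)) hc
      (fun c => ∑ z, M.p c.1.1.1 c.1.1.2 z * U c.1.2 z - U c.1.2 c.2)
  · refine mgfBound_of_partition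
      (fun t ω => (((h ω).st t, (h ω).act t), episodeData (h ω) (pol ω) t)) hcell ?_
    rintro t ht F hF - ⟨⟨x, b⟩, e⟩ hFx
    have hFe : ∀ ω ∈ F, ((h ω).st t = x ∧ (h ω).act t = b) ∧ episodeData (h ω) (pol ω) t = e :=
      fun ω hω => by
        have : (((h ω).st t, (h ω).act t), episodeData (h ω) (pol ω) t) = ((x, b), e) := hFx hω
        exact ⟨Prod.ext_iff.1 (Prod.ext_iff.1 this).1, (Prod.ext_iff.1 this).2⟩
    have hFx' : F ⊆ playEvent h x b t := fun ω hω => (hFe ω hω).1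
    have h1 := mgf_transition hi ht hF hFx'
      (fun y => -l * (U e y - ∑ z, M.p x b z * U e z))
    have h2 := hoeffding_stdSimplex (M.p_mem x b) (hB e) (-l)
    rw [neg_sq] at h2
    calc _ = ∫⁻ ω in F, ENNReal.ofReal (Real.exp (-l * (U e ((h ω).st (t + 1))
          - ∑ z, M.p x b z * U e z))) ∂P := by
          refine setLIntegral_congr_fun (ℱ.le _ _ hF) fun ω hω => ?_
          rw [(hFe ω hω).1.1, (hFe ω hω).1.2, (hFe ω hω).2]
          ring_nf
      _ = P F * ∑ y, ENNReal.ofReal (M.p x b y) * ENNReal.ofReal (Real.exp (-l * (U e y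
          - ∑ z, M.p x b z * U e z))) := h1
      _ ≤ _ := by rw [mul_comm]; gcongr

end Martingales

/-! ### Hitting times, diameters and gains -/

namespace MDP

section

variable {S A : Type*} [Fintype S] (M : MDP S A)

theorem mean_mem (s : S) (a : A) : 0 ≤ M.mean s a ∧ M.mean s a ≤ 1 := by
  have := M.ν_prob s a
  have hae : ∀ᵐ x ∂(M.ν s a), x ∈ Set.Icc (0 : ℝ) 1 := ae_iff.2 (M.ν_supp s a)
  have hint : Integrable (fun x : ℝ => x) (M.ν s a) :=
    Integrable.of_mem_Icc 0 1 measurable_id.aemeasurable hae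
  refine ⟨integral_nonneg_of_ae (hae.mono fun x hx => hx.1), ?_⟩
  have h := integral_mono_ae hint (integrable_const 1) (hae.mono fun x hx => hx.2)
  simpa [mean] using h

theorem sum_p_mul_le {s : S} {a : A} {f : S → ℝ} {c : ℝ} (h : ∀ x, f x ≤ c) :
    ∑ z, M.p s a z * f z ≤ c := by
  calc ∑ z, M.p s a z * f z ≤ ∑ z, M.p s a z * c :=
        Finset.sum_le_sum fun z _ => mul_le_mul_of_nonneg_left (h z) ((M.p_mem s a).1 z)
    _ = c := by rw [← Finset.sum_mul, (M.p_mem s a).2, one_mul]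

theorem le_sum_p_mul {s : S} {a : A} {f : S → ℝ} {c : ℝ} (h : ∀ x, c ≤ f x) :
    c ≤ ∑ z, M.p s a z * f z := by
  have := M.sum_p_mul_le (s := s) (a := a) (f := fun x => -f x) (c := -c)
    (fun x => neg_le_neg (h x))
  simp only [mul_neg, Finset.sum_neg_distrib] at this
  linarith

theorem policyMatrix_mulVec (π : S → A) (v : S → ℝ) (s : S) :
    (M.policyMatrix π).mulVec v s = ∑ z, M.p s (π s) z * v z := rfl

variable [DecidableEq S]

theorem policyMatrix_pow_mulVec_mono (π : S → A) {v w : S → ℝ} (h : ∀ s, v s ≤ w s) (n : ℕ) :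
    ∀ s, (M.policyMatrix π ^ n).mulVec v s ≤ (M.policyMatrix π ^ n).mulVec w s := by
  induction n with
  | zero => simpa using h
  | succ n ih =>
    intro s
    rw [pow_succ', ← Matrix.mulVec_mulVec, ← Matrix.mulVec_mulVec, policyMatrix_mulVec,
      policyMatrix_mulVec]
    exact Finset.sum_le_sum fun z _ => mul_le_mul_of_nonneg_left (ih z) ((M.p_mem _ _).1 z)

theorem policyMatrix_pow_mulVec_const (π : S → A) (c : ℝ) (n : ℕ) :
    ∀ s, (M.policyMatrix π ^ n).mulVec (fun _ => c) s = c := by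
  induction n with
  | zero => simp
  | succ n ih =>
    intro s
    rw [pow_succ', ← Matrix.mulVec_mulVec, policyMatrix_mulVec]
    simp_rw [ih]
    rw [← Finset.sum_mul, (M.p_mem _ _).2, one_mul]

/-- A solution `u` of the optimality inequality with constant `c` bounds the gains of all
policies. -/
theorem optGain_le [Nonempty A] [Fintype A] {u : S → ℝ} {c : ℝ}
    (h : ∀ (π : S → A) (s : S), M.mean s (π s) + ∑ z, M.p s (π s) z * u z ≤ u s + c) (s : S) :
    M.optGain s ≤ c := by
  refine ciSup_le fun π => ?_
  have hS : Nonempty S := ⟨s⟩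
  obtain ⟨m, hm⟩ := Finite.exists_min u
  set r : S → ℝ := fun x => M.mean x (π x) with hr
  have hsum : ∀ n : ℕ, ∑ t ∈ Finset.range n, (M.policyMatrix π ^ t).mulVec r s
      ≤ n * c + u s - (M.policyMatrix π ^ n).mulVec u s := by
    intro n
    induction n with
    | zero => simp
    | succ n ih =>
      rw [Finset.sum_range_succ]
      have h1 := M.policyMatrix_pow_mulVec_mono π
        (v := fun x => r x + (M.policyMatrix π).mulVec u x) (w := fun x => u x + c)
        (fun x => h π x) n s
      have h2 : (M.policyMatrix π ^ n).mulVec (fun x => r x + (M.policyMatrix π).mulVec u x) s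
          = (M.policyMatrix π ^ n).mulVec r s + (M.policyMatrix π ^ (n + 1)).mulVec u s := by
        rw [show (fun x => r x + (M.policyMatrix π).mulVec u x)
          = r + (M.policyMatrix π).mulVec u from rfl, Matrix.mulVec_add, Matrix.mulVec_mulVec,
          ← pow_succ]
        rfl
      have h3 : (M.policyMatrix π ^ n).mulVec (fun x => u x + c) s
          = (M.policyMatrix π ^ n).mulVec u s + c := by
        rw [show (fun x => u x + c) = u + (fun _ => c) from rfl, Matrix.mulVec_add, Pi.add_apply,
          policyMatrix_pow_mulVec_const]
      rw [h2, h3] at h1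
      push_cast
      linarith
  have hmin : ∀ n : ℕ, u m ≤ (M.policyMatrix π ^ n).mulVec u s := fun n => by
    have := M.policyMatrix_pow_mulVec_mono π (v := fun _ => u m) (w := u) hm n s
    rwa [policyMatrix_pow_mulVec_const] at this
  have hnn : ∀ n : ℕ, 0 ≤ (∑ t ∈ Finset.range n, (M.policyMatrix π ^ t).mulVec r s) / n :=
    fun n => by
      refine div_nonneg (Finset.sum_nonneg fun t _ => ?_) (Nat.cast_nonneg n)
      have := M.policyMatrix_pow_mulVec_mono π (v := fun _ => 0) (w := r)
        (fun x => (M.mean_mem x (π x)).1) t s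
      rwa [policyMatrix_pow_mulVec_const] at this
  refine le_of_forall_pos_le_add fun ε hε => ?_
  refine limsup_le_of_le ?_ ?_
  · exact IsCoboundedUnder.of_frequently_ge (a := 0) (Frequently.of_forall hnn)
  · have hlim : Tendsto (fun n : ℕ => (u s - u m) / (n : ℝ)) atTop (nhds 0) :=
      tendsto_const_div_atTop_nhds_zero_nat _
    filter_upwards [hlim.eventually (gt_mem_nhds hε), eventually_gt_atTop 0] with n hn hn0
    have hn0' : (0 : ℝ) < n := by exact_mod_cast hn0
    rw [div_lt_iff₀ hn0'] at hn
    rw [div_le_iff₀ hn0']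
    have := hsum n
    have := hmin n
    nlinarith

theorem optGain_le_one [Nonempty A] [Fintype A] (s : S) : M.optGain s ≤ 1 :=
  M.optGain_le (u := 0) (fun π x => by simpa using (M.mean_mem x (π x)).2) s

theorem notHit_nonneg (π : S → A) (y : S) (n : ℕ) : ∀ x, 0 ≤ M.notHit π y n x := by
  induction n with
  | zero => intro x; unfold notHit; split_ifs <;> simp
  | succ n ih =>
    intro x; unfold notHit; split_ifs
    · exact le_rfl
    · exact M.le_sum_p_mul ih

theorem notHit_le_one (π : S → A) (y : S) (n : ℕ) : ∀ x, M.notHit π y n x ≤ 1 := by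
  induction n with
  | zero => intro x; unfold notHit; split_ifs <;> simp
  | succ n ih =>
    intro x; unfold notHit; split_ifs
    · exact zero_le_one
    · exact M.sum_p_mul_le ih

theorem notHit_self (π : S → A) (y : S) (n : ℕ) : M.notHit π y n y = 0 := by
  cases n <;> simp [notHit]

theorem notHit_zero_of_ne (π : S → A) {x y : S} (h : x ≠ y) : M.notHit π y 0 x = 1 := by
  simp [notHit, h]

theorem notHit_succ_of_ne (π : S → A) {x y : S} (h : x ≠ y) (n : ℕ) :
    M.notHit π y (n + 1) x = ∑ z, M.p x (π x) z * M.notHit π y n z := by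
  simp [notHit, h]

/-- If one step of `π` loses at most `c` in the expectation of `u`, then `u` drops by at most `c`
times the expected hitting time. -/
theorem sub_le_mul_expHit (π : S → A) {y : S} {u : S → ℝ} {c : ℝ}
    (h : ∀ s, ∑ z, M.p s (π s) z * u z - c ≤ u s) (x : S) (hfin : M.expHit π x y ≠ ∞) :
    u y - u x ≤ c * (M.expHit π x y).toReal := by
  have hS : Nonempty S := ⟨x⟩
  obtain ⟨m, hm⟩ := Finite.exists_min u
  set F := u y - u m with hF
  have hF0 : 0 ≤ F := sub_nonneg.2 (hm y)
  have key : ∀ n : ℕ, ∀ s, u y - u s ≤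
      c * ∑ j ∈ Finset.range n, M.notHit π y j s + F * M.notHit π y n s := by
    intro n
    induction n with
    | zero =>
      intro s
      by_cases hs : s = y
      · subst hs; simp [notHit]
      · simp only [Finset.range_zero, Finset.sum_empty, mul_zero, M.notHit_zero_of_ne π hs]
        linarith [hm s]
    | succ n ih =>
      intro s
      by_cases hs : s = y
      · subst hs
        simp [notHit_self]
      · have h1 : u y - u s ≤ c + ∑ z, M.p s (π s) z * (u y - u z) := by
          have : ∑ z, M.p s (π s) z * (u y - u z) = u y - ∑ z, M.p s (π s) z * u z := by
            simp_rw [mul_sub]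
            rw [Finset.sum_sub_distrib, ← Finset.sum_mul, (M.p_mem _ _).2, one_mul]
          rw [this]; linarith [h s]
        have h2 : ∑ z, M.p s (π s) z * (u y - u z) ≤ ∑ z, M.p s (π s) z *
            (c * ∑ j ∈ Finset.range n, M.notHit π y j z + F * M.notHit π y n z) :=
          Finset.sum_le_sum fun z _ => mul_le_mul_of_nonneg_left (ih z) ((M.p_mem _ _).1 z)
        have h3 : ∑ z, M.p s (π s) z *
            (c * ∑ j ∈ Finset.range n, M.notHit π y j z + F * M.notHit π y n z)
            = c * ∑ j ∈ Finset.range n, M.notHit π y (j + 1) s + F * M.notHit π y (n + 1) s := by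
          simp_rw [M.notHit_succ_of_ne π hs, mul_add, Finset.sum_add_distrib]
          congr 1
          · rw [Finset.sum_comm, Finset.mul_sum]
            refine Finset.sum_congr rfl fun z _ => ?_
            rw [← Finset.mul_sum]; ring
          · rw [Finset.mul_sum]
            exact Finset.sum_congr rfl fun z _ => by ring
        rw [Finset.sum_range_succ', M.notHit_zero_of_ne π hs]
        linarith
  have hsummable : Summable fun n => M.notHit π y n x := by
    have := ENNReal.summable_toReal hfin
    simpa [ENNReal.toReal_ofReal (M.notHit_nonneg π y _ x)] using this
  have htsum : (M.expHit π x y).toReal = ∑' n, M.notHit π y n x := by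
    rw [expHit, ENNReal.tsum_toReal_eq fun _ => ENNReal.ofReal_ne_top]
    simp_rw [ENNReal.toReal_ofReal (M.notHit_nonneg π y _ x)]
  have hlim : Tendsto (fun n : ℕ => c * ∑ j ∈ Finset.range n, M.notHit π y j x
      + F * M.notHit π y n x) atTop (nhds (c * (∑' n, M.notHit π y n x) + F * 0)) :=
    (hsummable.hasSum.tendsto_sum_nat.const_mul c).add
      (hsummable.tendsto_atTop_zero.const_mul F)
  rw [mul_zero, add_zero] at hlim
  rw [htsum]
  exact ge_of_tendsto' hlim fun n => key n x

theorem one_le_expHit (π : S → A) {x y : S} (h : x ≠ y) : 1 ≤ M.expHit π x y := by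
  refine le_trans (le_of_eq ?_) (ENNReal.le_tsum 0)
  rw [M.notHit_zero_of_ne π h, ENNReal.ofReal_one]

theorem expHit_self (π : S → A) (y : S) : M.expHit π y y = 0 := by
  simp [expHit, notHit_self]

/-- Under a policy that can always decrease a rank vanishing only at the target, the target is
reached in finite expected time. -/
theorem expHit_ne_top_of_rank (π : S → A) (y : S) (d : S → ℕ)
    (hd : ∀ x, x ≠ y → ∃ z, 0 < M.p x (π x) z ∧ d z < d x) (x : S) : M.expHit π x y ≠ ∞ := by
  have hS : Nonempty S := ⟨x⟩
  have hlt : ∀ k, ∀ x, d x ≤ k → ∀ n, k < n → M.notHit π y n x < 1 := by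
    intro k
    induction k with
    | zero =>
      intro x hx n _
      by_cases h : x = y
      · subst h; rw [notHit_self]; exact zero_lt_one
      · obtain ⟨z, _, hz⟩ := hd x h; omega
    | succ k ih =>
      intro x hx n hn
      by_cases h : x = y
      · subst h; rw [notHit_self]; exact zero_lt_one
      · obtain ⟨z, hz0, hz⟩ := hd x h
        obtain ⟨n, rfl⟩ : ∃ m, n = m + 1 := ⟨n - 1, by omega⟩
        rw [M.notHit_succ_of_ne π h]
        calc ∑ z, M.p x (π x) z * M.notHit π y n z < ∑ z, M.p x (π x) z * 1 := by
              refine Finset.sum_lt_sum (fun w _ => mul_le_mul_of_nonneg_left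
                (M.notHit_le_one π y n w) ((M.p_mem _ _).1 w)) ⟨z, Finset.mem_univ z, ?_⟩
              exact mul_lt_mul_of_pos_left (ih z (by omega) n (by omega)) hz0
          _ = 1 := by simp [(M.p_mem _ _).2]
  obtain ⟨w, hw⟩ := Finite.exists_max d
  set m := d w + 1 with hm
  obtain ⟨v, hv⟩ := Finite.exists_max (M.notHit π y m)
  set ρ := M.notHit π y m v with hρ
  have hρ1 : ρ < 1 := hlt (d w) v (hw v) m (by omega)
  have hρ0 : 0 ≤ ρ := M.notHit_nonneg π y m v
  have hgeo : ∀ n, ∀ s, M.notHit π y (n + m) s ≤ ρ * M.notHit π y n s := by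
    intro n
    induction n with
    | zero =>
      intro s
      by_cases hs : s = y
      · subst hs; simp [notHit_self]
      · rw [M.notHit_zero_of_ne π hs, mul_one, zero_add]; exact hv s
    | succ n ih =>
      intro s
      by_cases hs : s = y
      · subst hs; simp [notHit_self]
      · rw [show n + 1 + m = n + m + 1 by ring, M.notHit_succ_of_ne π hs,
          M.notHit_succ_of_ne π hs, Finset.mul_sum]
        refine Finset.sum_le_sum fun z _ => ?_
        have := mul_le_mul_of_nonneg_left (ih z) ((M.p_mem s (π s)).1 z)
        linarith
  have hsum : ∀ N, ∑ n ∈ Finset.range N, M.notHit π y n x ≤ m / (1 - ρ) := by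
    intro N
    have h1 : ∑ n ∈ Finset.range N, M.notHit π y n x
        ≤ ∑ n ∈ Finset.range (m + N), M.notHit π y n x :=
      Finset.sum_le_sum_of_subset_of_nonneg (Finset.range_mono (by omega))
        fun n _ _ => M.notHit_nonneg π y n x
    rw [Finset.sum_range_add] at h1
    have h2 : ∑ n ∈ Finset.range m, M.notHit π y n x ≤ m := by
      calc _ ≤ ∑ n ∈ Finset.range m, (1 : ℝ) :=
            Finset.sum_le_sum fun n _ => M.notHit_le_one π y n x
        _ = m := by simp
    have h3 : ∑ n ∈ Finset.range N, M.notHit π y (m + n) x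
        ≤ ρ * ∑ n ∈ Finset.range N, M.notHit π y n x := by
      rw [Finset.mul_sum]
      exact Finset.sum_le_sum fun n _ => by rw [add_comm]; exact hgeo n x
    rw [le_div_iff₀ (by linarith)]
    linarith
  refine ne_top_of_le_ne_top (ENNReal.ofReal_ne_top (r := m / (1 - ρ))) ?_
  refine ENNReal.tsum_le_of_sum_range_le fun N => ?_
  rw [← ENNReal.ofReal_sum_of_nonneg fun n _ => M.notHit_nonneg π y n x]
  exact ENNReal.ofReal_le_ofReal (hsum N)

theorem policyMatrix_pow_nonneg (π : S → A) (n : ℕ) (x y : S) :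
    0 ≤ (M.policyMatrix π ^ n) x y := by
  induction n generalizing x with
  | zero => rw [pow_zero, Matrix.one_apply]; split_ifs <;> simp
  | succ n ih =>
    rw [pow_succ', Matrix.mul_apply]
    exact Finset.sum_nonneg fun z _ => mul_nonneg ((M.p_mem _ _).1 z) (ih z)

variable {M}

theorem Communicating.minHit_ne_top (hM : M.Communicating) (x y : S) : M.minHit x y ≠ ∞ := by
  classical
  have hex : ∀ x, ∃ n : ℕ, ∃ π : S → A, 0 < (M.policyMatrix π ^ n) x y := fun x => by
    obtain ⟨π, n, h⟩ := hM x y; exact ⟨n, π, h⟩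
  have hstep : ∀ x, ∃ a : A, x ≠ y → ∃ z, 0 < M.p x a z ∧ Nat.find (hex z) < Nat.find (hex x) := by
    intro x
    obtain ⟨π, hπ⟩ := Nat.find_spec (hex x)
    refine ⟨π x, fun hxy => ?_⟩
    rcases h0 : Nat.find (hex x) with _ | n
    · rw [h0, pow_zero, Matrix.one_apply_ne hxy] at hπ
      exact absurd hπ (lt_irrefl _)
    · rw [h0, pow_succ', Matrix.mul_apply] at hπ
      obtain ⟨z, _, hz⟩ := Finset.exists_lt_of_sum_lt (f := fun _ => (0:ℝ)) (by simpa using hπ)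
      have hz1 : 0 ≤ (M.policyMatrix π ^ n) z y := M.policyMatrix_pow_nonneg π n z y
      have hp1 : 0 ≤ M.p x (π x) z := (M.p_mem _ _).1 z
      refine ⟨z, ?_, ?_⟩
      · exact pos_of_mul_pos_left hz hz1
      · exact Nat.lt_succ_of_le (Nat.find_min' (hex z) ⟨π, pos_of_mul_pos_right hz hp1⟩)
  choose π hπ using hstep
  exact ne_top_of_le_ne_top (M.expHit_ne_top_of_rank π y _ hπ x) (iInf_le _ π)

theorem exists_minHit_eq [Finite A] [Nonempty A] (x y : S) :
    ∃ π : S → A, M.expHit π x y = M.minHit x y := exists_eq_ciInf_of_finite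

theorem minHit_self [Nonempty A] (y : S) : M.minHit y y = 0 := by
  have π : S → A := Classical.arbitrary _
  exact le_antisymm ((iInf_le _ π).trans (M.expHit_self π y).le) zero_le

theorem one_le_minHit {x y : S} (h : x ≠ y) : 1 ≤ M.minHit x y :=
  le_iInf fun π => M.one_le_expHit π h

theorem Communicating.iSup_minHit_ne_top (hM : M.Communicating) :
    (⨆ (x : S) (y : S) (_ : x ≠ y), M.minHit x y) ≠ ∞ := by
  refine ne_top_of_le_ne_top (b := ∑ x, ∑ y, M.minHit x y)
    (ENNReal.sum_ne_top.2 fun x _ => ENNReal.sum_ne_top.2 fun y _ => hM.minHit_ne_top x y) ?_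
  refine iSup_le fun x => iSup_le fun y => iSup_le fun _ => ?_
  exact (Finset.single_le_sum (f := fun y => M.minHit x y) (fun _ _ => zero_le)
    (Finset.mem_univ y)).trans (Finset.single_le_sum (f := fun x => ∑ y, M.minHit x y)
      (fun _ _ => zero_le) (Finset.mem_univ x))

theorem Communicating.minHit_le_diam [Nonempty A] (hM : M.Communicating) (x y : S) :
    (M.minHit x y).toReal ≤ M.diam := by
  by_cases h : x = y
  · subst h; rw [minHit_self]; exact ENNReal.toReal_nonneg
  · refine ENNReal.toReal_mono hM.iSup_minHit_ne_top ?_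
    exact le_iSup_of_le x (le_iSup_of_le y (le_iSup_of_le h le_rfl))

theorem Communicating.one_le_diam [Nonempty A] [Nontrivial S] (hM : M.Communicating) :
    1 ≤ M.diam := by
  obtain ⟨x, y, h⟩ := exists_pair_ne S
  refine le_trans ?_ (hM.minHit_le_diam x y)
  rw [← ENNReal.toReal_one]
  exact ENNReal.toReal_mono (hM.minHit_ne_top x y) (one_le_minHit h)

theorem Communicating.localDiam_sup_le (s : S) :
    (⨆ (x : S) (y : S) (_ : (∃ a, x ∈ M.succs s a) ∧ (∃ a, y ∈ M.succs s a) ∧ x ≠ y),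
      M.minHit x y) ≤ ⨆ (x : S) (y : S) (_ : x ≠ y), M.minHit x y :=
  iSup_le fun x => iSup_le fun y => iSup_le fun h =>
    le_iSup_of_le x (le_iSup_of_le y (le_iSup_of_le h.2.2 le_rfl))

theorem Communicating.localDiam_le_diam (hM : M.Communicating) (s : S) :
    M.localDiam s ≤ M.diam :=
  ENNReal.toReal_mono hM.iSup_minHit_ne_top (Communicating.localDiam_sup_le s)

theorem Communicating.minHit_le_localDiam [Nonempty A] (hM : M.Communicating) {s x y : S}
    (hx : ∃ a, x ∈ M.succs s a) (hy : ∃ a, y ∈ M.succs s a) :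
    (M.minHit x y).toReal ≤ M.localDiam s := by
  by_cases h : x = y
  · subst h; rw [minHit_self]; exact ENNReal.toReal_nonneg
  · refine ENNReal.toReal_mono (ne_top_of_le_ne_top hM.iSup_minHit_ne_top
      (Communicating.localDiam_sup_le s)) ?_
    exact le_iSup_of_le x (le_iSup_of_le y (le_iSup_of_le ⟨hx, hy, h⟩ le_rfl))

theorem localDiam_nonneg (s : S) : 0 ≤ M.localDiam s := ENNReal.toReal_nonneg

end

end MDP

/-! ### Near-optimism of NOSS -/

namespace UCRL3

section Noss

variable {S : Type*} [Fintype S] [DecidableEq S]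

theorem sub_le_span (f : S → ℝ) (x y : S) : f x - f y ≤ span f :=
  sub_le_sub (le_ciSup (Set.finite_range f).bddAbove x) (ciInf_le (Set.finite_range f).bddBelow y)

theorem span_le [Nonempty S] {f : S → ℝ} {c : ℝ} (h : ∀ x y, f x - f y ≤ c) : span f ≤ c := by
  obtain ⟨x, hx⟩ := exists_eq_ciSup_of_finite (f := f)
  obtain ⟨y, hy⟩ := exists_eq_ciInf_of_finite (f := f)
  rw [span, ← hx, ← hy]
  exact h x y

theorem span_nonneg [Nonempty S] (f : S → ℝ) : 0 ≤ span f := by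
  have x : S := Classical.arbitrary S
  simpa using sub_le_span f x x

theorem NossVisits.subset {C : S → Set ℝ} {f : S → ℝ} {T₀ T : Finset S} {κ : ℝ}
    (h : NossVisits C f T₀ κ T) : T₀ ⊆ T ∧ ∃ m ∈ T, ∀ x, f x ≤ f m := by
  induction h with
  | start m hm => exact ⟨Finset.subset_insert _ _, m, Finset.mem_insert_self _ _, hm⟩
  | step T _ _ y _ _ ih =>
    obtain ⟨h1, m, hm, h2⟩ := ih
    exact ⟨h1.trans (Finset.subset_insert _ _), m, Finset.mem_insert_of_mem hm, h2⟩

/-- The mass that a plausible `p` puts outside of the output of NOSS is worth at most `κ`. -/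
theorem IsNossOutput.loss_le {C : S → Set ℝ} {f : S → ℝ} {T₀ T : Finset S} {κ : ℝ}
    (h : IsNossOutput C f T₀ κ T) (hκ : 0 ≤ κ) (hC : ∀ x, C x ⊆ Set.Icc 0 1) (hf : ∀ x, 0 ≤ f x)
    {p : S → ℝ} (hp : p ∈ stdSimplex ℝ S) (hpC : ∀ x, p x ∈ C x) :
    ∑ x ∈ Finset.univ \ T, f x * p x ≤ κ := by
  by_cases hT : T = Finset.univ
  · simpa [hT] using hκ
  have h1 : fbar C f (Finset.univ \ T) ≤ κ := by
    have := h.2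
    rw [NossGuard, not_and, not_le] at this
    exact (this hT).le.trans (min_le_left _ _)
  have hp1 : ∑ x ∈ Finset.univ \ T, p x ≤ 1 := by
    rw [← hp.2]
    exact Finset.sum_le_sum_of_subset_of_nonneg (Finset.subset_univ _) fun x _ _ => hp.1 x
  refine le_trans ?_ h1
  unfold fbar
  refine le_csSup ?_ ⟨p, fun x _ => hpC x, hp1, rfl⟩
  refine ⟨∑ x ∈ Finset.univ \ T, f x, ?_⟩
  rintro v ⟨q, hq, -, rfl⟩
  refine Finset.sum_le_sum fun x hx => ?_
  have := (hC x (hq x hx)).2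
  nlinarith [hf x]

theorem bddAbove_optExp (C : S → Set ℝ) (T : Finset S) (u : S → ℝ) :
    BddAbove {v | ∃ q ∈ stdSimplex ℝ S, (∀ x, q x ∈ C x) ∧ (∀ x, x ∉ T → q x = 0) ∧
      v = ∑ x, q x * u x} := by
  refine ⟨∑ x, |u x|, ?_⟩
  rintro v ⟨q, hq, -, -, rfl⟩
  refine Finset.sum_le_sum fun x _ => ?_
  have h1 : q x ≤ 1 := by
    have := Finset.single_le_sum (f := q) (fun z _ => hq.1 z) (Finset.mem_univ x)
    rwa [hq.2] at this
  have h0 := hq.1 x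
  nlinarith [le_abs_self (u x), abs_nonneg (u x)]

/-- If the sets `C x` are stable under moving `p x` up towards a plausible distribution `q₀` on
`T`, the mass of `p` outside `T` can be redistributed on `T` without losing value there. -/
theorem exists_redistribution {C : S → Set ℝ} {T : Finset S} {p q₀ : S → ℝ}
    (hp : p ∈ stdSimplex ℝ S) (hpC : ∀ x, p x ∈ C x) (hq₀ : q₀ ∈ stdSimplex ℝ S)
    (hq₀C : ∀ x, q₀ x ∈ C x) (hq₀T : ∀ x, x ∉ T → q₀ x = 0)
    (hconv : ∀ x q, p x ≤ q → q ≤ q₀ x → q ∈ C x) :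
    ∃ q ∈ stdSimplex ℝ S, (∀ x, q x ∈ C x) ∧ (∀ x, x ∉ T → q x = 0) ∧ ∀ x ∈ T, p x ≤ q x := by
  set E := ∑ x ∈ T, max (q₀ x - p x) 0 with hE
  set R := 1 - ∑ x ∈ T, p x with hR
  have hR0 : 0 ≤ R := by
    rw [hR, ← hp.2, sub_nonneg]
    exact Finset.sum_le_sum_of_subset_of_nonneg (Finset.subset_univ _) fun x _ _ => hp.1 x
  have hRE : R ≤ E := by
    have h1 : ∑ x ∈ T, q₀ x = 1 := by
      rw [← hq₀.2]
      exact Finset.sum_subset (Finset.subset_univ _) fun x _ hx => hq₀T x hx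
    rw [hR, ← h1, ← Finset.sum_sub_distrib]
    exact Finset.sum_le_sum fun x _ => le_max_left _ _
  obtain ⟨a, ha0, ha1, haE⟩ : ∃ a, 0 ≤ a ∧ a ≤ 1 ∧ a * E = R := by
    rcases (hR0.trans hRE).eq_or_lt with h | h
    · exact ⟨0, le_rfl, zero_le_one, by rw [zero_mul]; linarith⟩
    · exact ⟨R / E, div_nonneg hR0 h.le, (div_le_one h).2 hRE, div_mul_cancel₀ _ h.ne'⟩
  refine ⟨fun x => if x ∈ T then p x + a * max (q₀ x - p x) 0 else 0, ⟨fun x => ?_, ?_⟩,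
    fun x => ?_, fun x hx => if_neg hx, fun x hx => ?_⟩
  · dsimp only
    split_ifs
    · exact add_nonneg (hp.1 x) (mul_nonneg ha0 (le_max_right _ _))
    · exact le_rfl
  · rw [Finset.sum_ite_mem, Finset.univ_inter, Finset.sum_add_distrib, ← Finset.mul_sum, haE]
    rw [hR]; ring
  · dsimp only
    split_ifs with hx
    · rcases le_total (q₀ x - p x) 0 with h | h
      · rw [max_eq_right h, mul_zero, add_zero]; exact hpC x
      · rw [max_eq_left h]
        exact hconv x _ (by nlinarith) (by nlinarith)
    · rw [← hq₀T x hx]; exact hq₀C x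
  · simp only [if_pos hx]
    have := mul_nonneg ha0 (le_max_right (q₀ x - p x) 0)
    linarith

/-- Near-optimism: the supports chosen by NOSS cost at most `κ`. The mass that a plausible `p` has
outside the support is moved inside, towards the plausible centre `q₀`. -/
theorem le_optExp_of_noss {C : S → Set ℝ} {u : S → ℝ} {T₀ T : Finset S} {κ : ℝ} [Nonempty S]
    (h : IsNossOutput C (fun x => u x - ⨅ y, u y) T₀ κ T) (hκ : 0 ≤ κ)
    (hC : ∀ x, C x ⊆ Set.Icc 0 1) {p q₀ : S → ℝ}
    (hp : p ∈ stdSimplex ℝ S) (hpC : ∀ x, p x ∈ C x) (hq₀ : q₀ ∈ stdSimplex ℝ S)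
    (hq₀C : ∀ x, q₀ x ∈ C x) (hq₀T : ∀ x, x ∉ T → q₀ x = 0)
    (hconv : ∀ x q, p x ≤ q → q ≤ q₀ x → q ∈ C x) :
    ∑ x, p x * u x - κ ≤ optExp C T u := by
  have hf : ∀ x, 0 ≤ u x - ⨅ y, u y := fun x =>
    sub_nonneg.2 (ciInf_le (Set.finite_range u).bddBelow x)
  have hloss := h.loss_le hκ hC hf hp hpC
  obtain ⟨q, hq, hqC, hqT, hpq⟩ := exists_redistribution hp hpC hq₀ hq₀C hq₀T hconv
  refine le_trans ?_ (le_csSup (bddAbove_optExp C T u) ⟨q, hq, hqC, hqT, rfl⟩)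
  set c := ⨅ y, u y
  have e : ∀ r ∈ stdSimplex ℝ S, ∑ x, r x * u x = ∑ x, r x * (u x - c) + c := fun r hr => by
    simp_rw [mul_sub]
    rw [Finset.sum_sub_distrib, ← Finset.sum_mul, hr.2]; ring
  rw [e p hp, e q hq]
  have h1 : ∑ x, p x * (u x - c) = ∑ x ∈ Finset.univ \ T, p x * (u x - c)
      + ∑ x ∈ T, p x * (u x - c) := (Finset.sum_sdiff (Finset.subset_univ T)).symm
  have h2 : ∑ x ∈ T, p x * (u x - c) ≤ ∑ x, q x * (u x - c) :=
    (Finset.sum_le_sum fun x hx => mul_le_mul_of_nonneg_right (hpq x hx) (hf x)).trans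
      (Finset.sum_le_sum_of_subset_of_nonneg (Finset.subset_univ _) fun x _ _ =>
        mul_nonneg (hq.1 x) (hf x))
  have h3 : ∑ x ∈ Finset.univ \ T, p x * (u x - c) ≤ κ := by
    simpa only [mul_comm] using hloss
  linarith

end Noss

/-! ### The confidence sets of one pair -/

section Pair

variable {S A : Type*} [Fintype S] [DecidableEq S] [DecidableEq A]
  {H : Trajectory S A} {t : ℕ} {d : ℝ} {x : S} {b : A}

theorem pHat_mem_stdSimplex (hn : (H.visits 1 t x b).Nonempty) :
    H.pHat t x b ∈ stdSimplex ℝ S := by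
  have hN : (0 : ℝ) < (H.visits 1 t x b).card := by exact_mod_cast hn.card_pos
  refine ⟨fun y => div_nonneg (Nat.cast_nonneg _) (Nat.cast_nonneg _), ?_⟩
  simp only [Trajectory.pHat]
  rw [← Finset.sum_div, Trajectory.N_eq_card hn, div_eq_one_iff_eq hN.ne', ← Nat.cast_sum]
  congr 1
  exact (Finset.card_eq_sum_card_fiberwise (f := fun i => H.st (i + 1)) (t := Finset.univ)
    (fun _ _ => Finset.mem_coe.2 (Finset.mem_univ _))).symm

theorem le_one_of_mem_stdSimplex {q : S → ℝ} (hq : q ∈ stdSimplex ℝ S) (y : S) : q y ≤ 1 := by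
  have := Finset.single_le_sum (f := q) (fun z _ => hq.1 z) (Finset.mem_univ y)
  rwa [hq.2] at this

theorem pHat_mem_transSet (hd : 0 < d) (hd1 : d ≤ 1) (hn : (H.visits 1 t x b).Nonempty) (y : S) :
    H.pHat t x b y ∈ transSet H t d x b y := by
  have hs := pHat_mem_stdSimplex hn
  refine ⟨⟨hs.1 y, le_one_of_mem_stdSimplex hs y⟩, fun _ => ?_⟩
  simp only [sub_self, abs_zero, zero_div, Left.neg_nonpos_iff]
  refine ⟨fun h2 => add_nonneg (Real.sqrt_nonneg _) ?_, Real.sqrt_nonneg _, Real.sqrt_nonneg _⟩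
  have := ell_pos h2 hd hd1
  positivity

theorem sqrt_split {q n e : ℝ} (hq : 0 ≤ q * (1 - q)) :
    √(2 * q * (1 - q) / n * e) = √(q * (1 - q)) * √(2 * (e / n)) := by
  rw [← Real.sqrt_mul hq]; congr 1; ring

/-- Between a plausible value and a larger empirical frequency all values are plausible. -/
theorem transSet_convex (hd : 0 < d) (hd1 : d ≤ 1) (hn : (H.visits 1 t x b).Nonempty) {y : S}
    {p q : ℝ} (hp : p ∈ transSet H t d x b y) (hpq : p ≤ q) (hq : q ≤ H.pHat t x b y) :
    q ∈ transSet H t d x b y := by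
  have hs := pHat_mem_stdSimplex hn
  have hr1 := le_one_of_mem_stdSimplex hs y
  have hp0 : 0 ≤ p := hp.1.1
  obtain ⟨h1, -, h3⟩ := hp.2 hn
  have hN1 : 1 ≤ H.N t x b := le_max_left _ _
  have hβ := beta_pos hN1 hd hd1
  refine ⟨⟨hp0.trans hpq, hq.trans hr1⟩, fun _ => ⟨fun h2 => ?_, ?_, ?_⟩⟩
  · have hl := ell_pos h2 hd hd1
    have h1 := (abs_le.1 (h1 h2)).2
    rw [sqrt_split (mul_nonneg hp0 (by linarith))] at h1
    rw [sqrt_split (mul_nonneg (hp0.trans hpq) (by linarith)), abs_of_nonneg (by linarith)]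
    rcases bernstein_between hp0 hpq hq hr1 (by positivity) h1 with h | h
    · exact h
    · exact absurd h (not_lt.2 (Real.sqrt_nonneg _))
  · exact (neg_nonpos.2 (Real.sqrt_nonneg _)).trans (div_nonneg (by linarith) hβ.le)
  · exact gLow_between hp0 hpq hq hr1 hβ h3

theorem pHat_eq_zero_of_mem (hd : 0 < d) (hd1 : d ≤ 1) (hn : (H.visits 1 t x b).Nonempty) {y : S}
    (h0 : (0 : ℝ) ∈ transSet H t d x b y) : H.pHat t x b y = 0 := by
  have hN1 : 1 ≤ H.N t x b := le_max_left _ _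
  have hβ := beta_pos hN1 hd hd1
  obtain ⟨-, -, h3⟩ := h0.2 hn
  have hg : gLow 0 = 0 := by norm_num [gLow, g]
  rw [hg, Real.sqrt_zero, div_le_iff₀ hβ, zero_mul, sub_zero] at h3
  exact le_antisymm h3 ((pHat_mem_stdSimplex hn).1 y)

theorem pHat_eq_zero_of_not_nonempty (hn : ¬ (H.visits 1 t x b).Nonempty) (y : S) :
    H.pHat t x b y = 0 := by
  rw [Finset.not_nonempty_iff_eq_empty] at hn
  simp [Trajectory.pHat, hn]

/-- Two values allowed by the Bernstein constraint are close, with leading term the standard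
deviation at either of them. -/
theorem bernstein_diff {p q r v : ℝ} (hp : p ∈ Set.Icc (0 : ℝ) 1) (hq : q ∈ Set.Icc (0 : ℝ) 1)
    (hv : 0 ≤ v) (h1 : |r - p| ≤ √(p * (1 - p)) * √(2 * v) + v / 3)
    (h2 : |r - q| ≤ √(q * (1 - q)) * √(2 * v) + v / 3) :
    |q - p| ≤ 2 * √2 * √(p * (1 - p)) * √v + 4 * v := by
  rw [Real.sqrt_mul (x := 2) (by norm_num)] at h1 h2
  set y := √(q * (1 - q)) with hy
  set z := √(p * (1 - p)) with hz
  set s := √(2 : ℝ) with hs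
  set w := √v with hw
  have hy2 : y ^ 2 = q * (1 - q) := Real.sq_sqrt (mul_nonneg hq.1 (by linarith [hq.2]))
  have hz2 : z ^ 2 = p * (1 - p) := Real.sq_sqrt (mul_nonneg hp.1 (by linarith [hp.2]))
  have hs2 : s ^ 2 = 2 := Real.sq_sqrt (by norm_num)
  have hw2 : w ^ 2 = v := Real.sq_sqrt hv
  have hy0 : 0 ≤ y := Real.sqrt_nonneg _
  have hz0 : 0 ≤ z := Real.sqrt_nonneg _
  have hs0 : 0 ≤ s := Real.sqrt_nonneg _
  have hw0 : 0 ≤ w := Real.sqrt_nonneg _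
  have hs1 : s ≤ 1.415 := by nlinarith
  have hqp : |q - p| ≤ s * w * (y + z) + 2 / 3 * w ^ 2 := by
    have : |q - p| ≤ |r - p| + |r - q| := by
      have := abs_sub (r - p) (r - q)
      rwa [sub_sub_sub_cancel_left] at this
    rw [hw2]; linarith
  have hyz : y ^ 2 ≤ z ^ 2 + |q - p| := by
    rw [hy2, hz2]
    have h3 : q * (1 - q) - p * (1 - p) = (q - p) * (1 - p - q) := by ring
    have h4 : (q - p) * (1 - p - q) ≤ |q - p| * 1 := by
      refine (le_abs_self _).trans ?_
      rw [abs_mul]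
      refine mul_le_mul_of_nonneg_left ?_ (abs_nonneg _)
      rw [abs_le]; constructor <;> linarith [hp.1, hp.2, hq.1, hq.2]
    linarith
  have hle : y ≤ z + 2 * w := by
    by_contra hcon
    push Not at hcon
    have h5 : (y - z - s * w) * (y + z) ≤ 2 / 3 * w ^ 2 := by nlinarith
    have h6 : (2 - s) * w < y - z - s * w := by linarith
    have h7 : 2 * w ≤ y + z := by linarith
    have h8 : 0 < y + z := by linarith
    have h9 : (2 - s) * w * (y + z) < (y - z - s * w) * (y + z) := mul_lt_mul_of_pos_right h6 h8
    have h10 : (2 - s) * w * (2 * w) ≤ (2 - s) * w * (y + z) :=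
      mul_le_mul_of_nonneg_left h7 (mul_nonneg (by linarith) hw0)
    nlinarith [sq_nonneg w]
  have h11 : s * w * (y + z) ≤ s * w * (2 * z + 2 * w) :=
    mul_le_mul_of_nonneg_left (by linarith) (by positivity)
  rw [← hw2]
  nlinarith [sq_nonneg w]

theorem varHat_le (hr : ∀ i ≥ 1, H.rew i ∈ Set.Icc (0 : ℝ) 1)
    (hn : (H.visits 1 t x b).Nonempty) : H.varHat t x b ≤ 1 / 4 := by
  have hN : (0 : ℝ) < (H.visits 1 t x b).card := by exact_mod_cast hn.card_pos
  set m := H.rHat t x b with hm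
  have hsum : ∑ i ∈ H.visits 1 t x b, H.rew i = (H.visits 1 t x b).card * m := by
    rw [hm, Trajectory.rHat, Trajectory.N_eq_card hn]; field_simp
  rw [Trajectory.varHat, Trajectory.N_eq_card hn, div_le_iff₀ hN]
  calc ∑ i ∈ H.visits 1 t x b, (H.rew i - m) ^ 2
      ≤ ∑ i ∈ H.visits 1 t x b, (H.rew i * (1 - 2 * m) + m ^ 2) := by
        refine Finset.sum_le_sum fun i hi => ?_
        have hi1 : 1 ≤ i := (Finset.mem_Ico.1 (Finset.mem_filter.1 hi).1).1
        have := hr i hi1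
        nlinarith [this.1, this.2]
    _ = (H.visits 1 t x b).card * (m * (1 - m)) := by
        rw [Finset.sum_add_distrib, ← Finset.sum_mul, hsum, Finset.sum_const, nsmul_eq_mul]; ring
    _ ≤ 1 / 4 * (H.visits 1 t x b).card := by nlinarith [sq_nonneg (m - 1 / 2)]

end Pair

end UCRL3

/-! ### What the planner guarantees -/

namespace UCRL3

section Planning

/-- Transfer of expectations between two plausible distributions. On the successors `Ks` of the
pair the leading part of the deviation is weighted with the spread `B₁` of `u` over `Ks` only. -/
theorem sum_mul_le_of_bernstein {S : Type*} [Fintype S] {p q u : S → ℝ} {Ks : Finset S}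
    {B₁ B₂ v : ℝ} (hp : p ∈ stdSimplex ℝ S) (hq : q ∈ stdSimplex ℝ S) (hv : 0 ≤ v)
    (hdiff : ∀ x, |q x - p x| ≤ 2 * √2 * √(p x * (1 - p x)) * √v + 4 * v)
    (hne : Ks.Nonempty) (hsupp : ∀ x, x ∉ Ks → p x = 0)
    (h₁ : ∀ x ∈ Ks, ∀ y ∈ Ks, u x - u y ≤ B₁) (h₂ : ∀ x y, u x - u y ≤ B₂) (h₁₂ : B₁ ≤ B₂) :
    ∑ x, q x * u x ≤ ∑ x, p x * u x +
      (√2 * B₁ * (∑ x, √(p x * (1 - p x))) * √v + 4 * Fintype.card S * B₂ * v) := by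
  obtain ⟨a, ha, hamax⟩ := Ks.exists_max_image u hne
  obtain ⟨b, hb, hbmin⟩ := Ks.exists_min_image u hne
  -- centring at the midpoint of the range over the successors halves the leading term
  set c := (u a + u b) / 2 with hc
  have hB₁ : 0 ≤ B₁ := by simpa using h₁ a ha a ha
  have hB₂ : 0 ≤ B₂ := by simpa using h₂ a a
  have hin : ∀ x ∈ Ks, |u x - c| ≤ B₁ / 2 := fun x hx => by
    have := hamax x hx
    have := hbmin x hx
    have := h₁ a ha b hb
    rw [abs_le, hc]; constructor <;> linarith
  have hall : ∀ x, |u x - c| ≤ B₂ := fun x => by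
    have := h₂ x a
    have := h₂ x b
    have := h₂ a x
    have := h₂ b x
    rw [abs_le, hc]; constructor <;> linarith
  have hterm : ∀ x, (q x - p x) * (u x - c) ≤
      √2 * B₁ * √(p x * (1 - p x)) * √v + 4 * B₂ * v := fun x => by
    have h3 : (q x - p x) * (u x - c) ≤ |q x - p x| * |u x - c| := by
      rw [← abs_mul]; exact le_abs_self _
    refine h3.trans ?_
    by_cases hx : x ∈ Ks
    · calc |q x - p x| * |u x - c|
          ≤ (2 * √2 * √(p x * (1 - p x)) * √v + 4 * v) * (B₁ / 2) :=
            mul_le_mul (hdiff x) (hin x hx) (abs_nonneg _) (by positivity)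
        _ = √2 * B₁ * √(p x * (1 - p x)) * √v + 4 * v * (B₁ / 2) := by ring
        _ ≤ _ := by nlinarith
    · have h4 := hdiff x
      rw [hsupp x hx] at h4 ⊢
      simp only [zero_mul, Real.sqrt_zero, mul_zero, zero_add] at h4 ⊢
      calc |q x - 0| * |u x - c| ≤ 4 * v * B₂ :=
            mul_le_mul h4 (hall x) (abs_nonneg _) (by positivity)
        _ = _ := by ring
  have hsum : ∑ x, q x * u x - ∑ x, p x * u x = ∑ x, (q x - p x) * (u x - c) := by
    simp_rw [mul_sub, sub_mul]
    rw [Finset.sum_sub_distrib, Finset.sum_sub_distrib, Finset.sum_sub_distrib, ← Finset.sum_mul,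
      ← Finset.sum_mul, hp.2, hq.2]
    ring
  have h5 := Finset.sum_le_sum fun x (_ : x ∈ Finset.univ) => hterm x
  rw [Finset.sum_add_distrib, Finset.sum_const, Finset.card_univ, nsmul_eq_mul, ← Finset.sum_mul,
    ← Finset.mul_sum] at h5
  linarith

variable {S A : Type*} [Fintype S] [DecidableEq S] [Fintype A] [DecidableEq A]

/-- Optimistic surplus of a pair `(s, a)` that was played `n` times: reward and transition
uncertainty together. The factor `1.38` is the bound on the ratio between the spread of the
iterates and the hitting times in late episodes. -/
def surplus (M : MDP S A) (d : ℝ) (s : S) (a : A) (n : ℕ) : ℝ :=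
  if n ≤ 1 then 1 + 1.38 * M.diam else
    max (beta n d) (√(2 * (ell n d / n)) + 14 / 3 * (ell n d / n)) +
      (√2 * (1.38 * M.localDiam s) * √(M.effSupp s a) * √(ell n d / n)
        + 4 * Fintype.card S * (1.38 * M.diam) * (ell n d / n))

/-- `u` is an approximate optimistic bias for the policy `π`: it grows at most like the hitting
times, and it solves the optimality equation for the true model up to the accuracy `ε`, the loss
of NOSS and the surplus. No random reward enters, so that `u` can be chosen as a function of
discrete data. -/
def IsOptimisticBias (M : MDP S A) (d ε loss : ℝ) (π : S → A) (N : S → A → ℕ) (u : S → ℝ) : Prop :=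
  (∀ x y, u y - u x ≤ 1.38 * (M.minHit x y).toReal) ∧
  ∀ s s₀, u s + M.optGain s₀ - ε - loss ≤
    M.mean s (π s) + ∑ z, M.p s (π s) z * u z + surplus M d s (π s) (N s (π s))

variable {M : MDP S A} {H : Trajectory S A} {t : ℕ} {d : ℝ}

theorem supp_pHat_subset (hd : 0 < d) (hd1 : d ≤ 1)
    (hp : ∀ s a y, M.p s a y ∈ transSet H t d s a y) (s : S) (a : A) :
    supp (H.pHat t s a) ⊆ M.succs s a := by
  intro y hy
  simp only [supp, MDP.succs, Finset.mem_filter, Finset.mem_univ, true_and] at hy ⊢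
  by_contra h
  have h0 : M.p s a y = 0 := le_antisymm (not_lt.1 h) ((M.p_mem s a).1 y)
  by_cases hn : (H.visits 1 t s a).Nonempty
  · rw [pHat_eq_zero_of_mem hd hd1 hn (h0 ▸ hp s a y)] at hy
    exact lt_irrefl _ hy
  · rw [pHat_eq_zero_of_not_nonempty hn] at hy
    exact lt_irrefl _ hy

theorem card_supp_pHat_le (hd : 0 < d) (hd1 : d ≤ 1)
    (hp : ∀ s a y, M.p s a y ∈ transSet H t d s a y) (s : S) (a : A) :
    (supp (H.pHat t s a)).card ≤ M.maxSuccs :=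
  (Finset.card_le_card (supp_pHat_subset hd hd1 hp s a)).trans
    ((Finset.le_sup (f := fun a => (M.succs s a).card) (Finset.mem_univ a)).trans
      (Finset.le_sup (f := fun s => Finset.univ.sup fun a => (M.succs s a).card)
        (Finset.mem_univ s)))

/-- A plausible distribution supported on the output of NOSS: the empirical one, or the point mass
at a maximizer if there is no observation. -/
theorem exists_center [Nonempty S] (hd : 0 < d) (hd1 : d ≤ 1) {s : S} {a : A} {f : S → ℝ} {κ : ℝ}
    {T : Finset S} (hp : ∀ y, M.p s a y ∈ transSet H t d s a y)
    (hT : IsNossOutput (transSet H t d s a) f (supp (H.pHat t s a)) κ T) :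
    ∃ q₀ ∈ stdSimplex ℝ S, (∀ x, q₀ x ∈ transSet H t d s a x) ∧ (∀ x, x ∉ T → q₀ x = 0) ∧
      ∀ x q, M.p s a x ≤ q → q ≤ q₀ x → q ∈ transSet H t d s a x := by
  obtain ⟨hsub, m, hm, -⟩ := hT.1.subset
  by_cases hn : (H.visits 1 t s a).Nonempty
  · refine ⟨H.pHat t s a, pHat_mem_stdSimplex hn, pHat_mem_transSet hd hd1 hn, fun x hx => ?_,
      fun x q h1 h2 => transSet_convex hd hd1 hn (hp x) h1 h2⟩
    by_contra h
    refine hx (hsub ?_)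
    simp only [supp, Finset.mem_filter, Finset.mem_univ, true_and]
    exact lt_of_le_of_ne ((pHat_mem_stdSimplex hn).1 x) (Ne.symm h)
  · have hmem : ∀ x q, 0 ≤ q → q ≤ 1 → q ∈ transSet H t d s a x := fun x q h0 h1 =>
      ⟨⟨h0, h1⟩, fun h => absurd h hn⟩
    have hs := single_mem_stdSimplex ℝ m
    refine ⟨Pi.single m 1, hs, fun x => hmem x _ (hs.1 x) (le_one_of_mem_stdSimplex hs x),
      fun x hx => ?_, fun x q h1 h2 => hmem x q (((M.p_mem s a).1 x).trans h1)
        (h2.trans (le_one_of_mem_stdSimplex hs x))⟩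
    rw [Pi.single_apply, if_neg]
    rintro rfl
    exact hx hm

theorem mean_mem_rewSet (s : S) (a : A)
    (hr : (H.visits 1 t s a).Nonempty → |H.rHat t s a - M.mean s a| ≤ beta (H.N t s a) d / 2) :
    M.mean s a ∈ rewSet H t d s a :=
  ⟨M.mean_mem s a, fun hn => (hr hn).trans (le_max_left _ _)⟩

theorem bddAbove_rewSet (s : S) (a : A) : BddAbove (rewSet H t d s a) :=
  ⟨1, fun _ hm => hm.1.2⟩

/-- Optimistic values exceed true ones by at most the surplus. -/
theorem qValue_le [Nonempty A] (hM : M.Communicating) (hd : 0 < d) (hd1 : d ≤ 1)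
    (hrew : ∀ i ≥ 1, H.rew i ∈ Set.Icc (0 : ℝ) 1) {s : S} {a : A}
    (hr : (H.visits 1 t s a).Nonempty → |H.rHat t s a - M.mean s a| ≤ beta (H.N t s a) d / 2)
    (hp : ∀ y, M.p s a y ∈ transSet H t d s a y) {T : S → A → Finset S} {u : S → ℝ}
    (hu : ∀ x y, u y - u x ≤ 1.38 * (M.minHit x y).toReal)
    (hne : ∃ q ∈ stdSimplex ℝ S, (∀ x, q x ∈ transSet H t d s a x) ∧ ∀ x, x ∉ T s a → q x = 0) :
    qValue (rewSet H t d) (transSet H t d) T u s a ≤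
      M.mean s a + ∑ z, M.p s a z * u z + surplus M d s a (H.N t s a) := by
  have hmean := M.mean_mem s a
  have hsup : (rewSet H t d s a).Nonempty := ⟨_, mean_mem_rewSet s a hr⟩
  have hu₂ : ∀ x y, u x - u y ≤ 1.38 * M.diam := fun x y =>
    (hu y x).trans (mul_le_mul_of_nonneg_left (hM.minHit_le_diam y x) (by norm_num))
  have hne' : {v | ∃ q ∈ stdSimplex ℝ S, (∀ x, q x ∈ transSet H t d s a x) ∧
      (∀ x, x ∉ T s a → q x = 0) ∧ v = ∑ x, q x * u x}.Nonempty := by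
    obtain ⟨q, h1, h2, h3⟩ := hne
    exact ⟨_, q, h1, h2, h3, rfl⟩
  unfold qValue surplus
  split_ifs with hN
  · have h1 : sSup (rewSet H t d s a) ≤ 1 := csSup_le hsup fun m hm => hm.1.2
    have h2 : optExp (transSet H t d s a) (T s a) u ≤
        ∑ z, M.p s a z * u z + 1.38 * M.diam := by
      refine csSup_le hne' ?_
      rintro v ⟨q, hq, -, -, rfl⟩
      have h3 : ∀ x, u x ≤ ∑ z, M.p s a z * u z + 1.38 * M.diam := fun x => by
        have := M.le_sum_p_mul (s := s) (a := a) (f := u) (c := u x - 1.38 * M.diam)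
          (fun z => by linarith [hu₂ x z])
        linarith
      calc ∑ x, q x * u x ≤ ∑ x, q x * (∑ z, M.p s a z * u z + 1.38 * M.diam) :=
            Finset.sum_le_sum fun x _ => mul_le_mul_of_nonneg_left (h3 x) (hq.1 x)
        _ = _ := by rw [← Finset.sum_mul, hq.2, one_mul]
    linarith [hmean.1]
  · push Not at hN
    have h2N : 2 ≤ H.N t s a := hN
    have hn : (H.visits 1 t s a).Nonempty := by
      by_contra h
      rw [Finset.not_nonempty_iff_eq_empty] at h
      rw [Trajectory.N, h, Finset.card_empty] at h2N
      omega
    have hN0 : (0 : ℝ) < H.N t s a := by exact_mod_cast (by omega : 0 < H.N t s a)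
    have hl := ell_pos h2N hd hd1
    set n := H.N t s a with hn_def
    set v := ell n d / n with hv
    have hv0 : 0 ≤ v := by positivity
    have h1 : sSup (rewSet H t d s a) ≤
        M.mean s a + max (beta n d) (√(2 * v) + 14 / 3 * v) := by
      refine csSup_le hsup fun m hm => ?_
      have h3 := hm.2 hn
      have h4 := hr hn
      have h5 : rewRadius H t d s a ≤ max (beta n d / 2) (√(2 * v) / 2 + 7 / 3 * v) := by
        rw [rewRadius]
        rw [← hn_def, if_pos h2N]
        refine max_le_max le_rfl (add_le_add ?_ (le_of_eq ?_))
        · have e : √(2 * v) / 2 = √(2 * (1 / 4) / n * ell n d) := by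
            rw [show 2 * (1 / 4) / (n : ℝ) * ell n d = (1 / 2) ^ 2 * (2 * v) by rw [hv]; ring,
              Real.sqrt_mul (by norm_num : (0 : ℝ) ≤ (1 / 2) ^ 2), Real.sqrt_sq (by norm_num)]
            ring
          rw [e]
          have := varHat_le hrew hn
          gcongr
        · rw [hv]; field_simp
      have h6 : m - M.mean s a ≤ rewRadius H t d s a + beta n d / 2 := by
        have := (abs_le.1 h3).1
        have := (abs_le.1 h4).2
        linarith
      have h7 : 2 * max (beta n d / 2) (√(2 * v) / 2 + 7 / 3 * v)
          = max (beta n d) (√(2 * v) + 14 / 3 * v) := by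
        rw [mul_max_of_nonneg _ _ zero_le_two]; congr 1 <;> ring
      have h8 := le_max_left (beta n d / 2) (√(2 * v) / 2 + 7 / 3 * v)
      linarith
    have h2 : optExp (transSet H t d s a) (T s a) u ≤ ∑ z, M.p s a z * u z +
        (√2 * (1.38 * M.localDiam s) * √(M.effSupp s a) * √v
          + 4 * Fintype.card S * (1.38 * M.diam) * v) := by
      refine csSup_le hne' ?_
      rintro w ⟨q, hq, hqC, -, rfl⟩
      have hle : √(M.effSupp s a) = ∑ x, √(M.p s a x * (1 - M.p s a x)) :=
        Real.sqrt_sq (Finset.sum_nonneg fun x _ => Real.sqrt_nonneg _)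
      rw [hle]
      have hdiff : ∀ x, |q x - M.p s a x| ≤
          2 * √2 * √(M.p s a x * (1 - M.p s a x)) * √v + 4 * v := fun x => by
        have hb : ∀ r, r ∈ transSet H t d s a x →
            |H.pHat t s a x - r| ≤ √(r * (1 - r)) * √(2 * v) + v / 3 := fun r hr' => by
          have := (hr'.2 hn).1 h2N
          rw [← hn_def, sqrt_split (mul_nonneg hr'.1.1 (by linarith [hr'.1.2]))] at this
          refine this.trans (le_of_eq ?_)
          rw [hv]; field_simp
        exact bernstein_diff (hp x).1 (hqC x).1 hv0 (hb _ (hp x)) (hb _ (hqC x))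
      refine sum_mul_le_of_bernstein (Ks := Finset.univ.filter fun x => ∃ a, x ∈ M.succs s a)
        (M.p_mem s a) hq hv0 hdiff ?_ ?_ ?_ hu₂
        (mul_le_mul_of_nonneg_left (hM.localDiam_le_diam s) (by norm_num))
      · obtain ⟨z, -, hz⟩ := Finset.exists_lt_of_sum_lt (f := fun _ => (0 : ℝ)) (g := M.p s a)
          (s := Finset.univ) (by rw [(M.p_mem s a).2]; simp)
        exact ⟨z, by simpa using ⟨a, by simpa [MDP.succs] using hz⟩⟩
      · intro x hx
        simp only [Finset.mem_filter, Finset.mem_univ, true_and, not_exists, MDP.succs,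
          not_lt] at hx
        exact le_antisymm (hx a) ((M.p_mem s a).1 x)
      · intro x hx y hy
        simp only [Finset.mem_filter, Finset.mem_univ, true_and] at hx hy
        exact (hu y x).trans (mul_le_mul_of_nonneg_left (hM.minHit_le_localDiam hy hx)
          (by norm_num))
    linarith

/-- A policy returned by EVI-NOSS at a time when the true model is plausible comes with an
optimistic bias, provided that the loss of NOSS is small compared with the diameter. The stopping
rule makes the last iterate an approximate solution of the optimality equation, and this alone
bounds its spread by hitting times. -/
theorem exists_optimisticBias [Nontrivial S] [Nonempty A] (hM : M.Communicating) (hd : 0 < d)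
    (hd1 : d ≤ 1) (hrew : ∀ i ≥ 1, H.rew i ∈ Set.Icc (0 : ℝ) 1)
    (hr : ∀ s a, (H.visits 1 t s a).Nonempty →
      |H.rHat t s a - M.mean s a| ≤ beta (H.N t s a) d / 2)
    (hp : ∀ s a y, M.p s a y ∈ transSet H t d s a y) {Nmax : ℕ} {ε : ℝ}
    (hε : ε ≤ 0.01) {π : S → A}
    (hθ : 10 * M.maxSuccs / (Nmax : ℝ) ^ (2 / 3 : ℝ) * M.diam ≤ 0.2646)
    (hplan : IsEviNossOutput (H.pHat t) (rewSet H t d) (transSet H t d) Nmax ε π) :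
    ∃ u, IsOptimisticBias M d ε (13.8 * M.diam * M.maxSuccs / (Nmax : ℝ) ^ (2 / 3 : ℝ)) π
      (H.N t) u := by
  obtain ⟨n, U, T, -, hT, hU, -, hacc, hπ⟩ := hplan
  have hT := hT n le_rfl
  have hU := hU n le_rfl
  set u := U n with hu
  set w := U (n + 1) with hw
  set θ := 10 * M.maxSuccs / (Nmax : ℝ) ^ (2 / 3 : ℝ) with hθd
  have hθ0 : 0 ≤ θ := by positivity
  have hsp := span_nonneg u
  have hD1 := hM.one_le_diam
  have hCsub : ∀ s a x, transSet H t d s a x ⊆ Set.Icc 0 1 := fun s a x q hq => hq.1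
  have hlow : ∀ s a, M.mean s a + ∑ z, M.p s a z * u z - θ * span u ≤
      qValue (rewSet H t d) (transSet H t d) (T n) u s a := fun s a => by
    have h1 : M.mean s a ≤ sSup (rewSet H t d s a) :=
      le_csSup (bddAbove_rewSet s a) (mean_mem_rewSet s a (hr s a))
    obtain ⟨q₀, hq₀, hq₀C, hq₀T, hconv⟩ := exists_center hd hd1 (hp s a) (hT s a)
    have h2 := le_optExp_of_noss (hT s a) (by positivity) (hCsub s a) (M.p_mem s a) (hp s a) hq₀
      hq₀C hq₀T hconv
    have h3 : 10 * span u * ((supp (H.pHat t s a)).card : ℝ) / (Nmax : ℝ) ^ (2 / 3 : ℝ)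
        ≤ θ * span u := by
      have : ((supp (H.pHat t s a)).card : ℝ) ≤ M.maxSuccs := by
        exact_mod_cast card_supp_pHat_le hd hd1 hp s a
      rw [hθd]
      calc _ ≤ 10 * span u * (M.maxSuccs : ℝ) / (Nmax : ℝ) ^ (2 / 3 : ℝ) := by gcongr
        _ = _ := by ring
    unfold qValue
    linarith
  have hwge : ∀ s a, qValue (rewSet H t d) (transSet H t d) (T n) u s a ≤ w s := fun s a => by
    rw [hU s]
    exact le_ciSup (Set.finite_range fun a =>
      qValue (rewSet H t d) (transSet H t d) (T n) u s a).bddAbove a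
  have hwπ : ∀ s, w s ≤ qValue (rewSet H t d) (transSet H t d) (T n) u s (π s) := fun s => by
    rw [hU s]
    exact ciSup_le fun a => hπ s a
  -- `γ` is the smallest increment of the last iteration
  obtain ⟨s₁, hs₁⟩ := Finite.exists_min (w - u)
  set γ := (w - u) s₁ with hγ
  have hinc : ∀ s, w s - u s ≤ γ + ε := fun s => by
    have := (sub_le_span (w - u) s s₁).trans hacc
    simp only [Pi.sub_apply] at this hγ
    linarith
  have hinc' : ∀ s, γ ≤ w s - u s := hs₁
  have hne : ∀ s a, ∃ q ∈ stdSimplex ℝ S, (∀ x, q x ∈ transSet H t d s a x) ∧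
      ∀ x, x ∉ T n s a → q x = 0 := fun s a => by
    obtain ⟨q₀, hq₀, hq₀C, hq₀T, -⟩ := exists_center hd hd1 (hp s a) (hT s a)
    exact ⟨q₀, hq₀, hq₀C, hq₀T⟩
  have hγ1 : γ ≤ 1 := by
    obtain ⟨m, hm⟩ := Finite.exists_max u
    have h1 : qValue (rewSet H t d) (transSet H t d) (T n) u m (π m) ≤ 1 + u m := by
      refine add_le_add (csSup_le ⟨_, mean_mem_rewSet m (π m) (hr m (π m))⟩ fun r hr => hr.1.2) ?_
      obtain ⟨q₀, h1, h2, h3⟩ := hne m (π m)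
      refine csSup_le ⟨_, q₀, h1, h2, h3, rfl⟩ ?_
      rintro v ⟨q, hq, -, -, rfl⟩
      calc ∑ x, q x * u x ≤ ∑ x, q x * u m :=
            Finset.sum_le_sum fun x _ => mul_le_mul_of_nonneg_left (hm x) (hq.1 x)
        _ = u m := by rw [← Finset.sum_mul, hq.2, one_mul]
    linarith [hinc' m, hwπ m]
  have hhit : ∀ x y, u y - u x ≤ (1 + ε + θ * span u) * (M.minHit x y).toReal := fun x y => by
    obtain ⟨ρ, hρ⟩ := M.exists_minHit_eq x y
    rw [← hρ]
    refine M.sub_le_mul_expHit ρ (fun s => ?_) x (hρ ▸ hM.minHit_ne_top x y)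
    have := hlow s (ρ s)
    have := hwge s (ρ s)
    have := hinc s
    have := (M.mean_mem s (ρ s)).1
    linarith
  have hfac0 : 0 ≤ 1 + ε + θ * span u := by
    have := span_nonneg (w - u)
    have := mul_nonneg hθ0 hsp
    linarith
  have hspan : span u ≤ (1 + ε + θ * span u) * M.diam := span_le fun x y =>
    (hhit y x).trans (mul_le_mul_of_nonneg_left (hM.minHit_le_diam y x) hfac0)
  have hspan1 : span u ≤ 1.38 * M.diam := by nlinarith
  have hfac : 1 + ε + θ * span u ≤ 1.38 := by
    have h2 : span u ≤ 1.3735 * M.diam := by nlinarith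
    have : θ * span u ≤ θ * (1.3735 * M.diam) := mul_le_mul_of_nonneg_left h2 hθ0
    linarith
  have hmain : ∀ x y, u y - u x ≤ 1.38 * (M.minHit x y).toReal := fun x y =>
    (hhit x y).trans (mul_le_mul_of_nonneg_right hfac ENNReal.toReal_nonneg)
  refine ⟨u, hmain, fun s s₀ => ?_⟩
  have hgain : M.optGain s₀ ≤ γ + ε + θ * span u := M.optGain_le (u := u) (fun ρ x => by
    have := hlow x (ρ x)
    have := hwge x (ρ x)
    have := hinc x
    linarith) s₀
  have hloss : θ * span u ≤ 13.8 * M.diam * M.maxSuccs / (Nmax : ℝ) ^ (2 / 3 : ℝ) := by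
    calc θ * span u ≤ θ * (1.38 * M.diam) := mul_le_mul_of_nonneg_left hspan1 hθ0
      _ = _ := by rw [hθd]; ring
  have hq := qValue_le hM hd hd1 hrew (hr s (π s)) (hp s (π s)) hmain (hne s (π s))
  linarith [hwπ s, hinc' s]

end Planning

end UCRL3

/-! ### Sums over episodes -/

/-- The potential method. A counter `c` is read at the starts `e t` of the episodes, and grows
within an episode from `n` to at most `B n`. If the potential `G` pays for this growth at the price
`w n` per unit, then all increments together are paid by the final potential. -/
theorem sum_episodes_le {e c : ℕ → ℕ} (he1 : e 1 = 1)
    (he : ∀ t ≥ 1, e t ≤ t ∧ (e (t + 1) = e t ∨ e (t + 1) = t + 1)) (I : ℕ → Prop)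
    [DecidablePred I] (hc1 : c 1 = 0) (hc : ∀ t ≥ 1, c (t + 1) = c t + if I t then 1 else 0)
    {B : ℕ → ℕ} {T : ℕ} (hT : 1 ≤ T) (hB : ∀ t ≥ 1, t ≤ T → c (t + 1) ≤ B (c (e t)))
    {w G : ℕ → ℝ} (hG0 : 0 ≤ G 0)
    (hw : ∀ n n', n ≤ n' → n' ≤ B n → G n + ((n' : ℝ) - n) * w n ≤ G n') :
    ∑ t ∈ Finset.Icc 1 T, (if I t then w (c (e t)) else 0) ≤ G (c (T + 1)) := by
  have hmono : ∀ i ≥ 1, ∀ j, i ≤ j → c i ≤ c j := fun i hi j hij => by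
    induction j, hij using Nat.le_induction with
    | base => exact le_rfl
    | succ j hj ih => rw [hc j (by omega)]; omega
  have he1' : ∀ t ≥ 1, 1 ≤ e t := fun t ht => by
    induction t, ht using Nat.le_induction with
    | base => rw [he1]
    | succ t ht ih => rcases (he t ht).2 with h | h <;> omega
  have key : ∀ t ≥ 1, t ≤ T → ∑ i ∈ Finset.Icc 1 t, (if I i then w (c (e i)) else 0) ≤
      G (c (e t)) + ((c (t + 1) : ℝ) - c (e t)) * w (c (e t)) := fun t ht => by
    induction t, ht using Nat.le_induction with
    | base =>
      intro _
      rw [Finset.Icc_self, Finset.sum_singleton, he1, hc 1 le_rfl, hc1]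
      split_ifs <;> simpa using hG0
    | succ t ht ih =>
      intro htT
      rw [Finset.sum_Icc_succ_top (by omega), hc (t + 1) (by omega)]
      have ih := ih (by omega)
      rcases (he t ht).2 with h | h
      · rw [h]
        split_ifs <;> push_cast <;> linarith
      · rw [h]
        have := hw _ _ (hmono (e t) (he1' t ht) (t + 1) (by have := (he t ht).1; omega))
          (hB t ht (by omega))
        split_ifs <;> push_cast <;> linarith
  exact (key T hT le_rfl).trans (hw _ _ (hmono _ (he1' T hT) _ (by have := (he T hT).1; omega))
    (hB T hT le_rfl))

/-- A potential that increases by at least one whenever its argument doubles. -/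
def logPotential (n : ℕ) : ℝ := (min 1 n : ℕ) + 2 * Real.log n

theorem logPotential_nonneg (n : ℕ) : 0 ≤ logPotential n := by
  have := Real.log_natCast_nonneg n
  unfold logPotential
  positivity

theorem logPotential_mono : Monotone logPotential := fun n n' h => by
  unfold logPotential
  rcases Nat.eq_zero_or_pos n with rfl | hn
  · simpa [logPotential] using logPotential_nonneg n'
  · rw [min_eq_left hn, min_eq_left (hn.trans_le h)]
    gcongr

theorem logPotential_le {n T : ℕ} (h : n ≤ T) (hT : 1 ≤ T) :
    logPotential n ≤ 1 + 2 * Real.log T := by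
  refine (logPotential_mono h).trans ?_
  rw [logPotential, min_eq_left hT]
  simp

theorem logPotential_double {n n' : ℕ} (h : n + max 1 n ≤ n') :
    logPotential n + 1 ≤ logPotential n' := by
  refine le_trans ?_ (logPotential_mono h)
  rcases Nat.eq_zero_or_pos n with rfl | hn
  · simp [logPotential]
  · rw [logPotential, logPotential, max_eq_right hn, min_eq_left hn, min_eq_left (by omega)]
    have hn' : (0 : ℝ) < n := by exact_mod_cast hn
    have : ((n + n : ℕ) : ℝ) = 2 * n := by push_cast; ring
    rw [this, Real.log_mul two_ne_zero hn'.ne']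
    linarith [Real.log_two_gt_d9]

theorem logPotential_add_le {n n' : ℕ} (h : n ≤ n') (h' : n' ≤ n + max 1 n) :
    logPotential n + ((n' : ℝ) - n) * (1 / (max 1 n : ℕ)) ≤ logPotential n' := by
  rcases Nat.eq_zero_or_pos n with rfl | hn
  · have : n' = 0 ∨ n' = 1 := by simp at h'; omega
    rcases this with rfl | rfl <;> simp [logPotential]
  · rw [logPotential, logPotential, max_eq_right hn, min_eq_left hn, min_eq_left (by omega)]
    rw [max_eq_right hn] at h'
    have hn0 : (0 : ℝ) < n := by exact_mod_cast hn
    have h1 : (n : ℝ) ≤ n' := by exact_mod_cast h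
    have h2 : (n' : ℝ) ≤ 2 * n := by
      have : (n' : ℝ) ≤ n + n := by exact_mod_cast h'
      linarith
    have hn'0 : (0 : ℝ) < n' := by linarith
    have h3 := Real.one_sub_inv_le_log_of_pos (x := (n' : ℝ) / n) (by positivity)
    rw [Real.log_div hn'0.ne' hn0.ne', inv_div] at h3
    have h4 : ((n' : ℝ) - n) * (1 / n) ≤ 2 * (1 - n / n') := by
      rw [mul_one_div, div_le_iff₀ hn0]
      have : 2 * (1 - (n : ℝ) / n') * n = (n' - n) * (2 * n / n') := by field_simp
      rw [this]
      refine le_mul_of_one_le_right (by linarith) ?_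
      rw [le_div_iff₀ hn'0]; linarith
    linarith

/-- The potential for square roots; `1 + √2` is the best constant for a counter that at most
doubles. -/
theorem sqrtPotential_add_le {n n' : ℕ} (h : n ≤ n') (h' : n' ≤ n + max 1 n) :
    (1 + √2) * √(n : ℝ) + ((n' : ℝ) - n) * (1 / √((max 1 n : ℕ) : ℝ)) ≤ (1 + √2) * √(n' : ℝ) := by
  rcases Nat.eq_zero_or_pos n with rfl | hn
  · have : n' = 0 ∨ n' = 1 := by simp at h'; omega
    rcases this with rfl | rfl <;> simp
  · rw [max_eq_right hn]
    rw [max_eq_right hn] at h'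
    have hn0 : (0 : ℝ) < n := by exact_mod_cast hn
    have h1 : (n : ℝ) ≤ n' := by exact_mod_cast h
    have h2 : (n' : ℝ) ≤ 2 * n := by
      have : (n' : ℝ) ≤ n + n := by exact_mod_cast h'
      linarith
    have hs := Real.sqrt_pos.2 hn0
    have hs1 := Real.sqrt_le_sqrt h1
    have hs2 := Real.sqrt_le_sqrt h2
    rw [Real.sqrt_mul zero_le_two] at hs2
    have e : ((n' : ℝ) - n) = (√(n' : ℝ) - √n) * (√n' + √n) := by
      nlinarith [Real.sq_sqrt hn0.le, Real.sq_sqrt (hn0.le.trans h1)]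
    have : ((n' : ℝ) - n) * (1 / √n) ≤ (√(n' : ℝ) - √n) * (1 + √2) := by
      rw [mul_one_div, div_le_iff₀ hs, e, mul_assoc]
      exact mul_le_mul_of_nonneg_left (by linarith) (by linarith)
    linarith

/-- Episodes starting after `n` steps are late if `n` is large compared with
`a = D K (S A)^{2/3}`. -/
def IsLate (a : ℝ) (n : ℕ) : Prop := 10 ^ 4 ≤ n ∧ 60 * a < (2 * n : ℝ) ^ (2 / 3 : ℝ)

theorem cube_rpow_third {x : ℝ} (hx : 0 ≤ x) : (x ^ (1 / 3 : ℝ)) ^ 3 = x := by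
  rw [← Real.rpow_natCast, ← Real.rpow_mul hx]; norm_num

theorem rpow_two_thirds {x : ℝ} (hx : 0 ≤ x) : x ^ (2 / 3 : ℝ) = (x ^ (1 / 3 : ℝ)) ^ 2 := by
  rw [← Real.rpow_natCast, ← Real.rpow_mul hx]; norm_num

/-- The constant is `2^{2/3} / 60`, rounded up. -/
theorem IsLate.le {a : ℝ} {n : ℕ} (h : IsLate a n) : a / (n : ℝ) ^ (2 / 3 : ℝ) ≤ 0.02646 := by
  have hn : (0 : ℝ) < n := by
    have := h.1
    exact_mod_cast (by omega : 0 < n)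
  have h2 := h.2
  rw [Real.mul_rpow zero_le_two hn.le] at h2
  have hp := Real.rpow_pos_of_pos hn (2 / 3)
  have h3 : (2 : ℝ) ^ (2 / 3 : ℝ) ≤ 1.5876 := by
    have h4 : (0 : ℝ) ≤ (2 : ℝ) ^ (2 / 3 : ℝ) := by positivity
    have : ((2 : ℝ) ^ (2 / 3 : ℝ)) ^ 3 = 4 := by
      rw [← Real.rpow_natCast, ← Real.rpow_mul zero_le_two]; norm_num
    by_contra hc
    push Not at hc
    have : (1.5876 : ℝ) ^ 3 < ((2 : ℝ) ^ (2 / 3 : ℝ)) ^ 3 := by gcongr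
    norm_num at this
    linarith
  rw [div_le_iff₀ hp]
  nlinarith

/-- Late episodes start after `100 m` steps at least; for `m = S A` the additive term in the growth
of the global counter is then negligible. -/
theorem IsLate.card_le {a : ℝ} {n m : ℕ} (h : IsLate a n) (ha : (m : ℝ) ^ (2 / 3 : ℝ) ≤ a) :
    100 * m ≤ n := by
  have hm : (0 : ℝ) ≤ m := Nat.cast_nonneg m
  have h1 : (200 * m : ℝ) ^ (2 / 3 : ℝ) < (2 * n : ℝ) ^ (2 / 3 : ℝ) := by
    refine lt_of_le_of_lt ?_ h.2
    rw [Real.mul_rpow (by norm_num) hm]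
    refine mul_le_mul ?_ ha (by positivity) (by norm_num)
    rw [rpow_two_thirds (by norm_num)]
    have h4 : (0 : ℝ) ≤ (200 : ℝ) ^ (1 / 3 : ℝ) := by positivity
    have := cube_rpow_third (x := 200) (by norm_num)
    nlinarith
  have h2 := lt_of_not_ge fun hc => absurd h1 (not_lt.2
    (Real.rpow_le_rpow (by positivity) hc (by norm_num : (0 : ℝ) ≤ 2 / 3)))
  have : (100 * m : ℝ) < n := by linarith
  exact_mod_cast this.le

/-- The potential for the loss caused by restricted supports, and for all early episodes. -/
theorem cubeRootPotential_add_le {a : ℝ} {m n n' : ℕ} (ha : (m : ℝ) ^ (2 / 3 : ℝ) ≤ a)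
    (h : n ≤ n') (h' : n' ≤ 2 * n + m) [Decidable (IsLate a n)] :
    min (n : ℝ) (m + 2 * 10 ^ 4 + 60 * a * (n : ℝ) ^ (1 / 3 : ℝ)) + ((n' : ℝ) - n) *
        (if IsLate a n then 13.8 * a / (n : ℝ) ^ (2 / 3 : ℝ) else 1) ≤
      min (n' : ℝ) (m + 2 * 10 ^ 4 + 60 * a * (n' : ℝ) ^ (1 / 3 : ℝ)) := by
  have hm0 : (0 : ℝ) ≤ m := Nat.cast_nonneg m
  have ha0 : 0 ≤ a := le_trans (by positivity) ha
  have hn0 : (0 : ℝ) ≤ n := Nat.cast_nonneg n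
  have h1 : (n : ℝ) ≤ n' := by exact_mod_cast h
  have h2 : (n' : ℝ) ≤ 2 * n + m := by exact_mod_cast h'
  have hn'0 : (0 : ℝ) ≤ n' := hn0.trans h1
  split_ifs with hl
  · have hl1 := hl.le
    have hl2 : (100 * m : ℝ) ≤ n := by exact_mod_cast hl.card_le ha
    have hn : (0 : ℝ) < n := by
      have := hl.1
      exact_mod_cast (by omega : 0 < n)
    set x := (n : ℝ) ^ (1 / 3 : ℝ) with hx
    set y := (n' : ℝ) ^ (1 / 3 : ℝ) with hy
    have hx0 : 0 < x := by positivity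
    have hxy : x ≤ y := Real.rpow_le_rpow hn0 h1 (by norm_num)
    have hx3 : x ^ 3 = n := cube_rpow_third hn0
    have hy3 : y ^ 3 = n' := cube_rpow_third hn'0
    rw [rpow_two_thirds hn0, ← hx] at hl1 ⊢
    have hyx : y ≤ 1.301 * x := by
      by_contra hc
      push Not at hc
      have : (1.301 * x) ^ 3 < y ^ 3 := by gcongr
      rw [mul_pow, hx3, hy3] at this
      norm_num at this
      linarith
    refine le_min ?_ ?_
    · have : ((n' : ℝ) - n) * (13.8 * a / x ^ 2) ≤ ((n' : ℝ) - n) * 1 := by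
        refine mul_le_mul_of_nonneg_left ?_ (by linarith)
        rw [mul_div_assoc]; linarith
      exact (add_le_add (min_le_left _ _) this).trans (by linarith)
    · have : ((n' : ℝ) - n) * (13.8 * a / x ^ 2) ≤ 60 * a * (y - x) := by
        rw [mul_div_assoc', div_le_iff₀ (by positivity), ← hx3, ← hy3]
        have h5 : y ^ 2 + x * y + x ^ 2 ≤ 4 * x ^ 2 := by nlinarith
        have h6 : 0 ≤ a * (y - x) := mul_nonneg ha0 (by linarith)
        have h7 : 13.8 * (y ^ 2 + x * y + x ^ 2) ≤ 60 * x ^ 2 := by nlinarith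
        have h8 := mul_le_mul_of_nonneg_left h7 h6
        linarith [h8, show (y ^ 3 - x ^ 3) * (13.8 * a)
          = a * (y - x) * (13.8 * (y ^ 2 + x * y + x ^ 2)) by ring]
      exact (add_le_add (min_le_right _ _) this).trans (by linarith)
  · have hle : (n' : ℝ) ≤ m + 2 * 10 ^ 4 + 60 * a * (n' : ℝ) ^ (1 / 3 : ℝ) := by
      have h0 : 0 ≤ 60 * a * (n' : ℝ) ^ (1 / 3 : ℝ) := by positivity
      unfold IsLate at hl
      rcases lt_or_ge n (10 ^ 4) with hlt | hge
      · have : (n : ℝ) < 10 ^ 4 := by exact_mod_cast hlt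
        linarith
      · have hl2 : (2 * n : ℝ) ^ (2 / 3 : ℝ) ≤ 60 * a := by
          by_contra hc
          exact hl ⟨hge, not_le.1 hc⟩
        set k := min (n' : ℝ) (2 * n) with hk
        have hk0 : 0 ≤ k := le_min hn'0 (by positivity)
        have hk1 : k ^ (2 / 3 : ℝ) ≤ 60 * a :=
          (Real.rpow_le_rpow hk0 (min_le_right _ _) (by norm_num)).trans hl2
        have hk2 : k ^ (1 / 3 : ℝ) ≤ (n' : ℝ) ^ (1 / 3 : ℝ) :=
          Real.rpow_le_rpow hk0 (min_le_left _ _) (by norm_num)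
        have hk3 : k ≤ 60 * a * (n' : ℝ) ^ (1 / 3 : ℝ) := by
          calc k = k ^ (2 / 3 : ℝ) * k ^ (1 / 3 : ℝ) := by
                rw [rpow_two_thirds hk0, ← pow_succ, cube_rpow_third hk0]
            _ ≤ _ := mul_le_mul hk1 hk2 (by positivity) (by positivity)
        have : (n' : ℝ) ≤ k + m := by
          rcases min_choice (n' : ℝ) (2 * n) with h3 | h3 <;> rw [hk, h3] <;> linarith
        linarith
    rw [min_eq_left hle]
    linarith [min_le_left (n : ℝ) (m + 2 * 10 ^ 4 + 60 * a * (n : ℝ) ^ (1 / 3 : ℝ))]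

/-- The potential for the planning accuracy in late episodes. -/
theorem latePotential_add_le {a : ℝ} {m n n' : ℕ} (ha : (m : ℝ) ^ (2 / 3 : ℝ) ≤ a)
    (h : n ≤ n') (h' : n' ≤ 2 * n + m) [Decidable (IsLate a n)] :
    2.5 * √(n : ℝ) + ((n' : ℝ) - n) * (if IsLate a n then 1 / √((n + 1 : ℕ) : ℝ) else 0) ≤
      2.5 * √(n' : ℝ) := by
  have h1 : (n : ℝ) ≤ n' := by exact_mod_cast h
  have hs1 := Real.sqrt_le_sqrt h1
  split_ifs with hl
  · have hl2 : (100 * m : ℝ) ≤ n := by exact_mod_cast hl.card_le ha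
    have h2 : (n' : ℝ) ≤ 2 * n + m := by exact_mod_cast h'
    have hn : (0 : ℝ) < n := by
      have := hl.1
      exact_mod_cast (by omega : 0 < n)
    have hs := Real.sqrt_pos.2 hn
    have hs2 : √(n' : ℝ) ≤ 1.5 * √n := by
      rw [Real.sqrt_le_left (by positivity), mul_pow, Real.sq_sqrt hn.le]
      norm_num; linarith
    have e : ((n' : ℝ) - n) = (√(n' : ℝ) - √n) * (√n' + √n) := by
      nlinarith [Real.sq_sqrt hn.le, Real.sq_sqrt (hn.le.trans h1)]
    have h3 : ((n' : ℝ) - n) * (1 / √((n + 1 : ℕ) : ℝ)) ≤ ((n' : ℝ) - n) * (1 / √n) := by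
      refine mul_le_mul_of_nonneg_left ?_ (by linarith)
      refine one_div_le_one_div_of_le hs (Real.sqrt_le_sqrt ?_)
      push_cast; linarith
    have : ((n' : ℝ) - n) * (1 / √n) ≤ (√(n' : ℝ) - √n) * 2.5 := by
      rw [mul_one_div, div_le_iff₀ hs, e, mul_assoc]
      exact mul_le_mul_of_nonneg_left (by linarith) (by linarith)
    linarith
  · linarith

/-! ### The episodes of an execution -/

namespace UCRL3

section Episodes

variable {S A : Type*} [DecidableEq S] [DecidableEq A] {H : Trajectory S A} {pl : ℕ → S → A}

theorem _root_.Trajectory.visits_succ_card (H : Trajectory S A) {lo t : ℕ} (h : lo ≤ t) (s : S)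
    (a : A) : (H.visits lo (t + 1) s a).card =
      (H.visits lo t s a).card + if H.st t = s ∧ H.act t = a then 1 else 0 := by
  rw [Trajectory.visits, Trajectory.visits, Finset.card_filter, Finset.card_filter,
    Finset.sum_Ico_succ_top h]

theorem _root_.Trajectory.visits_card_add (H : Trajectory S A) {i j k : ℕ} (h : i ≤ j)
    (h' : j ≤ k) (s : S) (a : A) :
    (H.visits i j s a).card + (H.visits j k s a).card = (H.visits i k s a).card := by
  simp only [Trajectory.visits, Finset.card_filter]
  exact Finset.sum_Ico_consecutive _ h h'

theorem _root_.Trajectory.visits_card_le (H : Trajectory S A) (i j : ℕ) (s : S) (a : A) :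
    (H.visits i j s a).card ≤ j - i :=
  (Finset.card_filter_le _ _).trans_eq (Nat.card_Ico i j)

theorem _root_.Trajectory.sum_visits_card [Fintype S] [Fintype A] (H : Trajectory S A) (i j : ℕ) :
    ∑ s, ∑ a, (H.visits i j s a).card = j - i := by
  rw [← Nat.card_Ico i j, ← Fintype.sum_prod_type' fun s a => (H.visits i j s a).card,
    Finset.card_eq_sum_card_fiberwise (f := fun k => (H.st k, H.act k)) (t := Finset.univ)
      (by simp)]
  refine Finset.sum_congr rfl fun c _ => ?_
  simp [Trajectory.visits, Prod.ext_iff]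

theorem episodeStart_one : episodeStart H pl 1 = 1 := by simp [episodeStart]

theorem episodeStart_succ (H : Trajectory S A) (pl : ℕ → S → A) (t : ℕ) :
    episodeStart H pl (t + 1) = episodeStart H pl t ∨ episodeStart H pl (t + 1) = t + 1 := by
  rw [episodeStart]
  split_ifs
  · exact Or.inl rfl
  · exact Or.inr rfl

theorem episodeStart_idem {t : ℕ} (ht : 1 ≤ t) :
    episodeStart H pl (episodeStart H pl t) = episodeStart H pl t := by
  induction t, ht using Nat.le_induction with
  | base => rw [episodeStart_one, episodeStart_one]
  | succ t ht ih =>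
    rcases episodeStart_succ H pl t with h | h
    · rw [h, ih]
    · rw [h, h]

variable {T : ℕ}

/-- The policy is kept during an episode. -/
theorem pol_episodeStart (hpl : ∀ t ∈ Finset.Icc 1 T, episodeStart H pl t ≠ t → pl t = pl (t - 1))
    {t : ℕ} (ht : 1 ≤ t) (htT : t ≤ T) : pl (episodeStart H pl t) = pl t := by
  induction t, ht using Nat.le_induction with
  | base => rw [episodeStart_one]
  | succ t ht ih =>
    rcases episodeStart_succ H pl t with h | h
    · have hm := episodeStart_mem H pl ht
      rw [h, ih (by omega), hpl (t + 1) (Finset.mem_Icc.2 ⟨by omega, htT⟩) (by omega),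
        Nat.add_sub_cancel]
    · rw [h]

/-- In an episode a pair is played at most as often as before the episode. -/
theorem visits_episode_card_le (hact : ∀ t ∈ Finset.Icc 1 T, H.act t = pl t (H.st t))
    (hpl : ∀ t ∈ Finset.Icc 1 T, episodeStart H pl t ≠ t → pl t = pl (t - 1))
    {t : ℕ} (ht : 1 ≤ t) (htT : t ≤ T) (s : S) (a : A) :
    (H.visits (episodeStart H pl t) (t + 1) s a).card ≤ H.N (episodeStart H pl t) s a := by
  have hN : ∀ k, 1 ≤ H.N k s a := fun k => le_max_left _ _
  induction t, ht using Nat.le_induction with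
  | base =>
    rw [episodeStart_one]
    exact (H.visits_card_le 1 2 s a).trans (hN 1)
  | succ t ht ih =>
    have hm := episodeStart_mem H pl ht
    by_cases h : 0 < t ∧ (H.visits (episodeStart H pl t) (t + 1) (H.st (t + 1))
        (pl t (H.st (t + 1)))).card < H.N (episodeStart H pl t) (H.st (t + 1))
          (pl t (H.st (t + 1)))
    · have he : episodeStart H pl (t + 1) = episodeStart H pl t := by
        rw [episodeStart]; exact if_pos h
      have hp : pl (t + 1) = pl t := by
        have := hpl (t + 1) (Finset.mem_Icc.2 ⟨by omega, htT⟩) (by omega)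
        rwa [Nat.add_sub_cancel] at this
      rw [he, H.visits_succ_card (by omega)]
      split_ifs with hc
      · have h2 := h.2
        rw [← hp, ← hact (t + 1) (Finset.mem_Icc.2 ⟨by omega, htT⟩), hc.1, hc.2] at h2
        exact h2
      · exact ih (by omega)
    · have he : episodeStart H pl (t + 1) = t + 1 := by
        rw [episodeStart]; exact if_neg h
      rw [he]
      refine (H.visits_card_le _ _ s a).trans ?_
      have := hN (t + 1)
      omega

theorem visits_card_le_double (hact : ∀ t ∈ Finset.Icc 1 T, H.act t = pl t (H.st t))
    (hpl : ∀ t ∈ Finset.Icc 1 T, episodeStart H pl t ≠ t → pl t = pl (t - 1))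
    {t : ℕ} (ht : 1 ≤ t) (htT : t ≤ T) (s : S) (a : A) :
    (H.visits 1 (t + 1) s a).card ≤ (H.visits 1 (episodeStart H pl t) s a).card +
      max 1 (H.visits 1 (episodeStart H pl t) s a).card := by
  have hm := episodeStart_mem H pl ht
  rw [← H.visits_card_add hm.1 (by omega : episodeStart H pl t ≤ t + 1)]
  exact Nat.add_le_add_left (visits_episode_card_le hact hpl ht htT s a) _

/-- An episode ends because some pair has doubled its count. -/
theorem exists_double_of_new {t : ℕ} (ht : 1 ≤ t) (h : episodeStart H pl (t + 1) = t + 1) :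
    ∃ s a, (H.visits 1 (episodeStart H pl t) s a).card +
      max 1 (H.visits 1 (episodeStart H pl t) s a).card ≤ (H.visits 1 (t + 1) s a).card := by
  have hm := episodeStart_mem H pl ht
  refine ⟨H.st (t + 1), pl t (H.st (t + 1)), ?_⟩
  rw [episodeStart] at h
  split_ifs at h with hc
  · omega
  · rw [not_and, not_lt] at hc
    rw [← H.visits_card_add hm.1 (by omega : episodeStart H pl t ≤ t + 1)]
    exact Nat.add_le_add_left (hc ht) _

variable [Fintype S] [Fintype A]

theorem time_le_double (hact : ∀ t ∈ Finset.Icc 1 T, H.act t = pl t (H.st t))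
    (hpl : ∀ t ∈ Finset.Icc 1 T, episodeStart H pl t ≠ t → pl t = pl (t - 1))
    {t : ℕ} (ht : 1 ≤ t) (htT : t ≤ T) :
    t ≤ 2 * (episodeStart H pl t - 1) + Fintype.card S * Fintype.card A := by
  have h1 := H.sum_visits_card 1 (t + 1)
  have h2 := H.sum_visits_card 1 (episodeStart H pl t)
  have h3 : ∑ s, ∑ a, (H.visits 1 (t + 1) s a).card ≤
      ∑ s : S, ∑ a : A, (2 * (H.visits 1 (episodeStart H pl t) s a).card + 1) :=
    Finset.sum_le_sum fun s _ => Finset.sum_le_sum fun a _ => by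
      have := visits_card_le_double hact hpl ht htT s a
      omega
  simp only [Finset.sum_add_distrib, ← Finset.mul_sum, Finset.sum_const, Finset.card_univ,
    smul_eq_mul, mul_one] at h3
  rw [h1, h2] at h3
  omega

/-- The number of episodes that start before `T` is logarithmic. -/
theorem card_episodes_le (hT : 1 ≤ T) :
    (((Finset.Icc 1 T).filter fun t => episodeStart H pl t = t).card : ℝ) ≤
      1 + Fintype.card S * Fintype.card A * (1 + 2 * Real.log T) := by
  have key : ∀ t ≥ 1, (((Finset.Icc 1 t).filter fun t => episodeStart H pl t = t).card : ℝ) ≤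
      1 + ∑ s, ∑ a, logPotential (H.visits 1 (episodeStart H pl t) s a).card := fun t ht => by
    have hnn : ∀ k, 0 ≤ ∑ s, ∑ a, logPotential (H.visits 1 k s a).card := fun k =>
      Finset.sum_nonneg fun s _ => Finset.sum_nonneg fun a _ => logPotential_nonneg _
    induction t, ht using Nat.le_induction with
    | base =>
      have : (((Finset.Icc 1 1).filter fun t => episodeStart H pl t = t).card : ℝ) ≤ 1 := by
        exact_mod_cast (Finset.card_filter_le _ _)
      linarith [hnn (episodeStart H pl 1)]
    | succ t ht ih =>
      have hm := episodeStart_mem H pl ht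
      rw [Finset.card_filter, Finset.sum_Icc_succ_top (by omega), ← Finset.card_filter]
      rcases episodeStart_succ H pl t with h | h
      · rw [h, if_neg (by omega)]
        simpa using ih
      · rw [if_pos h, h]
        obtain ⟨s₀, a₀, h0⟩ := exists_double_of_new ht h
        have hmono : ∀ s a, logPotential (H.visits 1 (episodeStart H pl t) s a).card ≤
            logPotential (H.visits 1 (t + 1) s a).card := fun s a => by
          refine logPotential_mono ?_
          rw [← H.visits_card_add hm.1 (by omega : episodeStart H pl t ≤ t + 1)]
          omega
        have h1 : ∑ s, ∑ a, logPotential (H.visits 1 (episodeStart H pl t) s a).card + 1 ≤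
            ∑ s, ∑ a, logPotential (H.visits 1 (t + 1) s a).card := by
          rw [← Fintype.sum_prod_type'
              (f := fun s a => logPotential (H.visits 1 (episodeStart H pl t) s a).card),
            ← Fintype.sum_prod_type' (f := fun s a => logPotential (H.visits 1 (t + 1) s a).card),
            ← Finset.add_sum_erase _ _ (Finset.mem_univ (s₀, a₀)),
            ← Finset.add_sum_erase _ _ (Finset.mem_univ (s₀, a₀))]
          have := logPotential_double h0
          have := Finset.sum_le_sum fun c (_ : c ∈ Finset.univ.erase (s₀, a₀)) => hmono c.1 c.2
          linarith
        push_cast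
        linarith
  refine (key T hT).trans ?_
  have hm := episodeStart_mem H pl hT
  have : ∑ s, ∑ a, logPotential (H.visits 1 (episodeStart H pl T) s a).card ≤
      ∑ _s : S, ∑ _a : A, (1 + 2 * Real.log T) :=
    Finset.sum_le_sum fun s _ => Finset.sum_le_sum fun a _ => logPotential_le
      ((H.visits_card_le _ _ s a).trans (by omega)) hT
  simp only [Finset.sum_const, Finset.card_univ, nsmul_eq_mul] at this
  rw [← mul_assoc] at this
  linarith

/-- Within an episode the increments of a bias telescope. -/
theorem sum_bias_le {v : ℕ → S → ℝ} {B : ℝ} (hB : ∀ t x y, v t x - v t y ≤ B)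
    (hv : ∀ t ≥ 1, t < T → episodeStart H pl (t + 1) ≠ t + 1 → v (t + 1) = v t) (hT : 1 ≤ T) :
    ∑ t ∈ Finset.Icc 1 T, (v t (H.st (t + 1)) - v t (H.st t)) ≤
      B * (((Finset.Icc 1 T).filter fun t => episodeStart H pl t = t).card : ℝ) := by
  have key : ∀ t ≥ 1, t ≤ T → ∑ i ∈ Finset.Icc 1 t, (v i (H.st (i + 1)) - v i (H.st i)) ≤
      B * ((((Finset.Icc 1 t).filter fun t => episodeStart H pl t = t).card : ℝ) - 1) +
        (v t (H.st (t + 1)) - v t (H.st (episodeStart H pl t))) := fun t ht => by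
    induction t, ht using Nat.le_induction with
    | base =>
      intro _
      simp [episodeStart_one, Finset.filter_singleton]
    | succ t ht ih =>
      intro htT
      have ih := ih (by omega)
      have hm := episodeStart_mem H pl ht
      rw [Finset.sum_Icc_succ_top (by omega), Finset.card_filter,
        Finset.sum_Icc_succ_top (by omega), ← Finset.card_filter]
      rcases episodeStart_succ H pl t with h | h
      · rw [if_neg (by omega), h, hv t ht (by omega) (by omega)]
        simp only [add_zero]
        linarith
      · rw [if_pos h, h]
        have := hB t (H.st (t + 1)) (H.st (episodeStart H pl t))
        push_cast
        linarith
  have := key T hT le_rfl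
  have := hB T (H.st (T + 1)) (H.st (episodeStart H pl T))
  linarith

end Episodes

end UCRL3

/-! ### Decomposition of the regret -/

namespace UCRL3

section Regret

variable {S A : Type*} [Fintype S] [DecidableEq S] [Fintype A] [DecidableEq A]

/-- The scale `D K (S A)^{2/3}` of the loss caused by restricted supports. -/
def lossScale (M : MDP S A) : ℝ :=
  M.diam * M.maxSuccs * ((Fintype.card S * Fintype.card A : ℕ) : ℝ) ^ (2 / 3 : ℝ)

/-- Largest count. -/
def maxCount (N : S → A → ℕ) : ℕ := Finset.univ.sup fun s => Finset.univ.sup fun a => N s a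

open Classical in
/-- An optimistic bias chosen as a function of the data of the episode, and zero if there is
none. -/
def chosenBias (M : MDP S A) (d : ℝ) (x : ℕ × (S → A) × (S → A → ℕ)) : S → ℝ :=
  if h : ∃ u, IsOptimisticBias M d (1 / √(x.1 : ℝ))
    (13.8 * M.diam * M.maxSuccs / (maxCount x.2.2 : ℝ) ^ (2 / 3 : ℝ)) x.2.1 x.2.2 u
  then h.choose else 0

variable {M : MDP S A} {H : Trajectory S A} {pl : ℕ → S → A} {d : ℝ}

theorem chosenBias_sub_le [Nontrivial S] [Nonempty A] (hM : M.Communicating) (d : ℝ)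
    (x : ℕ × (S → A) × (S → A → ℕ)) (s s' : S) :
    chosenBias M d x s - chosenBias M d x s' ≤ 1.38 * M.diam := by
  unfold chosenBias
  split_ifs with h
  · exact (h.choose_spec.1 s' s).trans
      (mul_le_mul_of_nonneg_left (hM.minHit_le_diam s' s) (by norm_num))
  · have := hM.one_le_diam
    simp only [Pi.zero_apply, sub_self]
    positivity

theorem one_le_maxSuccs [Nonempty S] [Nonempty A] (M : MDP S A) : 1 ≤ M.maxSuccs := by
  obtain ⟨s⟩ := ‹Nonempty S›
  obtain ⟨a⟩ := ‹Nonempty A›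
  obtain ⟨z, -, hz⟩ := Finset.exists_lt_of_sum_lt (f := fun _ => (0 : ℝ)) (g := M.p s a)
    (s := Finset.univ) (by rw [(M.p_mem s a).2]; simp)
  have h1 : 1 ≤ (M.succs s a).card := Finset.card_pos.2 ⟨z, by simpa [MDP.succs] using hz⟩
  exact h1.trans ((Finset.le_sup (f := fun a => (M.succs s a).card) (Finset.mem_univ a)).trans
    (Finset.le_sup (f := fun s => Finset.univ.sup fun a => (M.succs s a).card)
      (Finset.mem_univ s)))

theorem card_rpow_le_lossScale [Nontrivial S] [Nonempty A] (hM : M.Communicating) :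
    ((Fintype.card S * Fintype.card A : ℕ) : ℝ) ^ (2 / 3 : ℝ) ≤ lossScale M := by
  have h1 := hM.one_le_diam
  have h2 : (1 : ℝ) ≤ M.maxSuccs := by exact_mod_cast one_le_maxSuccs M
  exact le_mul_of_one_le_left (by positivity) (one_le_mul_of_one_le_of_one_le h1 h2)

theorem le_card_mul_maxCount (H : Trajectory S A) (e : ℕ) :
    e - 1 ≤ Fintype.card S * Fintype.card A * maxCount (H.N e) := by
  rw [← H.sum_visits_card 1 e]
  calc ∑ s, ∑ a, (H.visits 1 e s a).card ≤ ∑ _s : S, ∑ _a : A, maxCount (H.N e) :=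
        Finset.sum_le_sum fun s _ => Finset.sum_le_sum fun a _ => (le_max_right 1 _).trans
          ((Finset.le_sup (f := fun a => H.N e s a) (Finset.mem_univ a)).trans
            (Finset.le_sup (f := fun s => Finset.univ.sup fun a => H.N e s a)
              (Finset.mem_univ s)))
    _ = _ := by simp [mul_assoc]

/-- By the pigeonhole principle the largest count is at least `(e - 1) / (S A)`. -/
theorem loss_le [Nontrivial S] [Nonempty A] (hM : M.Communicating) {e : ℕ} (he : 0 < e - 1) :
    M.diam * M.maxSuccs / (maxCount (H.N e) : ℝ) ^ (2 / 3 : ℝ) ≤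
      lossScale M / ((e - 1 : ℕ) : ℝ) ^ (2 / 3 : ℝ) := by
  have hD := hM.one_le_diam
  have h1 := le_card_mul_maxCount H e
  have h2 : 0 < maxCount (H.N e) := Nat.pos_of_ne_zero fun h => by
    rw [h, mul_zero] at h1; omega
  have h2' : (0 : ℝ) < maxCount (H.N e) := by exact_mod_cast h2
  have he' : (0 : ℝ) < (e - 1 : ℕ) := by exact_mod_cast he
  have h3 : ((e - 1 : ℕ) : ℝ) ≤ ((Fintype.card S * Fintype.card A : ℕ) : ℝ) * maxCount (H.N e) := by
    exact_mod_cast h1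
  have h4 := Real.rpow_le_rpow he'.le h3 (by norm_num : (0 : ℝ) ≤ 2 / 3)
  rw [Real.mul_rpow (Nat.cast_nonneg _) h2'.le] at h4
  rw [div_le_div_iff₀ (Real.rpow_pos_of_pos h2' _) (Real.rpow_pos_of_pos he' _), lossScale]
  exact (mul_le_mul_of_nonneg_left h4 (by positivity : 0 ≤ M.diam * M.maxSuccs)).trans_eq (by ring)

theorem surplus_nonneg (hd : 0 < d) (hd1 : d ≤ 1) (s : S) (a : A) (n : ℕ) :
    0 ≤ surplus M d s a n := by
  have hD : 0 ≤ M.diam := ENNReal.toReal_nonneg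
  have hDs := M.localDiam_nonneg s
  unfold surplus
  split_ifs with h
  · positivity
  · push Not at h
    have := ell_pos h hd hd1
    have := (beta_pos (by omega : 1 ≤ n) hd hd1).le
    refine add_nonneg (le_max_of_le_left this) ?_
    positivity

/-- In a late episode the bias chosen for it is optimistic. -/
theorem chosenBias_spec [Nontrivial S] [Nonempty A] (hM : M.Communicating) {δ : ℝ}
    (hd : 0 < d) (hd1 : d ≤ 1)
    (hdδ : d = δ / (3 + 3 * (Fintype.card S : ℝ)) / ((Fintype.card S : ℝ) * Fintype.card A))
    (hconf : ModelInConfSets M d H) (hrew : ∀ i ≥ 1, H.rew i ∈ Set.Icc (0 : ℝ) 1) {T : ℕ}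
    (hrun : RunsUpTo δ H pl T) {t : ℕ} (ht : 1 ≤ t) (htT : t ≤ T)
    (hlate : IsLate (lossScale M) (episodeStart H pl t - 1)) (s s₀ : S) :
    chosenBias M d (episodeData H pl t) s + M.optGain s₀
        - 1 / √((episodeStart H pl t : ℕ) : ℝ)
        - 13.8 * lossScale M / ((episodeStart H pl t - 1 : ℕ) : ℝ) ^ (2 / 3 : ℝ) ≤
      M.mean s (pl t s) + ∑ z, M.p s (pl t s) z * chosenBias M d (episodeData H pl t) z
        + surplus M d s (pl t s) (H.N (episodeStart H pl t) s (pl t s)) := by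
  have hm := episodeStart_mem H pl ht
  set e := episodeStart H pl t with he
  have hplan := (hrun e (Finset.mem_Icc.2 ⟨hm.1, hm.2.trans htT⟩)).2.1 (episodeStart_idem ht)
  rw [pol_episodeStart (fun t ht => (hrun t ht).2.2) ht htT] at hplan
  have he4 : 10 ^ 4 ≤ e - 1 := hlate.1
  have hloss := loss_le (H := H) hM (e := e) (by omega)
  have hle := hlate.le
  have hex := exists_optimisticBias (t := e) (Nmax := maxCount (H.N e)) (ε := 1 / √(e : ℝ))
    (π := pl t) hM hd hd1 hrew (fun s a => (hconf e hm.1 s a).1) (fun s a => (hconf e hm.1 s a).2)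
    (by
      have h1 : (100 : ℝ) ≤ √(e : ℝ) := by
        rw [Real.le_sqrt (by norm_num) (Nat.cast_nonneg _)]
        norm_num
        exact_mod_cast (by omega : 10000 ≤ e)
      rw [div_le_iff₀ (by linarith)]
      linarith)
    (by
      have : 10 * (M.maxSuccs : ℝ) / (maxCount (H.N e) : ℝ) ^ (2 / 3 : ℝ) * M.diam =
        10 * (M.diam * M.maxSuccs / (maxCount (H.N e) : ℝ) ^ (2 / 3 : ℝ)) := by ring
      rw [this]
      linarith)
    (by
      subst hdδ
      exact hplan)
  have hu : chosenBias M d (episodeData H pl t) = hex.choose := by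
    rw [chosenBias]
    exact dif_pos hex
  have h2 := hex.choose_spec.2 s s₀
  rw [hu]
  have h3 : 13.8 * M.diam * M.maxSuccs / (maxCount (H.N e) : ℝ) ^ (2 / 3 : ℝ) ≤
      13.8 * lossScale M / ((e - 1 : ℕ) : ℝ) ^ (2 / 3 : ℝ) := by
    calc _ = 13.8 * (M.diam * M.maxSuccs / (maxCount (H.N e) : ℝ) ^ (2 / 3 : ℝ)) := by ring
      _ ≤ 13.8 * (lossScale M / ((e - 1 : ℕ) : ℝ) ^ (2 / 3 : ℝ)) :=
          mul_le_mul_of_nonneg_left hloss (by norm_num)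
      _ = _ := by ring
  linarith

open Classical in
/-- Decomposition of the regret on the good event: loss of early episodes and of restricted
supports, planning accuracy, surplus, the two martingales, and the telescoping biases. -/
theorem regret_le_sum [Nontrivial S] [Nonempty A] (hM : M.Communicating) {δ : ℝ}
    (hd : 0 < d) (hd1 : d ≤ 1)
    (hdδ : d = δ / (3 + 3 * (Fintype.card S : ℝ)) / ((Fintype.card S : ℝ) * Fintype.card A))
    (hconf : ModelInConfSets M d H) (hrew : ∀ i ≥ 1, H.rew i ∈ Set.Icc (0 : ℝ) 1) {T : ℕ}
    (hT : 1 ≤ T) (hrun : RunsUpTo δ H pl T) :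
    regret M H T ≤
      ((Fintype.card S * Fintype.card A : ℕ) + 2 * 10 ^ 4
        + 60 * lossScale M * (T : ℝ) ^ (1 / 3 : ℝ))
      + 2.5 * √(T : ℝ)
      + ∑ s, ∑ a, ∑ t ∈ Finset.Icc 1 T, (if H.st t = s ∧ H.act t = a then
          surplus M d s a (max 1 (H.visits 1 (episodeStart H pl t) s a).card) else 0)
      + ∑ t ∈ Finset.Icc 1 T, (if IsLate (lossScale M) (episodeStart H pl t - 1) then
          M.mean (H.st t) (H.act t) - H.rew t else 0)
      + ∑ t ∈ Finset.Icc 1 T, (if IsLate (lossScale M) (episodeStart H pl t - 1) then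
          ∑ z, M.p (H.st t) (H.act t) z * chosenBias M d (episodeData H pl t) z
            - chosenBias M d (episodeData H pl t) (H.st (t + 1)) else 0)
      + 1.38 * M.diam * (1 + Fintype.card S * Fintype.card A * (1 + 2 * Real.log T)) := by
  have hact : ∀ t ∈ Finset.Icc 1 T, H.act t = pl t (H.st t) := fun t ht => (hrun t ht).1
  have hpl : ∀ t ∈ Finset.Icc 1 T, episodeStart H pl t ≠ t → pl t = pl (t - 1) :=
    fun t ht => (hrun t ht).2.2
  have hD := hM.one_le_diam
  have ha := card_rpow_le_lossScale hM
  set L := lossScale M with hL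
  set e := episodeStart H pl with he
  set v : ℕ → S → ℝ := fun t => if IsLate L (e t - 1) then
    chosenBias M d (episodeData H pl t) else 0 with hv
  have heps : ∀ t ≥ 1, e t ≤ t ∧ (e (t + 1) = e t ∨ e (t + 1) = t + 1) := fun t ht =>
    ⟨(episodeStart_mem H pl ht).2, episodeStart_succ H pl t⟩
  -- the loss term: potential for the global counter `t - 1`
  have hB : ∀ t ≥ 1, t ≤ T → (t + 1) - 1 ≤ 2 * (e t - 1) + Fintype.card S * Fintype.card A :=
    fun t ht htT => by
      have : t ≤ 2 * (e t - 1) + _ := time_le_double hact hpl ht htT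
      omega
  have hloss : ∑ t ∈ Finset.Icc 1 T, (if IsLate L (e t - 1) then
      13.8 * L / ((e t - 1 : ℕ) : ℝ) ^ (2 / 3 : ℝ) else 1) ≤
      (Fintype.card S * Fintype.card A : ℕ) + 2 * 10 ^ 4 + 60 * L * (T : ℝ) ^ (1 / 3 : ℝ) := by
    have h0 : 0 ≤ L := le_trans (by positivity) ha
    have := sum_episodes_le (c := fun t => t - 1) (B := fun n => 2 * n +
        Fintype.card S * Fintype.card A) episodeStart_one heps (fun _ => True) rfl
      (fun t ht => by simp; omega) hT hB
      (w := fun n => if IsLate L n then 13.8 * L / (n : ℝ) ^ (2 / 3 : ℝ) else 1)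
      (G := fun n => min (n : ℝ) ((Fintype.card S * Fintype.card A : ℕ) + 2 * 10 ^ 4 +
        60 * L * (n : ℝ) ^ (1 / 3 : ℝ)))
      (by positivity) (fun n n' h h' => cubeRootPotential_add_le ha h h')
    simp only [if_true, Nat.add_sub_cancel] at this
    exact this.trans (min_le_right _ _)
  have hacc : ∑ t ∈ Finset.Icc 1 T, (if IsLate L (e t - 1) then 1 / √((e t : ℕ) : ℝ) else 0) ≤
      2.5 * √(T : ℝ) := by
    have := sum_episodes_le (c := fun t => t - 1) (B := fun n => 2 * n +
        Fintype.card S * Fintype.card A) episodeStart_one heps (fun _ => True) rfl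
      (fun t ht => by simp; omega) hT hB
      (w := fun n => if IsLate L n then 1 / √((n + 1 : ℕ) : ℝ) else 0)
      (G := fun n => 2.5 * √(n : ℝ))
      (by positivity) (fun n n' h h' => latePotential_add_le ha h h')
    simp only [if_true, Nat.add_sub_cancel] at this
    refine le_trans (le_of_eq (Finset.sum_congr rfl fun t ht => ?_)) this
    have := (episodeStart_mem H pl (Finset.mem_Icc.1 ht).1).1
    rw [Nat.sub_add_cancel this]
  have htel : ∑ t ∈ Finset.Icc 1 T, (v t (H.st (t + 1)) - v t (H.st t)) ≤
      1.38 * M.diam * (1 + Fintype.card S * Fintype.card A * (1 + 2 * Real.log T)) := by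
    refine (sum_bias_le (pl := pl) (B := 1.38 * M.diam) (fun t x y => ?_) (fun t ht htT hne => ?_)
      hT).trans (mul_le_mul_of_nonneg_left (card_episodes_le hT) (by positivity))
    · simp only [hv]
      split_ifs
      · exact chosenBias_sub_le hM d _ x y
      · simp only [Pi.zero_apply, sub_self]; positivity
    · have h1 : e (t + 1) = e t := (episodeStart_succ H pl t).resolve_right hne
      have h2 : pl (t + 1) = pl t :=
        hpl (t + 1) (Finset.mem_Icc.2 ⟨by omega, htT⟩) hne
      simp only [hv, episodeData]
      rw [← he, h1, h2]
  have hsur : ∑ t ∈ Finset.Icc 1 T, surplus M d (H.st t) (H.act t) (H.N (e t) (H.st t) (H.act t)) =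
      ∑ s, ∑ a, ∑ t ∈ Finset.Icc 1 T, (if H.st t = s ∧ H.act t = a then
        surplus M d s a (max 1 (H.visits 1 (e t) s a).card) else 0) := by
    simp_rw [Finset.sum_comm (s := Finset.univ (α := A)) (t := Finset.Icc 1 T)]
    rw [Finset.sum_comm]
    refine Finset.sum_congr rfl fun t _ => ?_
    simp_rw [ite_and]
    simp [Finset.sum_ite_eq, Trajectory.N]
  have hreg : regret M H T = ∑ t ∈ Finset.Icc 1 T, (M.optGain (H.st 1) - H.rew t) := by
    rw [regret, Finset.sum_sub_distrib]
    simp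
  rw [hreg, ← hsur]
  refine le_trans (Finset.sum_le_sum (g := fun t =>
      (if IsLate L (e t - 1) then 13.8 * L / ((e t - 1 : ℕ) : ℝ) ^ (2 / 3 : ℝ) else 1)
      + (if IsLate L (e t - 1) then 1 / √((e t : ℕ) : ℝ) else 0)
      + surplus M d (H.st t) (H.act t) (H.N (e t) (H.st t) (H.act t))
      + (if IsLate L (e t - 1) then M.mean (H.st t) (H.act t) - H.rew t else 0)
      + (if IsLate L (e t - 1) then
          ∑ z, M.p (H.st t) (H.act t) z * chosenBias M d (episodeData H pl t) z
            - chosenBias M d (episodeData H pl t) (H.st (t + 1)) else 0)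
      + (v t (H.st (t + 1)) - v t (H.st t))) fun t ht => ?_) ?_
  · have ht' := Finset.mem_Icc.1 ht
    have hs0 := surplus_nonneg (M := M) hd hd1 (H.st t) (H.act t)
      (H.N (e t) (H.st t) (H.act t))
    simp only [hv]
    by_cases hl : IsLate L (e t - 1)
    · simp only [if_pos hl]
      have := chosenBias_spec hM hd hd1 hdδ hconf hrew hrun ht'.1 ht'.2 hl (H.st t) (H.st 1)
      rw [← hact t ht] at this
      linarith
    · simp only [if_neg hl]
      have := M.optGain_le_one (H.st 1)
      have := (hrew t ht'.1).1
      simp only [Pi.zero_apply]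
      linarith
  · simp only [Finset.sum_add_distrib]
    linarith

end Regret

end UCRL3

/-! ### The regret bound on the good event -/

namespace UCRL3

section Bounds

variable {S A : Type*} [Fintype S] [DecidableEq S] [Fintype A] [DecidableEq A]
  {M : MDP S A} {H : Trajectory S A} {pl : ℕ → S → A} {d : ℝ}

theorem sum_mul_le_sqrt_mul_sqrt (f g : S → A → ℝ) :
    ∑ s, ∑ a, f s a * g s a ≤ √(∑ s, ∑ a, f s a ^ 2) * √(∑ s, ∑ a, g s a ^ 2) := by
  have := Real.sum_mul_le_sqrt_mul_sqrt (Finset.univ (α := S × A)) (fun c => f c.1 c.2)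
    (fun c => g c.1 c.2)
  rwa [Fintype.sum_prod_type' (f := fun s a => f s a * g s a),
    Fintype.sum_prod_type' (f := fun s a => f s a ^ 2),
    Fintype.sum_prod_type' (f := fun s a => g s a ^ 2)] at this

/-- The surplus of a pair played `n` times, with a leading part of order `1 / √n` and a lower
order part of order `1 / n`. -/
theorem surplus_le [Nontrivial S] [Nonempty A] (hM : M.Communicating) (hd : 0 < d) (hd1 : d ≤ 1)
    {Λ : ℝ} (hΛ : 1 ≤ Λ) {n : ℕ} (hn : 1 ≤ n) (hβ : Real.log (√((n : ℝ) + 1) / d) ≤ Λ)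
    (hell : 2 ≤ n → ell n d ≤ 1.12 * Λ) (s : S) (a : A) :
    surplus M d s a n ≤
      √Λ * (√3 + √2 * 1.38 * √1.12 * (M.localDiam s * √(M.effSupp s a))) * (1 / √(n : ℝ))
        + 9 * Fintype.card S * M.diam * Λ * (1 / n) := by
  have hD := hM.one_le_diam
  have hDs := M.localDiam_nonneg s
  have hS : (2 : ℝ) ≤ Fintype.card S := by exact_mod_cast Fintype.one_lt_card (α := S)
  have hSD : 2 ≤ Fintype.card S * M.diam := by nlinarith
  have hn0 : (0 : ℝ) < n := by exact_mod_cast hn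
  rw [surplus]
  split_ifs with h
  · have : n = 1 := by omega
    subst this
    have h1 : 0 ≤ √Λ * (√3 + √2 * 1.38 * √1.12 * (M.localDiam s * √(M.effSupp s a))) := by
      positivity
    have h2 : M.diam ≤ Fintype.card S * M.diam := le_mul_of_one_le_left (by linarith) (by linarith)
    have h3 : Fintype.card S * M.diam ≤ Fintype.card S * M.diam * Λ :=
      le_mul_of_one_le_right (by linarith) hΛ
    simp only [Nat.cast_one, Real.sqrt_one, div_one, mul_one]
    linarith [show 9 * (Fintype.card S : ℝ) * M.diam * Λ = 9 * (Fintype.card S * M.diam * Λ) by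
      ring]
  · push Not at h
    have hl := hell h
    have hl0 := ell_pos h hd hd1
    set v := ell n d / n with hv
    have hv0 : 0 ≤ v := by positivity
    have hv1 : v ≤ 1.12 * (Λ * (1 / n)) := by
      rw [hv, mul_one_div, ← mul_div_assoc]; gcongr
    have hΛn : √(Λ * (1 / n)) = √Λ * (1 / √(n : ℝ)) := by
      rw [Real.sqrt_mul (by linarith), Real.sqrt_div zero_le_one, Real.sqrt_one]
    have hsv : √v ≤ √1.12 * (√Λ * (1 / √(n : ℝ))) := by
      rw [← hΛn, ← Real.sqrt_mul (by norm_num)]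
      exact Real.sqrt_le_sqrt hv1
    have hbeta : beta n d ≤ √3 * (√Λ * (1 / √(n : ℝ))) := by
      rw [← hΛn, ← Real.sqrt_mul (by norm_num), beta]
      refine Real.sqrt_le_sqrt ?_
      have h1 : 1 / (n : ℝ) ≤ 1 / 2 :=
        one_div_le_one_div_of_le (by norm_num) (by exact_mod_cast h)
      have h2 := (log_level_pos hn hd hd1).le
      rw [mul_one_div, ← mul_div_assoc]
      gcongr
      linarith
    have hber : √(2 * v) ≤ √3 * (√Λ * (1 / √(n : ℝ))) := by
      rw [← hΛn, ← Real.sqrt_mul (by norm_num)]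
      have : 0 ≤ Λ * (1 / (n : ℝ)) := by positivity
      exact Real.sqrt_le_sqrt (by linarith)
    have hmax : max (beta n d) (√(2 * v) + 14 / 3 * v) ≤
        √3 * (√Λ * (1 / √(n : ℝ))) + 14 / 3 * v := max_le (by linarith) (by linarith)
    have htr : √2 * (1.38 * M.localDiam s) * √(M.effSupp s a) * √v ≤
        √2 * (1.38 * M.localDiam s) * √(M.effSupp s a) * (√1.12 * (√Λ * (1 / √(n : ℝ)))) :=
      mul_le_mul_of_nonneg_left hsv (by positivity)
    have hlow : 14 / 3 * v + 4 * Fintype.card S * (1.38 * M.diam) * v ≤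
        9 * Fintype.card S * M.diam * Λ * (1 / n) := by
      have h1 : 14 / 3 + 4 * Fintype.card S * (1.38 * M.diam) ≤
          7.9 * (Fintype.card S * M.diam) := by linarith
      calc 14 / 3 * v + 4 * Fintype.card S * (1.38 * M.diam) * v
          = (14 / 3 + 4 * Fintype.card S * (1.38 * M.diam)) * v := by ring
        _ ≤ 7.9 * (Fintype.card S * M.diam) * (1.12 * (Λ * (1 / n))) :=
            mul_le_mul h1 hv1 hv0 (by positivity)
        _ = 8.848 * (Fintype.card S * M.diam * Λ * (1 / n)) := by ring
        _ ≤ 9 * (Fintype.card S * M.diam * Λ * (1 / n)) := by gcongr; norm_num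
        _ = _ := by ring
    calc _ ≤ √3 * (√Λ * (1 / √(n : ℝ))) + 14 / 3 * v +
          (√2 * (1.38 * M.localDiam s) * √(M.effSupp s a) * (√1.12 * (√Λ * (1 / √(n : ℝ))))
          + 4 * Fintype.card S * (1.38 * M.diam) * v) := by linarith
      _ = √Λ * (√3 + √2 * 1.38 * √1.12 * (M.localDiam s * √(M.effSupp s a))) * (1 / √(n : ℝ))
          + (14 / 3 * v + 4 * Fintype.card S * (1.38 * M.diam) * v) := by ring
      _ ≤ _ := by linarith

/-- The leading constants: `√2 · 1.38 · √1.12 · (1 + √2) ≤ 5` and `√3 · (1 + √2) ≤ 4.2`. -/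
theorem leading_constants : √2 * 1.38 * √1.12 * (1 + √2) ≤ 5 ∧ √3 * (1 + √2) ≤ 4.2 := by
  have h2 : √2 ≤ 1.41422 := by rw [Real.sqrt_le_left (by norm_num)]; norm_num
  have h3 : √3 ≤ 1.7321 := by rw [Real.sqrt_le_left (by norm_num)]; norm_num
  have h4 : √1.12 ≤ 1.0584 := by rw [Real.sqrt_le_left (by norm_num)]; norm_num
  constructor
  · calc √2 * 1.38 * √1.12 * (1 + √2) ≤ 1.41422 * 1.38 * 1.0584 * (1 + 1.41422) := by gcongr
      _ ≤ 5 := by norm_num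
  · calc √3 * (1 + √2) ≤ 1.7321 * (1 + 1.41422) := by gcongr
      _ ≤ 4.2 := by norm_num

open Classical in
/-- All surpluses together; the pairs are combined by the Cauchy–Schwarz inequality. -/
theorem sum_surplus_le [Nontrivial S] [Nonempty A] (hM : M.Communicating) (hd : 0 < d)
    (hd1 : d ≤ 1) {T : ℕ} (hT : 1 ≤ T) (hact : ∀ t ∈ Finset.Icc 1 T, H.act t = pl t (H.st t))
    (hpl : ∀ t ∈ Finset.Icc 1 T, episodeStart H pl t ≠ t → pl t = pl (t - 1))
    {Λ : ℝ} (hΛ : 1 ≤ Λ) (hβ : ∀ n : ℕ, n ≤ T → Real.log (√((n : ℝ) + 1) / d) ≤ Λ)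
    (hell : ∀ n, 2 ≤ n → n ≤ T → ell n d ≤ 1.12 * Λ) :
    ∑ s, ∑ a, ∑ t ∈ Finset.Icc 1 T, (if H.st t = s ∧ H.act t = a then
          surplus M d s a (max 1 (H.visits 1 (episodeStart H pl t) s a).card) else 0) ≤
      (5 * √(∑ s, ∑ a, M.localDiam s ^ 2 * M.effSupp s a)
        + 4.2 * √((Fintype.card S : ℝ) * Fintype.card A)) * √(T * Λ)
      + Fintype.card S * Fintype.card A *
        (9 * Fintype.card S * M.diam * Λ * (1 + 2 * Real.log T)) := by
  have hD := hM.one_le_diam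
  obtain ⟨hc1, hc2⟩ := leading_constants
  set x : S → A → ℝ := fun s a => M.localDiam s * √(M.effSupp s a) with hx
  have hx0 : ∀ s a, 0 ≤ x s a := fun s a => mul_nonneg (M.localDiam_nonneg s) (Real.sqrt_nonneg _)
  have hx2 : ∀ s a, x s a ^ 2 = M.localDiam s ^ 2 * M.effSupp s a := fun s a => by
    rw [hx, mul_pow, Real.sq_sqrt (by unfold MDP.effSupp; positivity)]
  set N : S → A → ℕ := fun s a => (H.visits 1 (T + 1) s a).card with hN
  have hpair : ∀ s a, ∑ t ∈ Finset.Icc 1 T, (if H.st t = s ∧ H.act t = a then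
      surplus M d s a (max 1 (H.visits 1 (episodeStart H pl t) s a).card) else 0) ≤
      √Λ * (5 * (x s a * √(N s a : ℝ)) + 4.2 * (1 * √(N s a : ℝ)))
        + 9 * Fintype.card S * M.diam * Λ * (1 + 2 * Real.log T) := fun s a => by
    set α := √Λ * (√3 + √2 * 1.38 * √1.12 * x s a) with hα
    set b := 9 * Fintype.card S * M.diam * Λ with hb
    have hα0 : 0 ≤ α := by have := hx0 s a; positivity
    have hb0 : 0 ≤ b := by positivity
    have h1 := sum_episodes_le (c := fun t => (H.visits 1 t s a).card) (B := fun n => n + max 1 n)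
      (e := episodeStart H pl)
      episodeStart_one (fun t ht => ⟨(episodeStart_mem H pl ht).2, episodeStart_succ H pl t⟩)
      (fun t => H.st t = s ∧ H.act t = a) (by simp [Trajectory.visits])
      (fun t ht => H.visits_succ_card ht s a) hT
      (fun t ht htT => visits_card_le_double hact hpl ht htT s a)
      (w := fun n => α * (1 / √((max 1 n : ℕ) : ℝ)) + b * (1 / (max 1 n : ℕ)))
      (G := fun n => α * ((1 + √2) * √(n : ℝ)) + b * logPotential n)
      (add_nonneg (by positivity) (mul_nonneg hb0 (logPotential_nonneg 0)))
      (fun n n' h h' => by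
        have h1 := mul_le_mul_of_nonneg_left (sqrtPotential_add_le h h') hα0
        have h2 := mul_le_mul_of_nonneg_left (logPotential_add_le h h') hb0
        calc _ = α * ((1 + √2) * √(n : ℝ) + ((n' : ℝ) - n) * (1 / √((max 1 n : ℕ) : ℝ)))
            + b * (logPotential n + ((n' : ℝ) - n) * (1 / (max 1 n : ℕ))) := by ring
          _ ≤ _ := add_le_add h1 h2)
    refine (Finset.sum_le_sum fun t ht => ?_).trans (h1.trans ?_)
    · have ht' := Finset.mem_Icc.1 ht
      split_ifs
      · have hm := episodeStart_mem H pl ht'.1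
        have hle : max 1 (H.visits 1 (episodeStart H pl t) s a).card ≤ T :=
          max_le hT ((H.visits_card_le _ _ s a).trans (by omega))
        exact surplus_le hM hd hd1 hΛ (le_max_left _ _) (hβ _ hle) (fun h => hell _ h hle) s a
      · exact le_rfl
    · have h2 : b * logPotential (N s a) ≤ b * (1 + 2 * Real.log T) :=
        mul_le_mul_of_nonneg_left (logPotential_le ((H.visits_card_le _ _ s a).trans (by omega))
          hT) hb0
      have h3 : α * ((1 + √2) * √(N s a : ℝ)) ≤
          √Λ * (5 * (x s a * √(N s a : ℝ)) + 4.2 * (1 * √(N s a : ℝ))) := by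
        have h4 : (√3 * (1 + √2) + √2 * 1.38 * √1.12 * (1 + √2) * x s a) ≤ 4.2 + 5 * x s a :=
          add_le_add hc2 (mul_le_mul_of_nonneg_right hc1 (hx0 s a))
        calc α * ((1 + √2) * √(N s a : ℝ)) = √Λ * √(N s a : ℝ) *
              (√3 * (1 + √2) + √2 * 1.38 * √1.12 * (1 + √2) * x s a) := by rw [hα]; ring
          _ ≤ √Λ * √(N s a : ℝ) * (4.2 + 5 * x s a) :=
              mul_le_mul_of_nonneg_left h4 (by positivity)
          _ = _ := by ring
      exact add_le_add h3 h2
  have hNT : ∑ s, ∑ a, √(N s a : ℝ) ^ 2 = T := by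
    have := H.sum_visits_card 1 (T + 1)
    simp_rw [Real.sq_sqrt (Nat.cast_nonneg _)]
    rw [Nat.add_sub_cancel] at this
    exact_mod_cast this
  have hCS1 := sum_mul_le_sqrt_mul_sqrt x (fun s a => √(N s a : ℝ))
  have hCS2 := sum_mul_le_sqrt_mul_sqrt (fun (_ : S) (_ : A) => (1 : ℝ)) (fun s a => √(N s a : ℝ))
  simp only [one_pow, Finset.sum_const, Finset.card_univ, nsmul_eq_mul, mul_one] at hCS2
  rw [hNT] at hCS1 hCS2
  simp_rw [hx2] at hCS1
  refine (Finset.sum_le_sum fun s _ => Finset.sum_le_sum fun a _ => hpair s a).trans ?_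
  have hlin : ∀ (f g : S → A → ℝ) (k c : ℝ), ∑ s, ∑ a, (k * (5 * f s a + 4.2 * g s a) + c) =
      k * (5 * ∑ s, ∑ a, f s a + 4.2 * ∑ s, ∑ a, g s a)
        + Fintype.card S * Fintype.card A * c := fun f g k c => by
    simp only [Finset.sum_add_distrib, ← Finset.mul_sum, Finset.sum_const, Finset.card_univ,
      nsmul_eq_mul]
    ring
  rw [hlin, Real.sqrt_mul (Nat.cast_nonneg T)]
  have h0 := Real.sqrt_nonneg Λ
  have h1 := mul_le_mul_of_nonneg_left hCS1 h0
  have h2 := mul_le_mul_of_nonneg_left hCS2 h0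
  linarith

theorem regret_le_self [Nonempty A] (hrew : ∀ i ≥ 1, H.rew i ∈ Set.Icc (0 : ℝ) 1) (T : ℕ) :
    regret M H T ≤ T := by
  have h1 := M.optGain_le_one (H.st 1)
  have h2 : 0 ≤ ∑ t ∈ Finset.Icc 1 T, H.rew t :=
    Finset.sum_nonneg fun t ht => (hrew t (Finset.mem_Icc.1 ht).1).1
  have h3 : (T : ℝ) * M.optGain (H.st 1) ≤ T * 1 :=
    mul_le_mul_of_nonneg_left h1 (Nat.cast_nonneg T)
  rw [regret]
  linarith

/-- Comparison of the logarithmic factors of long runs. -/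
theorem log_factors {s a δ : ℝ} {T : ℕ} (hs : 2 ≤ s) (ha : 1 ≤ a) (hδ : 0 < δ) (hδ1 : δ < 1)
    (hd : d = δ / (3 + 3 * s) / (s * a)) (hT : 6 ≤ T) (hST : s ^ 2 * a ≤ T)
    (hgrow : Real.log T * Real.log (1.12 * T) ≤ Real.log 1.12 ^ 2 * √((T : ℝ) + 1)) :
    0 < d ∧ d ≤ 1 ∧
    (∀ n : ℕ, n ≤ T → Real.log (√((n : ℝ) + 1) / d) ≤
      Real.log (6 * s ^ 2 * a * √((T : ℝ) + 1) / δ)) ∧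
    (∀ n : ℕ, 2 ≤ n → n ≤ T → ell n d ≤
      1.12 * Real.log (6 * s ^ 2 * a * √((T : ℝ) + 1) / δ)) ∧
    1 ≤ Real.log (6 * s ^ 2 * a * √((T : ℝ) + 1) / δ) ∧
    Real.log (6 * s ^ 2 * a * √((T : ℝ) + 1) / δ) ≤ 3 * Real.log (T / δ) ∧
    Real.log T ≤ Real.log (T / δ) ∧ 1 ≤ Real.log (T / δ) := by
  have hTr : (6 : ℝ) ≤ T := by exact_mod_cast hT
  have hsa : 2 ≤ s * a := by nlinarith
  have hd0 : 0 < d := by rw [hd]; positivity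
  have hinv : 1 / d ≤ 6 * s ^ 2 * a / δ := by
    rw [hd, div_div, one_div_div]
    refine div_le_div_of_nonneg_right ?_ hδ.le
    have : 0 ≤ s * a * (s - 1) := mul_nonneg (by linarith) (by linarith)
    linarith [show (3 + 3 * s) * (s * a) = 6 * s ^ 2 * a - 3 * (s * a * (s - 1)) by ring]
  have hsq1 : 1 ≤ √((T : ℝ) + 1) := by rw [Real.one_le_sqrt]; linarith
  have hΛarg : √((T : ℝ) + 1) * (1 / d) ≤ 6 * s ^ 2 * a * √((T : ℝ) + 1) / δ := by
    calc _ ≤ √((T : ℝ) + 1) * (6 * s ^ 2 * a / δ) := by gcongr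
      _ = _ := by ring
  have hTδ : (T : ℝ) ≤ T / δ := by rw [le_div_iff₀ hδ]; nlinarith
  have he := Real.exp_one_lt_d9
  refine ⟨hd0, ?_, fun n hn => ?_, fun n h2n hn => ?_, ?_, ?_,
    Real.log_le_log (by linarith) hTδ, ?_⟩
  · rw [hd, div_div, div_le_one (by positivity)]
    nlinarith
  · have hnT : (n : ℝ) ≤ T := by exact_mod_cast hn
    refine Real.log_le_log (by positivity) (le_trans ?_ hΛarg)
    rw [mul_one_div]
    gcongr
  · have hnT : (n : ℝ) ≤ T := by exact_mod_cast hn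
    have hn2 : (2 : ℝ) ≤ n := by exact_mod_cast h2n
    have hl1 : 0 < Real.log n := Real.log_pos (by linarith)
    have hl2 : 0 < Real.log (1.12 * n) := Real.log_pos (by linarith)
    have hl3 : 0 < Real.log 1.12 := Real.log_pos (by norm_num)
    rw [ell]
    refine mul_le_mul_of_nonneg_left (Real.log_le_log (by positivity) (le_trans ?_ hΛarg))
      (by norm_num)
    rw [mul_one_div, ← div_div]
    gcongr
    rw [div_le_iff₀ (by positivity), mul_comm (√((T : ℝ) + 1))]
    refine le_trans ?_ hgrow
    gcongr
  · rw [Real.le_log_iff_exp_le (by positivity), le_div_iff₀ hδ]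
    have h2 : 24 ≤ 6 * s ^ 2 * a := by nlinarith
    have h3 : 24 * 1 ≤ 6 * s ^ 2 * a * √((T : ℝ) + 1) := by gcongr
    nlinarith [Real.exp_pos 1]
  · have : 3 * Real.log (T / δ) = Real.log ((T / δ) ^ 3) := by rw [Real.log_pow]; norm_num
    rw [this]
    refine Real.log_le_log (by positivity) ?_
    have h1 : √((T : ℝ) + 1) ≤ T := by
      rw [Real.sqrt_le_left (by linarith)]; nlinarith
    have h2 : 6 * s ^ 2 * a * √((T : ℝ) + 1) ≤ (T : ℝ) * T * T := by
      calc 6 * s ^ 2 * a * √((T : ℝ) + 1) = 6 * (s ^ 2 * a) * √((T : ℝ) + 1) := by ring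
        _ ≤ (T : ℝ) * T * T := by gcongr
    calc 6 * s ^ 2 * a * √((T : ℝ) + 1) / δ ≤ (T : ℝ) * T * T / δ := by gcongr
      _ = (T : ℝ) * T * (T / δ) := by ring
      _ ≤ (T / δ) * (T / δ) * (T / δ) := by gcongr
      _ = _ := by ring
  · rw [Real.le_log_iff_exp_le (by positivity)]
    linarith

/-- The terms of lower order add up to a multiple of `D S² A log² (T / δ)`. -/
theorem lower_order_le {D s a Λ ℓ l : ℝ} (hD : 1 ≤ D) (hs : 2 ≤ s) (ha : 1 ≤ a) (hΛ0 : 0 ≤ Λ)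
    (hΛ : Λ ≤ 3 * ℓ) (hl0 : 0 ≤ l) (hl : l ≤ ℓ) (hℓ : 1 ≤ ℓ) :
    s * a + 2 * 10 ^ 4 + s * a * (9 * s * D * Λ * (1 + 2 * l))
      + 1.38 * D * (1 + s * a * (1 + 2 * l)) ≤ 20100 * (D * s ^ 2 * a * ℓ ^ 2) := by
  have hsa : 2 ≤ s * a := by nlinarith
  have h1 : s * a * (9 * s * D * Λ * (1 + 2 * l)) ≤ 81 * (D * s ^ 2 * a * ℓ ^ 2) := by
    calc s * a * (9 * s * D * Λ * (1 + 2 * l)) ≤ s * a * (9 * s * D * (3 * ℓ) * (3 * ℓ)) := by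
          gcongr; linarith
      _ = _ := by ring
  have h2 : 1 ≤ ℓ ^ 2 := one_le_pow₀ hℓ
  have h3 : ℓ ≤ ℓ ^ 2 := by nlinarith
  have h4 : s * a ≤ D * s ^ 2 * a * ℓ ^ 2 := by
    have : 1 ≤ D * s * ℓ ^ 2 :=
      one_le_mul_of_one_le_of_one_le (one_le_mul_of_one_le_of_one_le hD (by linarith)) h2
    calc s * a ≤ s * a * (D * s * ℓ ^ 2) := le_mul_of_one_le_right (by linarith) this
      _ = _ := by ring
  have h5 : 1.38 * D * (1 + s * a * (1 + 2 * l)) ≤ 5 * (D * s ^ 2 * a * ℓ ^ 2) := by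
    have h6 : 1 + 2 * l ≤ 3 * ℓ ^ 2 := by linarith
    have h7 : 1 ≤ s * a * ℓ ^ 2 := one_le_mul_of_one_le_of_one_le (by linarith) h2
    calc 1.38 * D * (1 + s * a * (1 + 2 * l)) ≤ 1.38 * D * (s * a * ℓ ^ 2
          + s * a * (3 * ℓ ^ 2)) := by gcongr
      _ = 2.76 * (2 * (D * (s * a) * ℓ ^ 2)) := by ring
      _ ≤ 2.76 * (s * (D * (s * a) * ℓ ^ 2)) := by gcongr
      _ = 2.76 * (D * s ^ 2 * a * ℓ ^ 2) := by ring
      _ ≤ _ := by gcongr; norm_num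
  linarith

open Classical in
/-- The regret bound for long runs on the good event. -/
theorem regret_le_of_large [Nontrivial S] [Nonempty A] (hM : M.Communicating) {δ : ℝ}
    (hδ : 0 < δ) (hδ1 : δ < 1)
    (hdδ : d = δ / (3 + 3 * (Fintype.card S : ℝ)) / ((Fintype.card S : ℝ) * Fintype.card A))
    (hconf : ModelInConfSets M d H) (hrew : ∀ i ≥ 1, H.rew i ∈ Set.Icc (0 : ℝ) 1) {T : ℕ}
    (hT : 6 ≤ T) (hrun : RunsUpTo δ H pl T)
    (hST : (Fintype.card S : ℝ) ^ 2 * Fintype.card A ≤ T)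
    (hgrow : Real.log T * Real.log (1.12 * T) ≤ Real.log 1.12 ^ 2 * √((T : ℝ) + 1))
    {Λ : ℝ} (hΛ : Λ = Real.log (6 * (Fintype.card S : ℝ) ^ 2 * Fintype.card A
      * √((T : ℝ) + 1) / δ))
    (hR : ∑ t ∈ Finset.Icc 1 T, (if IsLate (lossScale M) (episodeStart H pl t - 1) then
          M.mean (H.st t) (H.act t) - H.rew t else 0) ≤ √((T + 1) / 2 * Λ))
    (hB : ∑ t ∈ Finset.Icc 1 T, (if IsLate (lossScale M) (episodeStart H pl t - 1) then
          ∑ z, M.p (H.st t) (H.act t) z * chosenBias M d (episodeData H pl t) z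
            - chosenBias M d (episodeData H pl t) (H.st (t + 1)) else 0) ≤
          1.38 * M.diam * √((T + 1) / 2 * Λ)) :
    regret M H T ≤
      (5 * √(∑ s, ∑ a, M.localDiam s ^ 2 * M.effSupp s a)
          + 10 * √((Fintype.card S : ℝ) * Fintype.card A) + 2 * M.diam) * √(T * Λ)
      + 60 * M.diam * M.maxSuccs * (Fintype.card S : ℝ) ^ (2 / 3 : ℝ)
          * (Fintype.card A : ℝ) ^ (2 / 3 : ℝ) * (T : ℝ) ^ (1 / 3 : ℝ)
      + 20100 * (M.diam * (Fintype.card S : ℝ) ^ 2 * Fintype.card A * Real.log (T / δ) ^ 2) := by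
  have hD := hM.one_le_diam
  have hS : (2 : ℝ) ≤ Fintype.card S := by exact_mod_cast Fintype.one_lt_card (α := S)
  have hA : (1 : ℝ) ≤ Fintype.card A := by exact_mod_cast Fintype.card_pos (α := A)
  obtain ⟨hd, hd1, hβ, hell, hΛ1, hΛℓ, hlogT, hℓ1⟩ :=
    log_factors hS hA hδ hδ1 hdδ hT hST hgrow
  rw [← hΛ] at hβ hell hΛ1 hΛℓ
  have hTr : (6 : ℝ) ≤ T := by exact_mod_cast hT
  have hlow := lower_order_le hD hS hA (by linarith) hΛℓ (Real.log_natCast_nonneg T) hlogT hℓ1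
  have hsum := sum_surplus_le hM hd hd1 (by omega : 1 ≤ T) (fun t ht => (hrun t ht).1)
    (fun t ht => (hrun t ht).2.2) hΛ1 hβ hell
  have hreg := regret_le_sum hM hd hd1 hdδ hconf hrew (by omega : 1 ≤ T) hrun
  have hTY : √(T : ℝ) ≤ √(T * Λ) := Real.sqrt_le_sqrt (le_mul_of_one_le_right (by linarith) hΛ1)
  have hmart : √((T + 1) / 2 * Λ) ≤ 0.82 * √(T * Λ) := by
    rw [Real.sqrt_le_left (by positivity), mul_pow, Real.sq_sqrt (by positivity)]
    have : ((T : ℝ) + 1) / 2 ≤ 0.82 ^ 2 * T := by norm_num; linarith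
    calc _ ≤ 0.82 ^ 2 * T * Λ := by gcongr
      _ = _ := by ring
  have hsa1 : 1 ≤ √((Fintype.card S : ℝ) * Fintype.card A) := by
    rw [Real.one_le_sqrt]; nlinarith
  have hYsa := le_mul_of_one_le_left (Real.sqrt_nonneg (T * Λ)) hsa1
  have hls : 60 * lossScale M * (T : ℝ) ^ (1 / 3 : ℝ) = 60 * M.diam * M.maxSuccs *
      (Fintype.card S : ℝ) ^ (2 / 3 : ℝ) * (Fintype.card A : ℝ) ^ (2 / 3 : ℝ)
        * (T : ℝ) ^ (1 / 3 : ℝ) := by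
    rw [lossScale, Nat.cast_mul, Real.mul_rpow (Nat.cast_nonneg _) (Nat.cast_nonneg _)]
    ring
  rw [Nat.cast_mul, hls] at hreg
  have hBm := mul_le_mul_of_nonneg_left hmart (by positivity : 0 ≤ 1.38 * M.diam)
  have hDY : 0 ≤ M.diam * √(T * Λ) := by positivity
  refine hreg.trans ((add_le_add (add_le_add (add_le_add (add_le_add le_rfl hsum)
    (hR.trans hmart)) (hB.trans hBm)) le_rfl).trans ?_)
  generalize √(∑ s, ∑ a, M.localDiam s ^ 2 * M.effSupp s a) = z
  linarith [Real.sqrt_nonneg (T * Λ)]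

end Bounds

end UCRL3

/-! ### Probability of the good event and conclusion -/

namespace UCRL3

section Growth

theorem eventually_log_sq_le {c : ℝ} (hc : 0 < c) :
    ∀ᶠ x : ℝ in atTop, Real.log x ^ 2 ≤ c * √x := by
  have h := (isLittleO_log_rpow_atTop (by norm_num : (0 : ℝ) < 1 / 4)).bound (Real.sqrt_pos.2 hc)
  filter_upwards [h, eventually_ge_atTop 1] with x hx h1
  rw [Real.norm_of_nonneg (Real.log_nonneg h1), Real.norm_of_nonneg (by positivity)] at hx
  calc Real.log x ^ 2 ≤ (√c * x ^ (1 / 4 : ℝ)) ^ 2 :=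
        pow_le_pow_left₀ (Real.log_nonneg h1) hx 2
    _ = c * √x := by
        rw [mul_pow, Real.sq_sqrt hc.le, ← Real.rpow_natCast, ← Real.rpow_mul (by linarith),
          Real.sqrt_eq_rpow]
        norm_num

/-- From some time on the iterated-logarithm level of the confidence sets is at most the level of
the bound. -/
theorem exists_growth : ∃ T₁ : ℕ, 6 ≤ T₁ ∧ ∀ T : ℕ, T₁ ≤ T →
    Real.log T * Real.log (1.12 * T) ≤ Real.log 1.12 ^ 2 * √((T : ℝ) + 1) := by
  have hl : 0 < Real.log 1.12 := Real.log_pos (by norm_num)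
  have h1 := eventually_log_sq_le (c := Real.log 1.12 ^ 2 / 2) (by positivity)
  have h2 : Tendsto (fun T : ℕ => 1.12 * (T : ℝ)) atTop atTop :=
    tendsto_natCast_atTop_atTop.const_mul_atTop (by norm_num)
  obtain ⟨T₁, hT₁⟩ := eventually_atTop.1 (h2.eventually h1)
  refine ⟨max T₁ 6, le_max_right _ _, fun T hT => ?_⟩
  have h6 : (6 : ℝ) ≤ T := by exact_mod_cast (le_max_right _ _).trans hT
  have h3 := hT₁ T ((le_max_left _ _).trans hT)
  have h4 : Real.log T ≤ Real.log (1.12 * T) := Real.log_le_log (by linarith) (by linarith)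
  have h5 : √(1.12 * (T : ℝ)) ≤ 2 * √((T : ℝ) + 1) := by
    rw [Real.sqrt_le_left (by positivity), mul_pow, Real.sq_sqrt (by positivity)]
    linarith
  calc Real.log T * Real.log (1.12 * T) ≤ Real.log (1.12 * T) * Real.log (1.12 * T) := by
        gcongr
        exact Real.log_nonneg (by linarith)
    _ ≤ Real.log 1.12 ^ 2 / 2 * √(1.12 * (T : ℝ)) := by rw [← sq]; exact h3
    _ ≤ Real.log 1.12 ^ 2 / 2 * (2 * √((T : ℝ) + 1)) := by gcongr
    _ = _ := by ring

/-- From some time on the leading term dominates the others. -/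
theorem exists_leading {δ s a K C : ℝ} (hδ : 0 < δ) (hδ1 : δ < 1) (hs : 2 ≤ s) (ha : 1 ≤ a)
    (hC : 0 < C) : ∃ T₀ : ℕ, ∀ T : ℕ, T₀ ≤ T →
      Real.log (6 * s ^ 2 * a * √((T : ℝ) + 1) / δ) ≤ 2 * Real.log (√(T : ℝ) / δ) ∧
      60 * K * s ^ (2 / 3 : ℝ) * a ^ (2 / 3 : ℝ) * (T : ℝ) ^ (1 / 3 : ℝ) ≤
        √(T * Real.log (√(T : ℝ) / δ)) ∧
      C * (s ^ 2 * a * Real.log (T / δ) ^ 2) ≤ √(T * Real.log (√(T : ℝ) / δ)) := by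
  have hk : 0 < C * (s ^ 2 * a) := by positivity
  have e1 : ∀ᶠ T : ℕ in atTop, max 9 (72 * s ^ 4 * a ^ 2) ≤ (T : ℝ) :=
    tendsto_natCast_atTop_atTop.eventually_ge_atTop _
  have e2 : ∀ᶠ T : ℕ in atTop, 60 * K * s ^ (2 / 3 : ℝ) * a ^ (2 / 3 : ℝ) ≤
      (T : ℝ) ^ (1 / 6 : ℝ) :=
    ((tendsto_rpow_atTop (by norm_num : (0 : ℝ) < 1 / 6)).comp
      tendsto_natCast_atTop_atTop).eventually_ge_atTop _
  have e3 : ∀ᶠ T : ℕ in atTop, Real.log ((T : ℝ) / δ) ^ 2 ≤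
      √δ / (C * (s ^ 2 * a)) * √((T : ℝ) / δ) :=
    (tendsto_natCast_atTop_atTop.atTop_div_const hδ).eventually
      (eventually_log_sq_le (by positivity))
  obtain ⟨T₀, hT₀⟩ := eventually_atTop.1 (e1.and (e2.and e3))
  refine ⟨T₀, fun T hT => ?_⟩
  obtain ⟨h1, h2, h3⟩ := hT₀ T hT
  have h9 : (9 : ℝ) ≤ T := (le_max_left _ _).trans h1
  have h72 : 72 * s ^ 4 * a ^ 2 ≤ (T : ℝ) := (le_max_right _ _).trans h1
  have h3T : 3 ≤ √(T : ℝ) := by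
    rw [Real.le_sqrt (by norm_num) (by linarith)]; linarith
  have hlog : 1 ≤ Real.log (√(T : ℝ) / δ) := by
    rw [Real.le_log_iff_exp_le (by positivity), le_div_iff₀ hδ]
    nlinarith [Real.exp_one_lt_d9, Real.exp_pos 1]
  have hY : √(T : ℝ) ≤ √(T * Real.log (√(T : ℝ) / δ)) :=
    Real.sqrt_le_sqrt (le_mul_of_one_le_right (by linarith) hlog)
  refine ⟨?_, le_trans ?_ hY, le_trans ?_ hY⟩
  · have : 2 * Real.log (√(T : ℝ) / δ) = Real.log ((√(T : ℝ) / δ) ^ 2) := by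
      rw [Real.log_pow]; norm_num
    rw [this]
    refine Real.log_le_log (by positivity) ?_
    have h4 : 6 * s ^ 2 * a * √((T : ℝ) + 1) ≤ T := by
      refine (sq_le_sq₀ (by positivity) (by linarith)).1 ?_
      rw [mul_pow, Real.sq_sqrt (by linarith)]
      calc (6 * s ^ 2 * a) ^ 2 * ((T : ℝ) + 1) ≤ (6 * s ^ 2 * a) ^ 2 * (2 * T) := by
            gcongr; linarith
        _ = (72 * s ^ 4 * a ^ 2) * T := by ring
        _ ≤ (T : ℝ) * T := by gcongr
        _ = _ := by ring
    rw [div_pow, Real.sq_sqrt (by linarith)]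
    have h5 : δ ^ 2 ≤ δ := by nlinarith
    gcongr
  · calc 60 * K * s ^ (2 / 3 : ℝ) * a ^ (2 / 3 : ℝ) * (T : ℝ) ^ (1 / 3 : ℝ) ≤
          (T : ℝ) ^ (1 / 6 : ℝ) * (T : ℝ) ^ (1 / 3 : ℝ) := by gcongr
      _ = √(T : ℝ) := by
          rw [← Real.rpow_add (by linarith), Real.sqrt_eq_rpow]; norm_num
  · calc C * (s ^ 2 * a * Real.log (T / δ) ^ 2) = C * (s ^ 2 * a) * Real.log (T / δ) ^ 2 := by ring
      _ ≤ C * (s ^ 2 * a) * (√δ / (C * (s ^ 2 * a)) * √((T : ℝ) / δ)) := by gcongr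
      _ = √(T : ℝ) := by
          rw [Real.sqrt_div (by linarith)]
          have := Real.sqrt_pos.2 hδ
          field_simp

end Growth

section Probability

variable {S A Ω : Type*} [Fintype S] [DecidableEq S] [Fintype A] [DecidableEq A]
  {mΩ : MeasurableSpace Ω} {M : MDP S A}
  {P : Measure Ω} {ℱ : Filtration ℕ mΩ} {h : Ω → Trajectory S A} {pol : Ω → ℕ → S → A}

/-- The level of the single confidence bounds. -/
def level (S A : Type*) [Fintype S] [Fintype A] (δ : ℝ) : ℝ :=
  δ / (3 + 3 * (Fintype.card S : ℝ)) / ((Fintype.card S : ℝ) * Fintype.card A)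

theorem level_pos [Nonempty S] [Nonempty A] {δ : ℝ} (hδ : 0 < δ) : 0 < level S A δ := by
  have : (0 : ℝ) < Fintype.card S := by exact_mod_cast Fintype.card_pos (α := S)
  have : (0 : ℝ) < Fintype.card A := by exact_mod_cast Fintype.card_pos (α := A)
  unfold level
  positivity

theorem level_le [Nonempty S] [Nonempty A] {δ : ℝ} (hδ : 0 < δ) : level S A δ ≤ δ := by
  have h1 : (1 : ℝ) ≤ Fintype.card S := by exact_mod_cast Fintype.card_pos (α := S)
  have h2 : (1 : ℝ) ≤ Fintype.card A := by exact_mod_cast Fintype.card_pos (α := A)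
  have h3 := one_le_mul_of_one_le_of_one_le h1 h2
  unfold level
  rw [div_div]
  exact div_le_self hδ.le (one_le_mul_of_one_le_of_one_le (by linarith) h3)

open Classical in
/-- The good event: the model is plausible at all times, the rewards lie in the unit interval and
both martingales obey their bounds. -/
def GoodEvent (M : MDP S A) (δ : ℝ) (H : Trajectory S A) (pl : ℕ → S → A) : Prop :=
  ModelInConfSets M (level S A δ) H ∧ (∀ i ≥ 1, H.rew i ∈ Set.Icc (0 : ℝ) 1) ∧
  ∀ (T : ℕ) (Λ : ℝ), 1 ≤ T → Real.log (√((T : ℝ) + 1) / δ) ≤ Λ →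
    ∑ t ∈ Finset.Icc 1 T, (if IsLate (lossScale M) (episodeStart H pl t - 1) then
      M.mean (H.st t) (H.act t) - H.rew t else 0) ≤ √((T + 1) / 2 * Λ) ∧
    ∑ t ∈ Finset.Icc 1 T, (if IsLate (lossScale M) (episodeStart H pl t - 1) then
      ∑ z, M.p (H.st t) (H.act t) z * chosenBias M (level S A δ) (episodeData H pl t) z
        - chosenBias M (level S A δ) (episodeData H pl t) (H.st (t + 1)) else 0) ≤
      1.38 * M.diam * √((T + 1) / 2 * Λ)

open Classical in
/-- The level in the time-uniform bound is monotone in the number of summands. -/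
theorem psum_le_of_not_lt {I : ℕ → Set Ω} {X : ℕ → Ω → ℝ} {B δ Λ : ℝ} {T : ℕ} {ω : Ω}
    (hB : 0 ≤ B) (hδ : 0 < δ) (hΛ0 : 0 ≤ Λ) (hΛ : Real.log (√((T : ℝ) + 1) / δ) ≤ Λ)
    (h : ¬ √(2 * (B ^ 2 / 4) * (cnt I (T + 1) ω + 1)
      * Real.log (√((cnt I (T + 1) ω : ℝ) + 1) / δ)) < psum I X (T + 1) ω) :
    ∑ t ∈ Finset.Icc 1 T, (if ω ∈ I t then X t ω else 0) ≤ B * √((T + 1) / 2 * Λ) := by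
  have hc : (cnt I (T + 1) ω : ℝ) ≤ T := by
    have : cnt I (T + 1) ω ≤ T := (Finset.card_filter_le _ _).trans (by simp)
    exact_mod_cast this
  have he : ∑ t ∈ Finset.Icc 1 T, (if ω ∈ I t then X t ω else 0) = psum I X (T + 1) ω := by
    rw [psum, Finset.sum_filter]
    rfl
  rw [he]
  refine (not_lt.1 h).trans ?_
  rw [← Real.sqrt_sq hB, ← Real.sqrt_mul (sq_nonneg B), Real.sqrt_sq hB]
  refine Real.sqrt_le_sqrt ?_
  have h1 : Real.log (√((cnt I (T + 1) ω : ℝ) + 1) / δ) ≤ Λ := by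
    refine (Real.log_le_log (by positivity) ?_).trans hΛ
    gcongr
  calc _ ≤ 2 * (B ^ 2 / 4) * ((cnt I (T + 1) ω : ℝ) + 1) * Λ := by gcongr
    _ = B ^ 2 * (((cnt I (T + 1) ω : ℝ) + 1) / 2 * Λ) := by ring
    _ ≤ _ := by gcongr

theorem measure_le_of_subset_union {E E₁ E₂ E₃ E₄ : Set Ω} {a b c : ℝ≥0∞} (h₁ : P E₁ ≤ a)
    (h₂ : P E₂ = 0) (h₃ : P E₃ ≤ b) (h₄ : P E₄ ≤ c) (h : E ⊆ (E₁ ∪ E₂) ∪ (E₃ ∪ E₄)) :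
    P E ≤ a + (b + c) := by
  calc P E ≤ (P E₁ + P E₂) + (P E₃ + P E₄) := (measure_mono h).trans
        ((measure_union_le _ _).trans (add_le_add (measure_union_le _ _) (measure_union_le _ _)))
    _ ≤ (a + 0) + (b + c) := by gcongr; exact h₂.le
    _ = _ := by rw [add_zero]

theorem measure_not_goodEvent_le [Nontrivial S] [Nonempty A] [IsProbabilityMeasure P]
    (hM : M.Communicating) (hi : IsInteraction M P ℱ h)
    (hpol : ∀ t ≥ 1, ∀ π : S → A, MeasurableSet[ℱ t] {ω | pol ω t = π})
    {δ : ℝ} (hδ : 0 < δ) (hδ1 : δ < 1) :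
    P {ω | ¬ GoodEvent M δ (h ω) (pol ω)} ≤ ENNReal.ofReal (4 * δ) := by
  have hD := hM.one_le_diam
  set late : ℕ → Prop := fun e => IsLate (lossScale M) (e - 1) with hlate
  have h1 := measure_not_modelInConfSets hi (level_pos (S := S) (A := A) hδ)
    ((level_le hδ).trans hδ1.le)
  have h2 := rewards_mem_Icc hi
  have h3 := martingale_reward hi hpol late hδ
  have h4 := martingale_bias hi hpol late (chosenBias M (level S A δ))
    (B := 1.38 * M.diam) (by positivity) (chosenBias_sub_le hM _) hδ
  refine (measure_le_of_subset_union h1 h2 h3 h4 ?_).trans ?_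
  · intro ω hω
    by_contra hn
    simp only [Set.mem_union, not_or] at hn
    obtain ⟨⟨n1, n2⟩, n3, n4⟩ := hn
    refine hω ⟨not_not.1 n1, not_not.1 n2, fun T Λ hT hΛ => ?_⟩
    have hΛ0 := (log_level_pos hT hδ hδ1.le).le.trans hΛ
    constructor
    · have n3' := fun hc => n3 ⟨T + 1, Nat.le_add_left 1 T, hc⟩
      have := psum_le_of_not_lt (B := 1) zero_le_one hδ hΛ0 hΛ (by simpa using n3')
      simpa using this
    · have n4' := fun hc => n4 ⟨T + 1, Nat.le_add_left 1 T, hc⟩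
      have := psum_le_of_not_lt (by positivity) hδ hΛ0 hΛ n4'
      simpa using this
  have hS : (0 : ℝ) < Fintype.card S := by exact_mod_cast Fintype.card_pos (α := S)
  have hA : (0 : ℝ) < Fintype.card A := by exact_mod_cast Fintype.card_pos (α := A)
  have hl := level_pos (S := S) (A := A) hδ
  rw [← ENNReal.ofReal_add hδ.le hδ.le, ← ENNReal.ofReal_add (by positivity)
    (by positivity)]
  refine ENNReal.ofReal_le_ofReal ?_
  have : (2 + 4 * (Fintype.card S : ℝ)) * ((Fintype.card S : ℝ) * Fintype.card A) * level S A δ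
      ≤ 2 * δ := by
    rw [level]
    have e : (2 + 4 * (Fintype.card S : ℝ)) * ((Fintype.card S : ℝ) * Fintype.card A) *
        (δ / (3 + 3 * (Fintype.card S : ℝ)) / ((Fintype.card S : ℝ) * Fintype.card A)) =
        (2 + 4 * (Fintype.card S : ℝ)) * δ / (3 + 3 * (Fintype.card S : ℝ)) := by
      field_simp
    rw [e, div_le_iff₀ (by positivity)]
    nlinarith
  linarith

end Probability

end UCRL3

namespace UCRL3

section Conclusion

variable {S A : Type*} [Fintype S] [DecidableEq S] [Fintype A] [DecidableEq A]
  [Nontrivial S] [Nonempty A] {M : MDP S A} {H : Trajectory S A} {pl : ℕ → S → A} {δ : ℝ}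

/-- The first regret bound on the good event; short runs are covered by the term of lower order,
because the regret is at most the number of steps. -/
theorem GoodEvent.regret_le {T₁ : ℕ} (hT₁ : 6 ≤ T₁) (hgrow : ∀ T : ℕ, T₁ ≤ T →
      Real.log T * Real.log (1.12 * T) ≤ Real.log 1.12 ^ 2 * √((T : ℝ) + 1))
    (hM : M.Communicating) (hδ : 0 < δ) (hδ1 : δ < 1) (hgood : GoodEvent M δ H pl) {T : ℕ}
    (hT : 3 ≤ T) (hrun : RunsUpTo δ H pl T) :
    regret M H T ≤
      (5 * √(∑ s, ∑ a, M.localDiam s ^ 2 * M.effSupp s a)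
          + 10 * √((Fintype.card S : ℝ) * Fintype.card A) + 2 * M.diam)
        * √(T * Real.log (6 * (Fintype.card S : ℝ) ^ 2 * Fintype.card A
            * √((T : ℝ) + 1) / δ))
      + 60 * M.diam * M.maxSuccs * (Fintype.card S : ℝ) ^ (2 / 3 : ℝ)
          * (Fintype.card A : ℝ) ^ (2 / 3 : ℝ) * (T : ℝ) ^ (1 / 3 : ℝ)
      + (20100 + T₁) * (M.diam * (Fintype.card S : ℝ) ^ 2 * Fintype.card A
          * Real.log (T / δ) ^ 2) := by
  obtain ⟨hconf, hrew, hmart⟩ := hgood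
  have hD := hM.one_le_diam
  have hS : (2 : ℝ) ≤ Fintype.card S := by exact_mod_cast Fintype.one_lt_card (α := S)
  have hA : (1 : ℝ) ≤ Fintype.card A := by exact_mod_cast Fintype.card_pos (α := A)
  have hTr : (3 : ℝ) ≤ T := by exact_mod_cast hT
  have hℓ : 1 ≤ Real.log (T / δ) := by
    rw [Real.le_log_iff_exp_le (by positivity), le_div_iff₀ hδ]
    nlinarith [Real.exp_one_lt_d9, Real.exp_pos 1]
  set V := (Fintype.card S : ℝ) ^ 2 * Fintype.card A with hV
  set W := M.diam * (Fintype.card S : ℝ) ^ 2 * Fintype.card A * Real.log (T / δ) ^ 2 with hW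
  have hV1 : 1 ≤ V := one_le_mul_of_one_le_of_one_le (one_le_pow₀ (by linarith)) hA
  have hWV : V ≤ W := by
    calc V ≤ V * (M.diam * Real.log (T / δ) ^ 2) := le_mul_of_one_le_right (by linarith)
          (one_le_mul_of_one_le_of_one_le hD (one_le_pow₀ hℓ))
      _ = W := by rw [hV, hW]; ring
  by_cases hlarge : T₁ ≤ T ∧ V ≤ T
  · set Λ := Real.log (6 * (Fintype.card S : ℝ) ^ 2 * Fintype.card A * √((T : ℝ) + 1) / δ)
      with hΛ
    have hlev : Real.log (√((T : ℝ) + 1) / δ) ≤ Λ := by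
      refine Real.log_le_log (by positivity) ?_
      gcongr
      refine le_mul_of_one_le_left (Real.sqrt_nonneg _) ?_
      rw [mul_assoc]
      linarith
    obtain ⟨hR, hB⟩ := hmart T Λ (by omega) hlev
    have := regret_le_of_large hM hδ hδ1 rfl hconf hrew (hT₁.trans hlarge.1) hrun hlarge.2
      (hgrow T hlarge.1) hΛ hR hB
    refine this.trans (add_le_add le_rfl (mul_le_mul_of_nonneg_right ?_ (by linarith)))
    linarith [(Nat.cast_nonneg T₁ : (0 : ℝ) ≤ T₁)]
  · have hTW : (T : ℝ) ≤ (20100 + T₁) * W := by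
      have h0 : (0 : ℝ) ≤ T₁ := Nat.cast_nonneg T₁
      rw [not_and_or, not_le, not_le] at hlarge
      rcases hlarge with h | h
      · have : (T : ℝ) < T₁ := by exact_mod_cast h
        nlinarith
      · nlinarith
    have := regret_le_self (M := M) hrew T
    have h1 : 0 ≤ (5 * √(∑ s, ∑ a, M.localDiam s ^ 2 * M.effSupp s a)
          + 10 * √((Fintype.card S : ℝ) * Fintype.card A) + 2 * M.diam)
        * √(T * Real.log (6 * (Fintype.card S : ℝ) ^ 2 * Fintype.card A
            * √((T : ℝ) + 1) / δ)) :=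
      mul_nonneg (add_nonneg (add_nonneg (mul_nonneg (by norm_num) (Real.sqrt_nonneg _))
        (mul_nonneg (by norm_num) (Real.sqrt_nonneg _))) (by linarith)) (Real.sqrt_nonneg _)
    have h2 : 0 ≤ 60 * M.diam * M.maxSuccs * (Fintype.card S : ℝ) ^ (2 / 3 : ℝ)
          * (Fintype.card A : ℝ) ^ (2 / 3 : ℝ) * (T : ℝ) ^ (1 / 3 : ℝ) := by positivity
    linarith

/-- For long runs the leading term of the first bound dominates. -/
theorem leading_regret_le (hM : M.Communicating) {T : ℕ} {C R Λ Λ' : ℝ} (hΛ : Λ ≤ 2 * Λ')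
    (hK : 60 * M.maxSuccs * (Fintype.card S : ℝ) ^ (2 / 3 : ℝ)
        * (Fintype.card A : ℝ) ^ (2 / 3 : ℝ) * (T : ℝ) ^ (1 / 3 : ℝ) ≤ √(T * Λ'))
    (hC : C * ((Fintype.card S : ℝ) ^ 2 * Fintype.card A * Real.log (T / δ) ^ 2) ≤ √(T * Λ'))
    (hR : R ≤ (5 * √(∑ s, ∑ a, M.localDiam s ^ 2 * M.effSupp s a)
          + 10 * √((Fintype.card S : ℝ) * Fintype.card A) + 2 * M.diam) * √(T * Λ)
      + 60 * M.diam * M.maxSuccs * (Fintype.card S : ℝ) ^ (2 / 3 : ℝ)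
          * (Fintype.card A : ℝ) ^ (2 / 3 : ℝ) * (T : ℝ) ^ (1 / 3 : ℝ)
      + C * (M.diam * (Fintype.card S : ℝ) ^ 2 * Fintype.card A * Real.log (T / δ) ^ 2)) :
    R ≤ 24 * ((√(∑ s, ∑ a, max (M.localDiam s ^ 2 * M.effSupp s a) 1) + M.diam)
      * √(T * Λ')) := by
  have hD := hM.one_le_diam
  set Q := √(∑ s, ∑ a, max (M.localDiam s ^ 2 * M.effSupp s a) 1) with hQ
  set Y := √(T * Λ') with hY
  have hY0 : 0 ≤ Y := Real.sqrt_nonneg _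
  have hQ1 : √(∑ s, ∑ a, M.localDiam s ^ 2 * M.effSupp s a) ≤ Q :=
    Real.sqrt_le_sqrt (Finset.sum_le_sum fun s _ => Finset.sum_le_sum fun a _ => le_max_left _ _)
  have hQ2 : √((Fintype.card S : ℝ) * Fintype.card A) ≤ Q := by
    refine Real.sqrt_le_sqrt ?_
    calc (Fintype.card S : ℝ) * Fintype.card A = ∑ _s : S, ∑ _a : A, (1 : ℝ) := by simp
      _ ≤ _ := Finset.sum_le_sum fun s _ => Finset.sum_le_sum fun a _ => le_max_right _ _
  have hQ0 : 0 ≤ Q := Real.sqrt_nonneg _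
  have hΛY : √(T * Λ) ≤ 1.42 * Y := by
    calc √(T * Λ) ≤ √(1.42 ^ 2 * (T * Λ')) := by
          rcases le_or_gt 0 Λ with h | h
          · refine Real.sqrt_le_sqrt ?_
            have : (T : ℝ) * Λ ≤ T * (2 * Λ') := by gcongr
            have h0 : 0 ≤ (T : ℝ) * Λ' := by
              have : 0 ≤ Λ' := by linarith
              positivity
            linarith
          · rw [Real.sqrt_eq_zero_of_nonpos
              (mul_nonpos_of_nonneg_of_nonpos (Nat.cast_nonneg T) h.le)]
            positivity
      _ = 1.42 * Y := by rw [Real.sqrt_mul (by positivity), Real.sqrt_sq (by norm_num)]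
  have h1 : (5 * √(∑ s, ∑ a, M.localDiam s ^ 2 * M.effSupp s a)
      + 10 * √((Fintype.card S : ℝ) * Fintype.card A) + 2 * M.diam) * √(T * Λ) ≤
      (15 * Q + 2 * M.diam) * (1.42 * Y) :=
    mul_le_mul (by linarith) hΛY (Real.sqrt_nonneg _) (by linarith)
  have h2 := mul_le_mul_of_nonneg_left hK (by linarith : 0 ≤ M.diam)
  have h3 := mul_le_mul_of_nonneg_left hC (by linarith : 0 ≤ M.diam)
  have h4 : 0 ≤ Q * Y := mul_nonneg hQ0 hY0
  have h5 : 0 ≤ M.diam * Y := mul_nonneg (by linarith) hY0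
  linarith

end Conclusion

end UCRL3

end

theorem theorem1 :
    ∃ C₁ C₂ : ℝ, 0 < C₁ ∧ 0 < C₂ ∧
      ∀ (S A : Type*) [Fintype S] [DecidableEq S] [Nontrivial S]
        [Fintype A] [DecidableEq A] [Nonempty A]
        (M : MDP S A), M.Communicating →
      ∀ δ : ℝ, 0 < δ → δ < 1 →
      ∃ T₀ : ℕ,
      ∀ (Ω : Type*) (mΩ : MeasurableSpace Ω) (P : Measure Ω) [IsProbabilityMeasure P]
        (ℱ : Filtration ℕ mΩ) (h : Ω → Trajectory S A) (pol : Ω → ℕ → S → A),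
        IsInteraction M P ℱ h →
        (∀ t ≥ 1, ∀ π : S → A, MeasurableSet[ℱ t] {ω | pol ω t = π}) →
        P {ω | ¬ ∀ T : ℕ, 3 ≤ T → UCRL3.RunsUpTo δ (h ω) (pol ω) T →
            regret M (h ω) T ≤
              (5 * √(∑ s, ∑ a, M.localDiam s ^ 2 * M.effSupp s a)
                  + 10 * √((Fintype.card S : ℝ) * Fintype.card A) + 2 * M.diam)
                * √(T * Real.log (6 * (Fintype.card S : ℝ) ^ 2 * Fintype.card A
                    * √((T : ℝ) + 1) / δ))
              + 60 * M.diam * M.maxSuccs * (Fintype.card S : ℝ) ^ (2 / 3 : ℝ)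
                  * (Fintype.card A : ℝ) ^ (2 / 3 : ℝ) * (T : ℝ) ^ (1 / 3 : ℝ)
              + C₁ * (M.diam * (Fintype.card S : ℝ) ^ 2 * Fintype.card A
                  * Real.log (T / δ) ^ 2) ∧
            (T₀ ≤ T → regret M (h ω) T ≤
              C₂ * ((√(∑ s, ∑ a, max (M.localDiam s ^ 2 * M.effSupp s a) 1) + M.diam)
                * √(T * Real.log (√(T : ℝ) / δ))))}
          ≤ ENNReal.ofReal (4 * δ) := by
  obtain ⟨T₁, hT₁, hgrow⟩ := UCRL3.exists_growth
  have hC : (0 : ℝ) < 20100 + T₁ := by positivity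
  refine ⟨20100 + T₁, 24, hC, by norm_num, ?_⟩
  intro S A _ _ _ _ _ _ M hM δ hδ hδ1
  have hS : (2 : ℝ) ≤ Fintype.card S := by exact_mod_cast Fintype.one_lt_card (α := S)
  have hA : (1 : ℝ) ≤ Fintype.card A := by exact_mod_cast Fintype.card_pos (α := A)
  obtain ⟨T₀, hT₀⟩ := UCRL3.exists_leading (K := M.maxSuccs) hδ hδ1 hS hA hC
  refine ⟨T₀, ?_⟩
  intro Ω mΩ P _ ℱ h pol hi hpol
  refine (measure_mono fun ω hω => ?_).trans (UCRL3.measure_not_goodEvent_le hM hi hpol hδ hδ1)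
  intro hgood
  refine hω fun T hT hrun => ?_
  have h1 := hgood.regret_le hT₁ hgrow hM hδ hδ1 hT hrun
  refine ⟨h1, fun hTT => ?_⟩
  obtain ⟨h2, h3, h4⟩ := hT₀ T hTT
  exact UCRL3.leading_regret_le hM h2 h3 h4 h1
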